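/- **Model.** There are $M\ge1$ LLMs and a hidden hypothesis $\theta\in\{A,B\}$ with prior $\xi_A\in(0,1)$, $\xi_B=1-\xi_A$. Under $\theta$, each query of LLM $j$ returns the answer $\theta$ with probability $\gamma_{j,\theta}\in(1/2,1)$ and the other label otherwise; it costs $c_j>0$ and takes a nonnegative random time with mean $\mu_j\in(0,\infty)$ and sub-Gaussian law: for some $\psi>0$, $\mathbb E[e^{\lambda(T_{j,t}-\mu_j)}]\le e^{\psi^2\lambda^2/2}$ for all $\lambda\in\mathbb R$ and all $j$. Waiting times of LLM $j$ are i.i.d.; given $\theta$, all answers and all waiting times are independent, and waiting times do not depend on $\theta$. The waiting penalty is $g(x)=cx^\rho$ with $c\ge0$, $\rho\ge1$. Let $\ell_j(y)=\log\frac{\mathbb P(Y=y\mid A,j)}{\mathbb P(Y=y\mid B,j)}$, $I_{j,A}=\mathbb E_A[\ell_j(Y)]$, $I_{j,B}=-\mathbb E_B[\ell_j(Y)]$, $\delta=\log(\xi_A/\xi_B)$, $A_\alpha=\log\frac{1-\alpha}{\alpha}-\delta$, $B_\alpha=\log\frac{1-\alpha}{\alpha}+\delta$. An admissible policy $\pi\in\Pi(\alpha)$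 chooses the LLM $j_t$ of query $t$ as a measurable function of the previously selected LLMs, answers and waiting times, and stops at $\tau=\inf\{t\ge0: L_t\ge A_\alpha\text{ or }L_t\le-B_\alpha\}$, where $L_t=\sum_{s\le t}\ell_{j_s}(Y_s)$ (equivalently, when the posterior probability of one hypothesis is at least $1-\alpha$). With $C_\pi=\sum_{t\le\tau}c_{j_t}$ and $W_\pi=\sum_{t\le\tau}T_{j_t,t}$, put $\mathcal R(\pi;\alpha)=\mathbb E[C_\pi]+\mathbb E[g(W_\pi)]\in[0,\infty]$. The sign-based two-LLM policy $\pi^{(2)}_{j_A,j_B}(\alpha)$ is the admissible policy that queries $j_A$ when $L_{t-1}\ge0$ and $j_B$ when $L_{t-1}<0$. **Benchmark.** Let $C_\ell=\max_{j,y}|\ell_j(y)|$, $K_\alpha=2\max\{\xi_A/\xi_B,\xi_B/\xi_A\}\,\alpha\,(A_\alpha+B_\alpha+C_\ell)$, $S_A=A_\alpha-K_\alpha$, $S_B=B_\alpha-K_\alpha$, and let $\Phi_\alpha$ be the minimum of $$\sum_{\theta\in\{A,B\}}\xi_\theta\Big(\sum_j c_jn_{j,\theta}+g\big(\sum_j\mu_jn_{j,\theta}\big)\Big)$$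 over all $n_{j,\theta}\ge0$ with $\sum_jI_{j,\theta}n_{j,\theta}\ge S_\theta$ for $\theta=A,B$. **Theorem.** (1) There is a pair $(j_A^\star,j_B^\star)\in[M]\times[M]$, not depending on $\alpha$, such that $\pi=\pi^{(2)}_{j_A^\star,j_B^\star}(\alpha)$ has finite expected cost for all small $\alpha$ and $$\mathbb E[C_\pi]+\mathbb E[g(W_\pi)]=\Phi_\alpha+O\big((\log(1/\alpha))^{\rho-1}\big)\qquad(\alpha\to0).$$ (2) Suppose that either $\rho>1$ and $c>0$, or $\rho=1$ and the following non-degeneracy holds: for some $\theta\in\{A,B\}$, with $\theta'$ the other label, a single LLM $j$ uniquely minimizes $(c_i+c\mu_i)/I_{i,\theta}$ over $i\in[M]$, and $|\ell_j(\theta')|$ is not an integer multiple of $|\ell_j(\theta)|$. Then the remainder order is tight: there is $k>0$ such that, for all sufficiently small $\alpha>0$, every admissible policy $\pi\in\Pi(\alpha)$, in particular an optimal one, satisfies $$\mathcal R(\pi;\alpha)\ \ge\ \Phi_\alpha+k\,(\log(1/\alpha))^{\rho-1}.$$ -/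

import Mathlib

open MeasureTheory ProbabilityTheory Filter Topology
open scoped ENNReal NNReal

namespace SeqTest

/-- The two hypotheses; the answers of an LLM are also elements of this type. -/
inductive Label where
  | A : Label
  | B : Label
  deriving DecidableEq

namespace Label

/-- The other hypothesis. -/
def other : Label → Label
  | A => B
  | B => A

instance : Fintype Label := ⟨{A, B}, fun x => by cases x <;> simp⟩

instance : MeasurableSpace Label := ⊤

instance : DiscreteMeasurableSpace Label := ⟨fun _ => trivial⟩

end Label

/-- The primitives of the testing problem with `M` LLMs and its standing assumptions. -/
structure Model (M : ℕ) where
  /-- prior probability of hypothesis `A` -/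
  priorA : ℝ
  /-- per-query cost -/
  cost : Fin M → ℝ
  /-- `acc j θ` is the probability that LLM `j` answers `θ` when `θ` is the truth -/
  acc : Fin M → Label → ℝ
  /-- law of one waiting time of LLM `j` -/
  waitLaw : Fin M → Measure ℝ
  /-- coefficient of the waiting penalty `g x = gCoef * x ^ ρ` -/
  gCoef : ℝ
  /-- exponent of the waiting penalty -/
  ρ : ℝ
  priorA_pos : 0 < priorA
  priorA_lt_one : priorA < 1
  cost_pos : ∀ j, 0 < cost j
  acc_gt : ∀ j θ, 1 / 2 < acc j θ
  acc_lt : ∀ j θ, acc j θ < 1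
  waitLaw_prob : ∀ j, IsProbabilityMeasure (waitLaw j)
  waitLaw_nonneg : ∀ j, ∀ᵐ x ∂(waitLaw j), 0 ≤ x
  waitLaw_mean_pos : ∀ j, 0 < ∫ x, x ∂(waitLaw j)
  waitLaw_subgaussian : ∃ ψ : ℝ≥0, 0 < ψ ∧
    ∀ j, HasSubgaussianMGF (fun x => x - ∫ y, y ∂(waitLaw j)) (ψ ^ 2) (waitLaw j)
  gCoef_nonneg : 0 ≤ gCoef
  one_le_ρ : 1 ≤ ρ

attribute [instance] Model.waitLaw_prob

/-- What is observed at one query: the selected LLM, its answer, its waiting time. -/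
abbrev Obs (M : ℕ) : Type := Fin M × Label × ℝ

/-- A sample point: at each time, the answer and the waiting time that each LLM would produce if it
were queried at that time. Time is counted from `0`, so index `t` belongs to query number `t+1`. -/
abbrev Sample (M : ℕ) : Type := ℕ → Fin M → Label × ℝ

/-- A non-anticipative selection policy: the LLM queried next is a measurable function of what has
been observed so far. -/
structure Policy (M : ℕ) where
  select : (t : ℕ) → (Fin t → Obs M) → Fin M
  measurable_select : ∀ t, Measurable (select t)

/-- The first `t` observations when policy `π` is run at the sample point `ω`. -/
def Policy.history {M : ℕ} (π : Policy M) (ω : Sample M) : (t : ℕ) → Fin t → Obs M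
  | 0 => Fin.elim0
  | t + 1 =>
    let h := π.history ω t
    Fin.snoc (α := fun _ => Obs M) h (π.select t h, ω t (π.select t h))

/-- The LLM selected at time index `t`. -/
def Policy.chosen {M : ℕ} (π : Policy M) (ω : Sample M) (t : ℕ) : Fin M :=
  π.select t (π.history ω t)

/-- The waiting time incurred at time index `t`. -/
def Policy.waitAt {M : ℕ} (π : Policy M) (ω : Sample M) (t : ℕ) : ℝ :=
  (ω t (π.chosen ω t)).2

noncomputable section

namespace Model

variable {M : ℕ} (m : Model M)

/-- Prior probabilities. -/
def prior : Label → ℝ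
  | Label.A => m.priorA
  | Label.B => 1 - m.priorA

/-- Mean waiting time of LLM `j`. -/
def meanWait (j : Fin M) : ℝ := ∫ x, x ∂(m.waitLaw j)

/-- Probability that LLM `j` answers `y` under hypothesis `θ`. -/
def outProb (j : Fin M) (θ y : Label) : ℝ :=
  if y = θ then m.acc j θ else 1 - m.acc j θ

/-- Law of an answer of LLM `j` under hypothesis `θ`. -/
def outLaw (j : Fin M) (θ : Label) : Measure Label :=
  ENNReal.ofReal (m.outProb j θ Label.A) • Measure.dirac Label.A
    + ENNReal.ofReal (m.outProb j θ Label.B) • Measure.dirac Label.B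

instance (j : Fin M) (θ : Label) : IsProbabilityMeasure (m.outLaw j θ) := by
  constructor
  have h0 := m.acc_gt j θ
  have h1 := m.acc_lt j θ
  cases θ <;>
    · simp only [outLaw, outProb, Measure.add_apply, Measure.smul_apply, measure_univ, smul_eq_mul,
        mul_one, if_true, reduceCtorEq, if_false]
      rw [← ENNReal.ofReal_add (by linarith) (by linarith)]
      simp

/-- Conditional law of the sample point given hypothesis `θ`: all answers and waiting times
are independent, answers of LLM `j` have law `outLaw j θ`, waiting times of `j` have law
`waitLaw j`. -/
def law (θ : Label) : Measure (Sample M) :=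
  Measure.infinitePi fun _ : ℕ => Measure.pi fun j : Fin M => (m.outLaw j θ).prod (m.waitLaw j)

/-- Expectation of a nonnegative random variable under the Bayes measure. -/
def bayesExp (f : Sample M → ℝ≥0∞) : ℝ≥0∞ :=
  ENNReal.ofReal (m.prior Label.A) * ∫⁻ ω, f ω ∂(m.law Label.A)
    + ENNReal.ofReal (m.prior Label.B) * ∫⁻ ω, f ω ∂(m.law Label.B)

/-- Log-likelihood ratio of `A` versus `B` of the single answer `y` of LLM `j`. -/
def llr (j : Fin M) (y : Label) : ℝ :=
  Real.log (m.outProb j Label.A y / m.outProb j Label.B y)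

/-- Cumulative log-likelihood ratio of a finite list of observations. -/
def histLLR {t : ℕ} (h : Fin t → Obs M) : ℝ := ∑ s, m.llr (h s).1 (h s).2.1

/-- The cumulative log-likelihood ratio `L_t` under policy `π`. -/
def cumLLR (π : Policy M) (ω : Sample M) (t : ℕ) : ℝ := m.histLLR (π.history ω t)

/-- Prior log-odds. -/
def logOdds : ℝ := Real.log (m.prior Label.A / m.prior Label.B)

/-- Upper stopping threshold is `upper α`. -/
def upper (α : ℝ) : ℝ := Real.log ((1 - α) / α) - m.logOdds

/-- Lower stopping threshold is `-lower α`. -/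
def lower (α : ℝ) : ℝ := Real.log ((1 - α) / α) + m.logOdds

/-- Number of queries made by policy `π`: the first `t ≥ 0` at which the log-likelihood ratio leaves
the open interval between the thresholds (`⊤` if there is none). -/
def stopTime (π : Policy M) (α : ℝ) (ω : Sample M) : ℕ∞ :=
  sInf {n : ℕ∞ | ∃ t : ℕ, n = t ∧
    (m.upper α ≤ m.cumLLR π ω t ∨ m.cumLLR π ω t ≤ -m.lower α)}

open Classical in
/-- Total query cost. -/
def totalCost (π : Policy M) (α : ℝ) (ω : Sample M) : ℝ≥0∞ :=
  ∑' t : ℕ, if (t : ℕ∞) < m.stopTime π α ω then ENNReal.ofReal (m.cost (π.chosen ω t)) else 0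

open Classical in
/-- Total waiting time. -/
def totalWait (π : Policy M) (α : ℝ) (ω : Sample M) : ℝ≥0∞ :=
  ∑' t : ℕ, if (t : ℕ∞) < m.stopTime π α ω then ENNReal.ofReal (π.waitAt ω t) else 0

/-- The waiting penalty on `[0, ∞)`. -/
def g (x : ℝ) : ℝ := m.gCoef * x ^ m.ρ

/-- The waiting penalty on `[0, ∞]`. -/
def gE (x : ℝ≥0∞) : ℝ≥0∞ := ENNReal.ofReal m.gCoef * x ^ m.ρ

/-- The objective: expected query cost plus expected waiting penalty. -/
def risk (π : Policy M) (α : ℝ) : ℝ≥0∞ :=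
  m.bayesExp (fun ω => m.totalCost π α ω) + m.bayesExp (fun ω => m.gE (m.totalWait π α ω))

/-- Information rate of LLM `j` under each hypothesis. -/
def info (j : Fin M) : Label → ℝ
  | Label.A => m.outProb j Label.A Label.A * m.llr j Label.A
      + m.outProb j Label.A Label.B * m.llr j Label.B
  | Label.B => -(m.outProb j Label.B Label.A * m.llr j Label.A
      + m.outProb j Label.B Label.B * m.llr j Label.B)

/-- The largest absolute value of a single log-likelihood ratio. -/
def llrBound : ℝ := ⨆ j : Fin M, max |m.llr j Label.A| |m.llr j Label.B|

/-- The constant in the bounds for the error probabilities. -/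
def errConst : ℝ :=
  2 * max (m.prior Label.A / m.prior Label.B) (m.prior Label.B / m.prior Label.A)

/-- The slack in the information budgets. -/
def slack (α : ℝ) : ℝ := m.errConst * α * (m.upper α + m.lower α + m.llrBound)

/-- The information budget under each hypothesis. -/
def budget (α : ℝ) : Label → ℝ
  | Label.A => m.upper α - m.slack α
  | Label.B => m.lower α - m.slack α

/-- Feasible allocations: `n θ j` is the expected number of queries of `j` under `θ`. -/
def feasible (α : ℝ) : Set (Label → Fin M → ℝ) :=
  {n | (∀ θ j, 0 ≤ n θ j) ∧ ∀ θ, m.budget α θ ≤ ∑ j, m.info j θ * n θ j}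

/-- Objective of the deterministic allocation problem. -/
def allocCost (n : Label → Fin M → ℝ) : ℝ :=
  (m.prior Label.A * ∑ j, m.cost j * n Label.A j + m.prior Label.B * ∑ j, m.cost j * n Label.B j)
    + (m.prior Label.A * m.g (∑ j, m.meanWait j * n Label.A j)
      + m.prior Label.B * m.g (∑ j, m.meanWait j * n Label.B j))

/-- The benchmark: the optimal value of the deterministic allocation problem. -/
def benchmark (α : ℝ) : ℝ := sInf (m.allocCost '' m.feasible α)

lemma measurable_histLLR (t : ℕ) :
    Measurable (fun h : Fin t → Obs M => m.histLLR h) := by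
  have h2 : Measurable fun p : Fin M × Label => m.llr p.1 p.2 := measurable_from_prod_countable_right
    fun _ => measurable_of_countable _
  unfold histLLR
  refine Finset.measurable_sum _ fun s _ => ?_
  exact h2.comp ((measurable_fst.comp (measurable_pi_apply s)).prodMk
    (measurable_fst.comp (measurable_snd.comp (measurable_pi_apply s))))

/-- The sign-based two-LLM policy: query `jA` if the current log-likelihood ratio is nonnegative,
and `jB` otherwise. -/
def twoLLM (jA jB : Fin M) : Policy M where
  select := fun _ h => if 0 ≤ m.histLLR h then jA else jB
  measurable_select := fun t =>
    Measurable.ite (measurableSet_le measurable_const (m.measurable_histLLR t))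
      measurable_const measurable_const

/-- For a linear penalty: under one of the hypotheses `θ`, a single LLM has the smallest total cost
per unit of information, and its log-likelihood step against `θ` is not an integer multiple of
its step in favour of `θ`. -/
def LinearNondegenerate : Prop :=
  ∃ (θ : Label) (j : Fin M),
    (∀ i, i ≠ j → (m.cost j + m.gCoef * m.meanWait j) / m.info j θ
      < (m.cost i + m.gCoef * m.meanWait i) / m.info i θ) ∧
    ∀ k : ℕ, |m.llr j θ.other| ≠ k * |m.llr j θ|

end Model

end

end SeqTest

/-!
Write `S` for the information budget under a hypothesis `θ` (it is `log (1 / α) + O(1)`), and call an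
LLM dominant under `θ` if, for all large `S`, it is the cheapest per unit of information once waiting
is charged at the marginal penalty `slope` that it incurs itself. Dominant LLMs exist
(`exists_dominant`). Since the penalty is convex, it lies above its tangents, so the benchmark is the
prior-weighted sum of the costs `singleCost` of collecting the budgets from dominant LLMs alone
(`benchmark_le`, `le_benchmark`). All comparisons can therefore be made under each hypothesis
separately (`condRisk`).

*Upper bound.* Under `θ` the two-LLM policy queries the dominant LLM whenever the evidence `E` for
`θ` is positive. With `X` the accumulated cost or waiting time, the process
`exp (l X - κ E) (1 + l D exp (-E / 2))` is a supermartingale for small `l > 0` and `κ` equal to the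
price of information times `l`, up to `O(l ^ 2)` (`lintegral_exp_supermartingale`). The second factor
absorbs the queries of the wrong LLM, because each answer multiplies the mean of `exp (-E / 2)` by a
Bhattacharyya coefficient, which is less than one. As `E` ends at most one step above the threshold,
`(x / b) ^ p ≤ exp (p (x / b - 1))` with `l = p / b` gives `E[X ^ p] ≤ b ^ p + O(S ^ (p - 1))`
(`exists_lintegral_totalReward_rpow_le`), which is used for `p = 1` and `p = ρ`.

*Lower bound.* Linearizing the penalty at the benchmark reduces the conditional risk of any policy to
per-query charges, which dominate the expected information; Wald's identity and the bound
`exp (-threshold)` for the probability of error turn this into `singleCost`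
(`singleCost_le_condRisk`); the slack in the budgets is what pays for the errors.

*Tightness, superlinear penalty.* The slope of the tangent may be perturbed by a random factor
`1 + u` at a cost of order `u ^ 2` (`rpow_perturbed_tangent_le`, from Young's inequality). Taking `u`
to be a small negative multiple of the evidence martingale after a number of queries proportional to
`S`, before which no policy can stop, gains the covariance of the early evidence with the remaining
waiting time. The gain is linear in that multiple and the cost quadratic; the net gain is of order
`S ^ (ρ - 1)` (`condRisk_ge_perturbed`).

*Tightness, linear penalty.* When the evidence first comes within one step of the threshold, the
policy either queries another LLM, which is strictly more expensive, or queries only the best LLM. In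
the latter case one of two blocks of answers, each of probability bounded below, makes the evidence
overshoot by a fixed amount (`exists_overshoot_ge`): answers in favour of `θ` only, or the same after
one answer against `θ`. This is where the ratio of the two steps must not be an integer. Wald's
identity charges for the overshoot (`exists_condRisk_ge_of_linear`).
-/

namespace SeqTest

/-! ### Signed log-likelihood steps -/

/-- The sign with which the log-likelihood ratio of `A` versus `B` counts as evidence for `θ`. -/
def Label.sign : Label → ℝ
  | A => 1
  | B => -1

lemma Label.other_ne (θ : Label) : θ.other ≠ θ := by cases θ <;> simp [Label.other]

lemma Label.other_other (θ : Label) : θ.other.other = θ := by cases θ <;> rfl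

namespace Model

variable {M : ℕ} (m : Model M)

/-- The evidence for `θ` (against the other label) carried by the answer `y` of LLM `j`. -/
noncomputable def step (θ : Label) (j : Fin M) (y : Label) : ℝ := θ.sign * m.llr j y

/-- The amount of evidence for `θ` at which testing stops. -/
noncomputable def thr (α : ℝ) : Label → ℝ
  | Label.A => m.upper α
  | Label.B => m.lower α

lemma budget_eq (α : ℝ) (θ : Label) : m.budget α θ = m.thr α θ - m.slack α := by
  cases θ <;> rfl

lemma prior_pos (θ : Label) : 0 < m.prior θ := by
  have := m.priorA_pos
  have := m.priorA_lt_one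
  cases θ <;> simp only [prior] <;> linarith

lemma acc_pos (j : Fin M) (θ : Label) : 0 < m.acc j θ := by linarith [m.acc_gt j θ]

lemma one_sub_acc_pos (j : Fin M) (θ : Label) : 0 < 1 - m.acc j θ := by linarith [m.acc_lt j θ]

lemma outProb_self (j : Fin M) (θ : Label) : m.outProb j θ θ = m.acc j θ := by simp [outProb]

lemma outProb_other (j : Fin M) (θ : Label) : m.outProb j θ θ.other = 1 - m.acc j θ := by
  simp [outProb, Label.other_ne]

lemma outProb_pos (j : Fin M) (θ y : Label) : 0 < m.outProb j θ y := by
  have := m.acc_pos j θ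
  have := m.one_sub_acc_pos j θ
  unfold outProb
  split_ifs <;> assumption

lemma outProb_self_gt (j : Fin M) (θ : Label) : m.outProb j θ.other θ < m.outProb j θ θ := by
  have h := m.outProb_other j θ.other
  rw [Label.other_other] at h
  rw [h, m.outProb_self]
  linarith [m.acc_gt j θ, m.acc_gt j θ.other]

lemma step_eq (θ : Label) (j : Fin M) (y : Label) :
    m.step θ j y = Real.log (m.outProb j θ y / m.outProb j θ.other y) := by
  cases θ
  · simp [step, llr, Label.sign, Label.other]
  · simp only [step, llr, Label.sign, Label.other]
    rw [neg_one_mul, ← Real.log_inv, inv_div]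

lemma exp_neg_step (θ : Label) (j : Fin M) (y : Label) :
    Real.exp (-m.step θ j y) = m.outProb j θ.other y / m.outProb j θ y := by
  rw [step_eq, Real.exp_neg, Real.exp_log (div_pos (m.outProb_pos _ _ _) (m.outProb_pos _ _ _)),
    inv_div]

lemma step_self_pos (θ : Label) (j : Fin M) : 0 < m.step θ j θ := by
  rw [step_eq]
  exact Real.log_pos ((one_lt_div (m.outProb_pos _ _ _)).2 (m.outProb_self_gt j θ))

lemma step_other_neg (θ : Label) (j : Fin M) : m.step θ j θ.other < 0 := by
  rw [step_eq]
  refine Real.log_neg (div_pos (m.outProb_pos _ _ _) (m.outProb_pos _ _ _)) ?_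
  rw [div_lt_one (m.outProb_pos _ _ _)]
  have := m.outProb_self_gt j θ.other
  rwa [Label.other_other] at this

lemma info_eq (j : Fin M) (θ : Label) :
    m.info j θ = m.acc j θ * m.step θ j θ + (1 - m.acc j θ) * m.step θ j θ.other := by
  have h := m.outProb_other j θ
  rw [← h, ← outProb_self]
  cases θ <;> simp only [info, step, Label.sign, Label.other] <;> ring

lemma abs_step_le (θ : Label) (j : Fin M) (y : Label) : |m.step θ j y| ≤ m.llrBound := by
  have h1 : |m.step θ j y| = |m.llr j y| := by
    cases θ <;> simp [step, Label.sign]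
  have h2 : |m.llr j y| ≤ max |m.llr j Label.A| |m.llr j Label.B| := by cases y <;> simp
  rw [h1]
  exact h2.trans (le_ciSup (f := fun j : Fin M => max |m.llr j Label.A| |m.llr j Label.B|)
    (Set.finite_range _).bddAbove j)

lemma llrBound_nonneg : 0 ≤ m.llrBound :=
  Real.iSup_nonneg fun _ => le_max_of_le_left (abs_nonneg _)

lemma llrBound_pos (j : Fin M) : 0 < m.llrBound :=
  (abs_pos.2 (m.step_self_pos Label.A j).ne').trans_le (m.abs_step_le Label.A j Label.A)

/-- Under `θ` the likelihood ratio of the other label versus `θ` has mean one. -/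
lemma mean_exp_neg_step (j : Fin M) (θ : Label) :
    m.acc j θ * Real.exp (-m.step θ j θ)
      + (1 - m.acc j θ) * Real.exp (-m.step θ j θ.other) = 1 := by
  have h1 := m.acc_pos j θ
  have h2 := m.one_sub_acc_pos j θ
  have h3 : m.outProb j θ.other θ = 1 - m.acc j θ.other := by
    have := m.outProb_other j θ.other
    rwa [Label.other_other] at this
  rw [exp_neg_step, exp_neg_step, outProb_self, outProb_other, outProb_self, h3]
  field_simp
  ring

lemma info_pos (j : Fin M) (θ : Label) : 0 < m.info j θ := by
  have h1 := m.acc_pos j θ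
  have h2 := m.one_sub_acc_pos j θ
  have h3 := Real.add_one_lt_exp (neg_ne_zero.2 (m.step_self_pos θ j).ne')
  have h4 := Real.add_one_lt_exp (neg_ne_zero.2 (m.step_other_neg θ j).ne)
  have h5 := m.mean_exp_neg_step j θ
  rw [info_eq]
  nlinarith [mul_lt_mul_of_pos_left h3 h1, mul_lt_mul_of_pos_left h4 h2]

lemma info_le (j : Fin M) (θ : Label) : m.info j θ ≤ m.llrBound := by
  rw [info_eq]
  nlinarith [m.acc_pos j θ, m.one_sub_acc_pos j θ, (abs_le.1 (m.abs_step_le θ j θ)).2,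
    (abs_le.1 (m.abs_step_le θ j θ.other)).2]

/-- The Bhattacharyya coefficient of the two answer laws of an LLM. -/
noncomputable def bhatt (j : Fin M) (θ : Label) : ℝ :=
  m.acc j θ * Real.exp (-(m.step θ j θ / 2))
    + (1 - m.acc j θ) * Real.exp (-(m.step θ j θ.other / 2))

lemma bhatt_lt_one (j : Fin M) (θ : Label) : m.bhatt j θ < 1 := by
  have h1 := m.acc_pos j θ
  have h2 := m.one_sub_acc_pos j θ
  have h5 := m.mean_exp_neg_step j θ
  have h6 : ∀ x : ℝ, Real.exp (-x) = Real.exp (-(x / 2)) ^ 2 := fun x => by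
    rw [← Real.exp_nat_mul]; congr 1; push_cast; ring
  rw [h6 (m.step θ j θ), h6 (m.step θ j θ.other)] at h5
  unfold bhatt
  have h7 : Real.exp (-(m.step θ j θ / 2)) ≠ 1 := by
    rw [Ne, Real.exp_eq_one_iff]
    linarith [m.step_self_pos θ j]
  nlinarith [mul_pos h1 (pow_pos (abs_pos.2 (sub_ne_zero.2 h7)) 2),
    mul_nonneg h2.le (sq_nonneg (Real.exp (-(m.step θ j θ.other / 2)) - 1)),
    sq_abs (Real.exp (-(m.step θ j θ / 2)) - 1)]

lemma integral_outLaw (j : Fin M) (θ : Label) (h : Label → ℝ) :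
    ∫ y, h y ∂(m.outLaw j θ) = m.acc j θ * h θ + (1 - m.acc j θ) * h θ.other := by
  have hi : ∀ (c : ℝ) (y : Label), Integrable h (ENNReal.ofReal c • Measure.dirac y) :=
    fun c y => (integrable_dirac (by simp)).smul_measure (by simp)
  have h1 := m.acc_pos j θ
  have h2 := m.one_sub_acc_pos j θ
  rw [outLaw, integral_add_measure (hi _ _) (hi _ _), integral_smul_measure, integral_smul_measure,
    integral_dirac, integral_dirac, ENNReal.toReal_ofReal (m.outProb_pos _ _ _).le,
    ENNReal.toReal_ofReal (m.outProb_pos _ _ _).le, ← outProb_other, ← outProb_self]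
  cases θ <;> simp [Label.other, add_comm]

lemma integrable_outLaw (j : Fin M) (θ : Label) (h : Label → ℝ) :
    Integrable h (m.outLaw j θ) := by
  have : Finite Label := inferInstance
  exact Integrable.of_finite

lemma lintegral_outLaw (j : Fin M) (θ : Label) (h : Label → ℝ) (hh : ∀ y, 0 ≤ h y) :
    ∫⁻ y, ENNReal.ofReal (h y) ∂(m.outLaw j θ)
      = ENNReal.ofReal (m.acc j θ * h θ + (1 - m.acc j θ) * h θ.other) := by
  rw [← integral_outLaw, ofReal_integral_eq_lintegral_ofReal (m.integrable_outLaw _ _ _)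
    (ae_of_all _ hh)]

lemma integral_step (j : Fin M) (θ : Label) :
    ∫ y, m.step θ j y ∂(m.outLaw j θ) = m.info j θ := by
  rw [integral_outLaw, info_eq]

/-- Variance of the evidence of one answer. -/
noncomputable def stepVar (j : Fin M) (θ : Label) : ℝ :=
  ∫ y, (m.step θ j y - m.info j θ) ^ 2 ∂(m.outLaw j θ)

lemma stepVar_pos (j : Fin M) (θ : Label) : 0 < m.stepVar j θ := by
  have h1 := m.acc_pos j θ
  have h2 := m.one_sub_acc_pos j θ
  have h3 := m.step_self_pos θ j
  have h4 := m.step_other_neg θ j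
  rw [stepVar, integral_outLaw, info_eq]
  have : 0 < m.acc j θ * (1 - m.acc j θ) * (m.step θ j θ - m.step θ j θ.other) ^ 2 := by
    have : 0 < m.step θ j θ - m.step θ j θ.other := by linarith
    positivity
  nlinarith

/-- `exp (-κ s)` is controlled by the first two terms of its expansion. -/
lemma mean_exp_neg_mul_step_le (j : Fin M) (θ : Label) {κ : ℝ} (hκ : 0 ≤ κ)
    (hκ1 : κ * m.llrBound ≤ 1) :
    m.acc j θ * Real.exp (-(κ * m.step θ j θ))
      + (1 - m.acc j θ) * Real.exp (-(κ * m.step θ j θ.other))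
      ≤ Real.exp (-(κ * m.info j θ) + m.llrBound ^ 2 * κ ^ 2) := by
  have h1 := m.acc_pos j θ
  have h2 := m.one_sub_acc_pos j θ
  have key : ∀ y, Real.exp (-(κ * m.step θ j y))
      ≤ 1 - κ * m.step θ j y + m.llrBound ^ 2 * κ ^ 2 := by
    intro y
    have hb : |κ * m.step θ j y| ≤ κ * m.llrBound := by
      rw [abs_mul, abs_of_nonneg hκ]
      exact mul_le_mul_of_nonneg_left (m.abs_step_le θ j y) hκ
    have h3 := Real.abs_exp_sub_one_sub_id_le (x := -(κ * m.step θ j y))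
      (by rw [abs_neg]; exact hb.trans hκ1)
    have h4 := (abs_le.1 h3).2
    have h5 : (κ * m.step θ j y) ^ 2 ≤ (κ * m.llrBound) ^ 2 := by
      rw [← sq_abs]
      exact pow_le_pow_left₀ (abs_nonneg _) hb 2
    nlinarith
  have h3 := Real.add_one_le_exp (-(κ * m.info j θ) + m.llrBound ^ 2 * κ ^ 2)
  refine le_trans ?_ h3
  rw [info_eq]
  nlinarith [mul_le_mul_of_nonneg_left (key θ) h1.le, mul_le_mul_of_nonneg_left (key θ.other) h2.le]

lemma meanWait_pos (j : Fin M) : 0 < m.meanWait j := m.waitLaw_mean_pos j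

lemma integrable_wait (j : Fin M) : Integrable (fun x : ℝ => x) (m.waitLaw j) := by
  obtain ⟨ψ, _, h⟩ := m.waitLaw_subgaussian
  have := (h j).integrable.add (integrable_const (∫ y, y ∂(m.waitLaw j)))
  refine this.congr (ae_of_all _ fun x => ?_)
  simp

end Model

/-! ### The filtration and the one-step identity -/

/-- The information in the coordinates before time `t`, including the answers and waiting times that
LLMs not selected would have produced. -/
@[reducible] def past (M : ℕ) (t : ℕ) : MeasurableSpace (Sample M) :=
  ⨆ s ∈ Set.Iio t, MeasurableSpace.comap (fun ω : Sample M => ω s) inferInstance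

variable {M : ℕ}

lemma past_le (t : ℕ) : past M t ≤ (MeasurableSpace.pi : MeasurableSpace (Sample M)) :=
  iSup₂_le fun s _ => (measurable_pi_apply s).comap_le

lemma past_mono {s t : ℕ} (h : s ≤ t) : past M s ≤ past M t :=
  biSup_mono fun _ hr => lt_of_lt_of_le hr h

lemma measurable_past_eval {s t : ℕ} (h : s < t) : Measurable[past M t] fun ω : Sample M => ω s :=
  Measurable.of_comap_le (le_iSup₂_of_le s h le_rfl)

lemma measurable_past_history (π : Policy M) (t : ℕ) :
    Measurable[past M t] fun ω : Sample M => π.history ω t := by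
  induction t with
  | zero =>
    refine @measurable_pi_lambda _ _ _ (past M 0) _ _ fun i => i.elim0
  | succ t ih =>
    have ih' : Measurable[past M (t + 1)] fun ω : Sample M => π.history ω t :=
      ih.mono (past_mono t.le_succ) le_rfl
    have hs : Measurable[past M (t + 1)] fun ω : Sample M => π.chosen ω t :=
      (π.measurable_select t).comp ih'
    have he : Measurable[past M (t + 1)] fun ω : Sample M => ω t :=
      measurable_past_eval t.lt_succ_self
    have hp : Measurable fun p : Fin M × (Fin M → Label × ℝ) => p.2 p.1 :=
      measurable_from_prod_countable_right fun j => measurable_pi_apply j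
    have hv : Measurable[past M (t + 1)] fun ω : Sample M => ω t (π.chosen ω t) :=
      hp.comp (hs.prodMk he)
    refine @measurable_pi_lambda _ _ _ (past M (t + 1)) _ _ fun i => ?_
    refine Fin.lastCases ?_ (fun i => ?_) i
    · have : (fun ω : Sample M => π.history ω (t + 1) (Fin.last t))
          = fun ω => (π.chosen ω t, ω t (π.chosen ω t)) := by
        funext ω
        simp [Policy.history, Policy.chosen]
      rw [this]
      exact hs.prodMk hv
    · have : (fun ω : Sample M => π.history ω (t + 1) i.castSucc)
          = fun ω => π.history ω t i := by
        funext ω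
        simp [Policy.history]
      rw [this]
      exact (measurable_pi_apply i).comp ih'

lemma measurable_past_chosen (π : Policy M) (t : ℕ) :
    Measurable[past M t] fun ω : Sample M => π.chosen ω t :=
  (π.measurable_select t).comp (measurable_past_history π t)

lemma measurable_past_reward (π : Policy M) (t : ℕ) {β : Type*} [MeasurableSpace β]
    (f : Fin M → Label × ℝ → β) (hf : ∀ j, Measurable (f j)) :
    Measurable[past M (t + 1)] fun ω : Sample M => f (π.chosen ω t) (ω t (π.chosen ω t)) := by
  have hp : Measurable fun p : Fin M × (Fin M → Label × ℝ) => f p.1 (p.2 p.1) :=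
    measurable_from_prod_countable_right fun j => (hf j).comp (measurable_pi_apply j)
  exact hp.comp (((measurable_past_chosen π t).mono (past_mono t.le_succ) le_rfl).prodMk
    (measurable_past_eval t.lt_succ_self))

namespace Model

variable (m : Model M)

/-- Law of the answer and waiting time of one query of LLM `j` under `θ`. -/
noncomputable def stepLaw (j : Fin M) (θ : Label) : Measure (Label × ℝ) :=
  (m.outLaw j θ).prod (m.waitLaw j)

instance (j : Fin M) (θ : Label) : IsProbabilityMeasure (m.stepLaw j θ) := by
  unfold stepLaw; infer_instance

instance (θ : Label) : IsProbabilityMeasure (m.law θ) := by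
  unfold law; infer_instance

lemma measurePreserving_coord (θ : Label) (t : ℕ) (j : Fin M) :
    MeasurePreserving (fun ω : Sample M => ω t j) (m.law θ) (m.stepLaw j θ) := by
  have h1 := measurePreserving_eval_infinitePi
    (fun _ : ℕ => Measure.pi fun j : Fin M => (m.outLaw j θ).prod (m.waitLaw j)) t
  have h2 := measurePreserving_eval (fun j : Fin M => (m.outLaw j θ).prod (m.waitLaw j)) j
  exact h2.comp h1

lemma indep_past (θ : Label) (t : ℕ) :
    Indep (past M t) (MeasurableSpace.comap (fun ω : Sample M => ω t) inferInstance) (m.law θ) := by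
  have h : iIndepFun (fun (i : ℕ) (ω : Sample M) => ω i) (m.law θ) :=
    iIndepFun_infinitePi (X := fun _ x => x) fun _ => measurable_id
  have h2 := indep_iSup_of_disjoint (fun i => (measurable_pi_apply i).comap_le)
    ((iIndepFun_iff_iIndep _ _ _).1 h) (S := Set.Iio t) (T := {t}) (by simp)
  simpa [past] using h2

/-- A query made at time `t` is, given the past, distributed according to the chosen LLM. -/
lemma lintegral_step_mul (θ : Label) (π : Policy M) (t : ℕ) (G : Sample M → ℝ≥0∞)
    (hG : Measurable[past M t] G) (f : Fin M → Label × ℝ → ℝ≥0∞) (hf : ∀ j, Measurable (f j)) :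
    ∫⁻ ω, G ω * f (π.chosen ω t) (ω t (π.chosen ω t)) ∂(m.law θ)
      = ∫⁻ ω, G ω * ∫⁻ z, f (π.chosen ω t) z ∂(m.stepLaw (π.chosen ω t) θ) ∂(m.law θ) := by
  classical
  have hch : ∀ j, MeasurableSet[past M t] {ω : Sample M | π.chosen ω t = j} := fun j =>
    measurable_past_chosen π t (measurableSet_singleton j)
  have hGj : ∀ j, Measurable[past M t] ({ω : Sample M | π.chosen ω t = j}.indicator G) :=
    fun j => hG.indicator (hch j)
  have hGm : ∀ j, Measurable ({ω : Sample M | π.chosen ω t = j}.indicator G) :=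
    fun j => (hGj j).mono (past_le t) le_rfl
  have split : ∀ F : Fin M → Sample M → ℝ≥0∞, ∀ ω, G ω * F (π.chosen ω t) ω
      = ∑ j, {ω : Sample M | π.chosen ω t = j}.indicator G ω * F j ω := by
    intro F ω
    rw [Finset.sum_eq_single (π.chosen ω t)]
    · simp
    · intro j _ hj
      simp [hj.symm]
    · simp
  have hfm : ∀ j, Measurable fun ω : Sample M => f j (ω t j) := fun j =>
    (hf j).comp ((measurable_pi_apply j).comp (measurable_pi_apply t))
  have h1 : ∀ j, Measurable fun ω =>
      {ω : Sample M | π.chosen ω t = j}.indicator G ω * f j (ω t j) :=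
    fun j => (hGm j).mul (hfm j)
  have h2 : ∀ j, Measurable fun ω =>
      {ω : Sample M | π.chosen ω t = j}.indicator G ω * ∫⁻ z, f j z ∂(m.stepLaw j θ) :=
    fun j => (hGm j).mul measurable_const
  rw [lintegral_congr (split fun j ω => f j (ω t j)),
    lintegral_congr (split fun j _ => ∫⁻ z, f j z ∂(m.stepLaw j θ)),
    lintegral_finsetSum _ fun j _ => h1 j, lintegral_finsetSum _ fun j _ => h2 j]
  refine Finset.sum_congr rfl fun j _ => ?_
  rw [lintegral_mul_const _ (hGm j), ← (m.measurePreserving_coord θ t j).lintegral_comp (hf j)]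
  refine lintegral_mul_eq_lintegral_mul_lintegral_of_independent_measurableSpace (past_le t)
    (measurable_pi_apply t).comap_le (m.indep_past θ t) (hGj j) ?_
  have : Measurable fun x : Fin M → Label × ℝ => f j (x j) := (hf j).comp (measurable_pi_apply j)
  exact this.comp (comap_measurable _)

lemma integrable_step_mul (θ : Label) (π : Policy M) (t : ℕ) (G : Sample M → ℝ)
    (hG : Measurable[past M t] G) (hGi : Integrable G (m.law θ)) (f : Fin M → Label × ℝ → ℝ)
    (hf : ∀ j, Measurable (f j)) (hfi : ∀ j, Integrable (f j) (m.stepLaw j θ)) :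
    Integrable (fun ω => G ω * f (π.chosen ω t) (ω t (π.chosen ω t))) (m.law θ)
    ∧ ∫ ω, G ω * f (π.chosen ω t) (ω t (π.chosen ω t)) ∂(m.law θ)
      = ∫ ω, G ω * ∫ z, f (π.chosen ω t) z ∂(m.stepLaw (π.chosen ω t) θ) ∂(m.law θ) := by
  classical
  have hch : ∀ j, MeasurableSet[past M t] {ω : Sample M | π.chosen ω t = j} := fun j =>
    measurable_past_chosen π t (measurableSet_singleton j)
  have hGj : ∀ j, Measurable[past M t] ({ω : Sample M | π.chosen ω t = j}.indicator G) :=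
    fun j => hG.indicator (hch j)
  have hGji : ∀ j, Integrable ({ω : Sample M | π.chosen ω t = j}.indicator G) (m.law θ) :=
    fun j => hGi.indicator (past_le t _ (hch j))
  have split : ∀ F : Fin M → Sample M → ℝ, (fun ω => G ω * F (π.chosen ω t) ω)
      = fun ω => ∑ j, {ω : Sample M | π.chosen ω t = j}.indicator G ω * F j ω := by
    intro F
    funext ω
    rw [Finset.sum_eq_single (π.chosen ω t)]
    · simp
    · intro j _ hj
      simp [hj.symm]
    · simp
  have hind : ∀ j, IndepFun ({ω : Sample M | π.chosen ω t = j}.indicator G)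
      (fun ω : Sample M => f j (ω t j)) (m.law θ) := by
    intro j
    have : Measurable fun x : Fin M → Label × ℝ => f j (x j) := (hf j).comp (measurable_pi_apply j)
    exact indep_of_indep_of_le_right (indep_of_indep_of_le_left (m.indep_past θ t)
      (hGj j).comap_le) (this.comp (comap_measurable _)).comap_le
  have hfc : ∀ j, Integrable (fun ω : Sample M => f j (ω t j)) (m.law θ) := fun j =>
    (m.measurePreserving_coord θ t j).integrable_comp_of_integrable (hfi j)
  have hmul : ∀ j, Integrable (fun ω => {ω : Sample M | π.chosen ω t = j}.indicator G ω
      * f j (ω t j)) (m.law θ) := fun j => (hind j).integrable_mul (hGji j) (hfc j)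
  rw [split fun j ω => f j (ω t j), split fun j _ => ∫ z, f j z ∂(m.stepLaw j θ)]
  refine ⟨integrable_finsetSum _ fun j _ => hmul j, ?_⟩
  rw [integral_finsetSum _ fun j _ => hmul j,
    integral_finsetSum _ fun j _ => (hGji j).mul_const _]
  refine Finset.sum_congr rfl fun j _ => ?_
  have hmap : ∫ z, f j z ∂(m.stepLaw j θ) = ∫ ω, f j (ω t j) ∂(m.law θ) := by
    rw [← (m.measurePreserving_coord θ t j).map_eq]
    exact integral_map (m.measurePreserving_coord θ t j).measurable.aemeasurable
      (hf j).aestronglyMeasurable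
  rw [integral_mul_const, hmap]
  exact (hind j).integral_fun_mul_eq_mul_integral (hGji j).aestronglyMeasurable
    (hfc j).aestronglyMeasurable

/-! ### Stopped sums -/

/-- The evidence for `θ` accumulated in the first `t` queries. -/
noncomputable def evid (π : Policy M) (θ : Label) (ω : Sample M) (t : ℕ) : ℝ :=
  θ.sign * m.cumLLR π ω t

lemma evid_zero (π : Policy M) (θ : Label) (ω : Sample M) : m.evid π θ ω 0 = 0 := by
  simp [evid, cumLLR, histLLR]

lemma evid_succ (π : Policy M) (θ : Label) (ω : Sample M) (t : ℕ) :
    m.evid π θ ω (t + 1)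
      = m.evid π θ ω t + m.step θ (π.chosen ω t) (ω t (π.chosen ω t)).1 := by
  simp only [evid, cumLLR, histLLR, step]
  rw [Fin.sum_univ_castSucc, mul_add]
  congr 1
  · simp [Policy.history]
  · simp [Policy.history, Policy.chosen]

lemma abs_evid_le (π : Policy M) (θ : Label) (ω : Sample M) (t : ℕ) :
    |m.evid π θ ω t| ≤ t * m.llrBound := by
  induction t with
  | zero => simp [evid_zero]
  | succ t ih =>
    rw [evid_succ]
    refine (abs_add_le _ _).trans ?_
    push_cast
    linarith [m.abs_step_le θ (π.chosen ω t) (ω t (π.chosen ω t)).1]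

/-- Testing has not stopped within the first `t` queries, so that a query is made at time `t`. -/
def Alive (π : Policy M) (α : ℝ) (ω : Sample M) (t : ℕ) : Prop :=
  ∀ s ≤ t, -m.lower α < m.cumLLR π ω s ∧ m.cumLLR π ω s < m.upper α

lemma alive_iff (π : Policy M) (α : ℝ) (θ : Label) (ω : Sample M) (t : ℕ) :
    m.Alive π α ω t ↔
      ∀ s ≤ t, -m.thr α θ.other < m.evid π θ ω s ∧ m.evid π θ ω s < m.thr α θ := by
  cases θ
  · simp [Alive, evid, thr, Label.sign, Label.other]
  · simp only [Alive, evid, thr, Label.sign, Label.other, neg_one_mul]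
    refine forall₂_congr fun s _ => ?_
    rw [neg_lt_neg_iff, neg_lt, and_comm]

lemma Alive.mono {π : Policy M} {α : ℝ} {ω : Sample M} {s t : ℕ} (h : m.Alive π α ω t)
    (hst : s ≤ t) : m.Alive π α ω s := fun r hr => h r (hr.trans hst)

lemma lt_stopTime_iff (π : Policy M) (α : ℝ) (ω : Sample M) (t : ℕ) :
    (t : ℕ∞) < m.stopTime π α ω ↔ m.Alive π α ω t := by
  constructor
  · intro h s hs
    by_contra hc
    have hmem : (s : ℕ∞) ∈ {n : ℕ∞ | ∃ t : ℕ, n = t ∧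
        (m.upper α ≤ m.cumLLR π ω t ∨ m.cumLLR π ω t ≤ -m.lower α)} := by
      refine ⟨s, rfl, ?_⟩
      by_contra hc'
      push Not at hc'
      exact hc ⟨hc'.2, hc'.1⟩
    exact absurd (lt_of_lt_of_le h (sInf_le hmem)) (not_lt.2 (by exact_mod_cast hs))
  · intro h
    by_contra hc
    rw [not_lt] at hc
    have hne : {n : ℕ∞ | ∃ t : ℕ, n = t ∧
        (m.upper α ≤ m.cumLLR π ω t ∨ m.cumLLR π ω t ≤ -m.lower α)}.Nonempty := by
      by_contra he
      rw [Set.not_nonempty_iff_eq_empty] at he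
      rw [stopTime, he, sInf_empty] at hc
      exact absurd hc (by simp)
    obtain ⟨s, hs, hs'⟩ := csInf_mem hne
    rw [stopTime, hs] at hc
    have := h s (by exact_mod_cast hc)
    rcases hs' with h1 | h1 <;> linarith

lemma measurable_past_cumLLR (π : Policy M) (t : ℕ) :
    Measurable[past M t] fun ω : Sample M => m.cumLLR π ω t :=
  (m.measurable_histLLR t).comp (measurable_past_history π t)

lemma measurableSet_past_alive (π : Policy M) (α : ℝ) (t : ℕ) :
    MeasurableSet[past M t] {ω : Sample M | m.Alive π α ω t} := by
  have : {ω : Sample M | m.Alive π α ω t}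
      = ⋂ s ∈ Set.Iic t, {ω | m.cumLLR π ω s ∈ Set.Ioo (-m.lower α) (m.upper α)} := by
    ext ω
    simp [Alive]
  rw [this]
  refine MeasurableSet.biInter (Set.to_countable _) fun s hs => ?_
  exact ((m.measurable_past_cumLLR π s).mono (past_mono hs) le_rfl) measurableSet_Ioo

open Classical in
/-- Indicator of `Alive`. -/
noncomputable def aliveInd (π : Policy M) (α : ℝ) (ω : Sample M) (t : ℕ) : ℝ :=
  if m.Alive π α ω t then 1 else 0

lemma aliveInd_of_alive {π : Policy M} {α : ℝ} {ω : Sample M} {t : ℕ} (h : m.Alive π α ω t) :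
    m.aliveInd π α ω t = 1 := if_pos h

lemma aliveInd_of_not {π : Policy M} {α : ℝ} {ω : Sample M} {t : ℕ} (h : ¬m.Alive π α ω t) :
    m.aliveInd π α ω t = 0 := if_neg h

lemma aliveInd_nonneg (π : Policy M) (α : ℝ) (ω : Sample M) (t : ℕ) :
    0 ≤ m.aliveInd π α ω t := by
  unfold aliveInd; split_ifs <;> simp

lemma aliveInd_le_one (π : Policy M) (α : ℝ) (ω : Sample M) (t : ℕ) :
    m.aliveInd π α ω t ≤ 1 := by
  unfold aliveInd; split_ifs <;> simp

lemma measurable_past_aliveInd (π : Policy M) (α : ℝ) (t : ℕ) :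
    Measurable[past M t] fun ω : Sample M => m.aliveInd π α ω t :=
  Measurable.ite (m.measurableSet_past_alive π α t) measurable_const measurable_const

/-- Sum of a per-query quantity `f` over the queries made before time `N`. -/
noncomputable def stoppedSum (π : Policy M) (α : ℝ) (f : Fin M → Label × ℝ → ℝ) (N : ℕ)
    (ω : Sample M) : ℝ :=
  ∑ t ∈ Finset.range N, m.aliveInd π α ω t * f (π.chosen ω t) (ω t (π.chosen ω t))

lemma stoppedSum_succ (π : Policy M) (α : ℝ) (f : Fin M → Label × ℝ → ℝ) (N : ℕ) (ω : Sample M) :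
    m.stoppedSum π α f (N + 1) ω = m.stoppedSum π α f N ω
      + m.aliveInd π α ω N * f (π.chosen ω N) (ω N (π.chosen ω N)) :=
  Finset.sum_range_succ _ _

lemma stoppedSum_add (π : Policy M) (α : ℝ) (f g : Fin M → Label × ℝ → ℝ) (N : ℕ) (ω : Sample M) :
    m.stoppedSum π α (fun j z => f j z + g j z) N ω
      = m.stoppedSum π α f N ω + m.stoppedSum π α g N ω := by
  simp only [stoppedSum, mul_add, Finset.sum_add_distrib]

lemma stoppedSum_sub (π : Policy M) (α : ℝ) (f g : Fin M → Label × ℝ → ℝ) (N : ℕ) (ω : Sample M) :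
    m.stoppedSum π α (fun j z => f j z - g j z) N ω
      = m.stoppedSum π α f N ω - m.stoppedSum π α g N ω := by
  simp only [stoppedSum, mul_sub, Finset.sum_sub_distrib]

lemma stoppedSum_const_mul (π : Policy M) (α c : ℝ) (f : Fin M → Label × ℝ → ℝ) (N : ℕ)
    (ω : Sample M) :
    m.stoppedSum π α (fun j z => c * f j z) N ω = c * m.stoppedSum π α f N ω := by
  simp only [stoppedSum, Finset.mul_sum]
  exact Finset.sum_congr rfl fun _ _ => by ring

lemma stoppedSum_le (π : Policy M) (α : ℝ) {f g : Fin M → Label × ℝ → ℝ} (h : ∀ j z, f j z ≤ g j z)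
    (N : ℕ) (ω : Sample M) : m.stoppedSum π α f N ω ≤ m.stoppedSum π α g N ω :=
  Finset.sum_le_sum fun _ _ => mul_le_mul_of_nonneg_left (h _ _) (m.aliveInd_nonneg _ _ _ _)

lemma stoppedSum_nonneg (π : Policy M) (α : ℝ) {f : Fin M → Label × ℝ → ℝ} (h : ∀ j z, 0 ≤ f j z)
    (N : ℕ) (ω : Sample M) : 0 ≤ m.stoppedSum π α f N ω :=
  Finset.sum_nonneg fun _ _ => mul_nonneg (m.aliveInd_nonneg _ _ _ _) (h _ _)

lemma measurable_past_stoppedSum (π : Policy M) (α : ℝ) (f : Fin M → Label × ℝ → ℝ)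
    (hf : ∀ j, Measurable (f j)) (N : ℕ) : Measurable[past M N] (m.stoppedSum π α f N) := by
  refine @Finset.measurable_fun_sum _ _ _ _ _ _ (past M N) _ _ fun t ht => ?_
  have ht' := Finset.mem_range.1 ht
  exact ((m.measurable_past_aliveInd π α t).mono (past_mono ht'.le) le_rfl).mul
    ((measurable_past_reward π t f hf).mono (past_mono ht') le_rfl)

lemma measurable_stoppedSum (π : Policy M) (α : ℝ) (f : Fin M → Label × ℝ → ℝ)
    (hf : ∀ j, Measurable (f j)) (N : ℕ) : Measurable (m.stoppedSum π α f N) :=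
  (m.measurable_past_stoppedSum π α f hf N).mono (past_le N) le_rfl

lemma integrable_aliveInd (θ : Label) (π : Policy M) (α : ℝ) (t : ℕ) :
    Integrable (fun ω => m.aliveInd π α ω t) (m.law θ) := by
  refine Integrable.of_bound
    ((m.measurable_past_aliveInd π α t).mono (past_le t) le_rfl).aestronglyMeasurable 1
    (ae_of_all _ fun ω => ?_)
  rw [Real.norm_eq_abs, abs_of_nonneg (m.aliveInd_nonneg _ _ _ _)]
  exact m.aliveInd_le_one _ _ _ _

lemma integrable_stoppedSum (θ : Label) (π : Policy M) (α : ℝ) (f : Fin M → Label × ℝ → ℝ)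
    (hf : ∀ j, Measurable (f j)) (hfi : ∀ j, Integrable (f j) (m.stepLaw j θ)) (N : ℕ) :
    Integrable (m.stoppedSum π α f N) (m.law θ) :=
  integrable_finsetSum _ fun t _ => (m.integrable_step_mul θ π t _
    (m.measurable_past_aliveInd π α t) (m.integrable_aliveInd θ π α t) f hf hfi).1

/-- Wald's identity for the stopped sums. -/
lemma integral_stoppedSum (θ : Label) (π : Policy M) (α : ℝ) (f : Fin M → Label × ℝ → ℝ)
    (hf : ∀ j, Measurable (f j)) (hfi : ∀ j, Integrable (f j) (m.stepLaw j θ)) (N : ℕ) :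
    ∫ ω, m.stoppedSum π α f N ω ∂(m.law θ)
      = ∫ ω, m.stoppedSum π α (fun j _ => ∫ z, f j z ∂(m.stepLaw j θ)) N ω ∂(m.law θ) := by
  have h := fun (f : Fin M → Label × ℝ → ℝ) hf hfi t => m.integrable_step_mul θ π t _
    (m.measurable_past_aliveInd π α t) (m.integrable_aliveInd θ π α t) f hf hfi
  have h' := h (fun j _ => ∫ z, f j z ∂(m.stepLaw j θ)) (fun j => measurable_const)
    (fun j => integrable_const _)
  simp only [stoppedSum]
  rw [integral_finsetSum _ fun t _ => (h f hf hfi t).1, integral_finsetSum _ fun t _ => (h' t).1]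
  exact Finset.sum_congr rfl fun t _ => (h f hf hfi t).2

open Classical in
/-- One-step recursion for exponential moments of stopped sums. -/
lemma lintegral_exp_stoppedSum_succ (θ : Label) (π : Policy M) (α : ℝ)
    (f : Fin M → Label × ℝ → ℝ) (hf : ∀ j, Measurable (f j)) (N : ℕ) :
    ∫⁻ ω, ENNReal.ofReal (Real.exp (m.stoppedSum π α f (N + 1) ω)) ∂(m.law θ)
      = ∫⁻ ω, ENNReal.ofReal (Real.exp (m.stoppedSum π α f N ω)) *
        (if m.Alive π α ω N then
          ∫⁻ z, ENNReal.ofReal (Real.exp (f (π.chosen ω N) z)) ∂(m.stepLaw (π.chosen ω N) θ)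
          else 1) ∂(m.law θ) := by
  have hZ : Measurable[past M N]
      fun ω => ENNReal.ofReal (Real.exp (m.stoppedSum π α f N ω)) :=
    ENNReal.measurable_ofReal.comp
      (Real.measurable_exp.comp (m.measurable_past_stoppedSum π α f hf N))
  have hA := m.measurableSet_past_alive π α N
  have hG := hZ.indicator hA
  have hG' := (hZ.indicator hA.compl).mono (past_le N) le_rfl
  have hfm : ∀ j, Measurable fun z => ENNReal.ofReal (Real.exp (f j z)) := fun j =>
    ENNReal.measurable_ofReal.comp (Real.measurable_exp.comp (hf j))
  have key := m.lintegral_step_mul θ π N _ hG (fun j z => ENNReal.ofReal (Real.exp (f j z))) hfm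
  calc _ = ∫⁻ ω, ({ω | m.Alive π α ω N}ᶜ.indicator
            (fun ω => ENNReal.ofReal (Real.exp (m.stoppedSum π α f N ω))) ω
          + {ω | m.Alive π α ω N}.indicator
            (fun ω => ENNReal.ofReal (Real.exp (m.stoppedSum π α f N ω))) ω
            * ENNReal.ofReal (Real.exp (f (π.chosen ω N) (ω N (π.chosen ω N))))) ∂(m.law θ) := by
        refine lintegral_congr fun ω => ?_
        rw [stoppedSum_succ]
        by_cases h : m.Alive π α ω N
        · simp [h, aliveInd_of_alive, Real.exp_add, ENNReal.ofReal_mul (Real.exp_pos _).le]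
        · simp [h, aliveInd_of_not]
    _ = ∫⁻ ω, ({ω | m.Alive π α ω N}ᶜ.indicator
            (fun ω => ENNReal.ofReal (Real.exp (m.stoppedSum π α f N ω))) ω
          + {ω | m.Alive π α ω N}.indicator
            (fun ω => ENNReal.ofReal (Real.exp (m.stoppedSum π α f N ω))) ω
            * ∫⁻ z, ENNReal.ofReal (Real.exp (f (π.chosen ω N) z)) ∂(m.stepLaw (π.chosen ω N) θ))
            ∂(m.law θ) := by
        rw [lintegral_add_left hG', lintegral_add_left hG', key]
    _ = _ := by
        refine lintegral_congr fun ω => ?_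
        by_cases h : m.Alive π α ω N <;> simp [h]

/-! ### The stopped evidence -/

/-- Evidence for `θ` at the stopping time or at time `N`, whichever is earlier. -/
noncomputable def stoppedEvid (π : Policy M) (α : ℝ) (θ : Label) (N : ℕ) (ω : Sample M) : ℝ :=
  m.stoppedSum π α (fun j z => m.step θ j z.1) N ω

lemma measurable_step (θ : Label) (j : Fin M) : Measurable fun z : Label × ℝ => m.step θ j z.1 :=
  (measurable_of_countable fun y => m.step θ j y).comp measurable_fst

lemma stoppedEvid_eq (π : Policy M) (α : ℝ) (θ : Label) (ω : Sample M) (N : ℕ)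
    (h : ∀ s < N, m.Alive π α ω s) : m.stoppedEvid π α θ N ω = m.evid π θ ω N := by
  induction N with
  | zero => simp [stoppedEvid, stoppedSum, evid_zero]
  | succ N ih =>
    have := ih fun s hs => h s (hs.trans N.lt_succ_self)
    unfold stoppedEvid at this ⊢
    rw [stoppedSum_succ, this, evid_succ, aliveInd_of_alive _ (h N N.lt_succ_self), one_mul]

lemma stoppedSum_eq_of_not_alive (π : Policy M) (α : ℝ) (f : Fin M → Label × ℝ → ℝ) (ω : Sample M)
    {t N : ℕ} (htN : t ≤ N) (h : ¬m.Alive π α ω t) :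
    m.stoppedSum π α f N ω = m.stoppedSum π α f t ω := by
  induction N, htN using Nat.le_induction with
  | base => rfl
  | succ N hN ih =>
    rw [stoppedSum_succ, ih, aliveInd_of_not _ fun h' => h (h'.mono m hN), zero_mul, add_zero]

/-- If testing has stopped by time `N`, then the stopped evidence is the evidence at the first
exit time. -/
lemma exists_exit (π : Policy M) (α : ℝ) (θ : Label) (ω : Sample M) (N : ℕ)
    (h : ¬m.Alive π α ω N) :
    ∃ t ≤ N, (∀ s < t, m.Alive π α ω s) ∧ ¬m.Alive π α ω t ∧
      m.stoppedEvid π α θ N ω = m.evid π θ ω t := by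
  classical
  have hex : ∃ t, ¬m.Alive π α ω t := ⟨N, h⟩
  have h1 : ∀ s < Nat.find hex, m.Alive π α ω s := fun s hs => not_not.1 (Nat.find_min hex hs)
  have h2 : Nat.find hex ≤ N := Nat.find_min' hex h
  refine ⟨Nat.find hex, h2, h1, Nat.find_spec hex, ?_⟩
  rw [← m.stoppedEvid_eq π α θ ω _ h1]
  exact m.stoppedSum_eq_of_not_alive π α _ ω h2 (Nat.find_spec hex)

lemma exit_evid (π : Policy M) (α : ℝ) (θ : Label) (ω : Sample M) (t : ℕ)
    (h1 : ∀ s < t, m.Alive π α ω s) (h2 : ¬m.Alive π α ω t) :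
    m.thr α θ ≤ m.evid π θ ω t ∨ m.evid π θ ω t ≤ -m.thr α θ.other := by
  by_contra hc
  push Not at hc
  refine h2 ((m.alive_iff π α θ ω t).2 fun s hs => ?_)
  rcases hs.lt_or_eq with hs | rfl
  · exact (m.alive_iff π α θ ω s).1 (h1 s hs) s le_rfl
  · exact ⟨hc.2, hc.1⟩

lemma exit_abs_bound (π : Policy M) (α : ℝ) (θ : Label) (hθ : 0 < m.thr α θ)
    (hθ' : 0 < m.thr α θ.other) (ω : Sample M) (t : ℕ) (h1 : ∀ s < t, m.Alive π α ω s) :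
    -(m.thr α θ.other + m.llrBound) ≤ m.evid π θ ω t ∧
      m.evid π θ ω t ≤ m.thr α θ + m.llrBound := by
  cases t with
  | zero => rw [evid_zero]; constructor <;> linarith [m.llrBound_nonneg]
  | succ t =>
    have h3 := (m.alive_iff π α θ ω t).1 (h1 t t.lt_succ_self) t le_rfl
    have h4 := abs_le.1 (m.abs_step_le θ (π.chosen ω t) (ω t (π.chosen ω t)).1)
    rw [evid_succ]
    constructor <;> linarith

lemma stoppedEvid_of_alive (π : Policy M) (α : ℝ) (θ : Label) (ω : Sample M) (N : ℕ)
    (h : m.Alive π α ω N) : m.stoppedEvid π α θ N ω = m.evid π θ ω N :=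
  m.stoppedEvid_eq π α θ ω N fun _ hs => h.mono m hs.le

lemma stoppedEvid_bounds (π : Policy M) (α : ℝ) (θ : Label) (hθ : 0 < m.thr α θ)
    (hθ' : 0 < m.thr α θ.other) (N : ℕ) (ω : Sample M) :
    -(m.thr α θ.other + m.llrBound) ≤ m.stoppedEvid π α θ N ω ∧
      m.stoppedEvid π α θ N ω ≤ m.thr α θ + m.llrBound := by
  by_cases h : m.Alive π α ω N
  · rw [stoppedEvid_of_alive _ _ _ _ _ _ h]
    exact m.exit_abs_bound π α θ hθ hθ' ω N fun s hs => h.mono m hs.le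
  · obtain ⟨t, _, h1, _, h3⟩ := m.exists_exit π α θ ω N h
    rw [h3]
    exact m.exit_abs_bound π α θ hθ hθ' ω t h1

lemma stoppedEvid_of_not_alive (π : Policy M) (α : ℝ) (θ : Label) (N : ℕ) (ω : Sample M)
    (h : ¬m.Alive π α ω N) :
    m.thr α θ ≤ m.stoppedEvid π α θ N ω ∨ m.stoppedEvid π α θ N ω ≤ -m.thr α θ.other := by
  obtain ⟨t, _, h1, h2, h3⟩ := m.exists_exit π α θ ω N h
  rw [h3]
  exact m.exit_evid π α θ ω t h1 h2

lemma lintegral_stepLaw_fst (j : Fin M) (θ : Label) (h : Label → ℝ) (hh : ∀ y, 0 ≤ h y) :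
    ∫⁻ z, ENNReal.ofReal (h z.1) ∂(m.stepLaw j θ)
      = ENNReal.ofReal (m.acc j θ * h θ + (1 - m.acc j θ) * h θ.other) := by
  rw [← m.lintegral_outLaw j θ h hh]
  have : Measurable fun y => ENNReal.ofReal (h y) := measurable_of_countable _
  exact (measurePreserving_fst (μ := m.outLaw j θ) (ν := m.waitLaw j)).lintegral_comp this

/-- Under `θ` the stopped likelihood ratio of the other label has mean one. -/
lemma lintegral_exp_neg_stoppedEvid (π : Policy M) (α : ℝ) (θ : Label) (N : ℕ) :
    ∫⁻ ω, ENNReal.ofReal (Real.exp (-m.stoppedEvid π α θ N ω)) ∂(m.law θ) = 1 := by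
  classical
  have h0 : ∀ N ω, -m.stoppedEvid π α θ N ω
      = m.stoppedSum π α (fun j z => -m.step θ j z.1) N ω := by
    intro N ω
    simp [stoppedEvid, stoppedSum]
  simp only [h0]
  induction N with
  | zero => simp [stoppedSum]
  | succ N ih =>
    rw [m.lintegral_exp_stoppedSum_succ θ π α (fun j z => -m.step θ j z.1)
      (fun j => (m.measurable_step θ j).neg) N]
    refine Eq.trans (lintegral_congr fun ω => ?_) ih
    have : ∫⁻ z, ENNReal.ofReal (Real.exp (-m.step θ (π.chosen ω N) z.1))
        ∂(m.stepLaw (π.chosen ω N) θ) = 1 := by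
      rw [m.lintegral_stepLaw_fst _ θ (fun y => Real.exp (-m.step θ (π.chosen ω N) y))
        fun y => (Real.exp_pos _).le, mean_exp_neg_step, ENNReal.ofReal_one]
    rw [this, ite_self, mul_one]

/-- The probability of accepting the wrong hypothesis. -/
lemma measure_error_le (π : Policy M) (α : ℝ) (θ : Label) (N : ℕ) (x : ℝ) :
    (m.law θ).real {ω | m.stoppedEvid π α θ N ω ≤ -x} ≤ Real.exp (-x) := by
  have hm : Measurable (m.stoppedEvid π α θ N) :=
    m.measurable_stoppedSum π α _ (m.measurable_step θ) N
  have h1 := mul_meas_ge_le_lintegral (μ := m.law θ)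
    (f := fun ω => ENNReal.ofReal (Real.exp (-m.stoppedEvid π α θ N ω)))
    (ENNReal.measurable_ofReal.comp (Real.measurable_exp.comp hm.neg)) (ENNReal.ofReal (Real.exp x))
  rw [lintegral_exp_neg_stoppedEvid] at h1
  have h2 : {ω | ENNReal.ofReal (Real.exp x)
      ≤ ENNReal.ofReal (Real.exp (-m.stoppedEvid π α θ N ω))}
      = {ω | m.stoppedEvid π α θ N ω ≤ -x} := by
    ext ω
    simp only [Set.mem_ofPred_eq]
    rw [ENNReal.ofReal_le_ofReal_iff (Real.exp_pos _).le, Real.exp_le_exp]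
    constructor <;> intro h <;> linarith
  rw [h2] at h1
  have h3 := ENNReal.toReal_mono ENNReal.one_ne_top h1
  rw [ENNReal.toReal_mul, ENNReal.toReal_ofReal (Real.exp_pos _).le, ENNReal.toReal_one] at h3
  rw [Real.exp_neg, ← one_div, le_div_iff₀' (Real.exp_pos _)]
  exact h3

end Model

/-! ### Rewards and their exponential moments -/

lemma exists_pos_forall_le {ι : Type*} [Finite ι] (f : ι → ℝ) (h : ∀ i, 0 < f i) :
    ∃ ε, 0 < ε ∧ ∀ i, ε ≤ f i := by
  rcases isEmpty_or_nonempty ι with _ | _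
  · exact ⟨1, one_pos, fun i => isEmptyElim i⟩
  · obtain ⟨i, hi⟩ := Finite.exists_min f
    exact ⟨f i, h i, hi⟩

lemma exists_pos_forall_ge {ι : Type*} [Finite ι] (f : ι → ℝ) : ∃ B, 0 < B ∧ ∀ i, f i ≤ B := by
  obtain ⟨B, hB⟩ := (Set.finite_range f).bddAbove
  exact ⟨max B 1, by positivity, fun i => (hB ⟨i, rfl⟩).trans (le_max_left _ _)⟩

lemma exp_le_one_add_two_mul {x : ℝ} (h0 : 0 ≤ x) (h1 : x ≤ 1) : Real.exp x ≤ 1 + 2 * x := by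
  have := (abs_le.1 (Real.abs_exp_sub_one_sub_id_le (x := x) (by rwa [abs_of_nonneg h0]))).2
  nlinarith

namespace Model

variable (m : Model M)

/-- A nonnegative per-query quantity that depends on the chosen LLM and on its waiting time, has
mean `μ j` for LLM `j`, and has uniformly Gaussian-bounded exponential moments. Both the query cost
and the waiting time are of this form. -/
structure IsReward (r : Fin M → ℝ → ℝ) (μ : Fin M → ℝ) : Prop where
  measurable : ∀ j, Measurable (r j)
  nonneg : ∀ j x, 0 ≤ r j x
  integrable : ∀ j, Integrable (r j) (m.waitLaw j)
  integral_eq : ∀ j, ∫ x, r j x ∂(m.waitLaw j) = μ j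
  mean_pos : ∀ j, 0 < μ j
  exists_mgf_le : ∃ ψ : ℝ, 0 ≤ ψ ∧ ∀ j, ∀ l : ℝ,
    ∫⁻ x, ENNReal.ofReal (Real.exp (l * r j x)) ∂(m.waitLaw j)
      ≤ ENNReal.ofReal (Real.exp (l * μ j + ψ * l ^ 2))

lemma isReward_cost : m.IsReward (fun j _ => m.cost j) m.cost where
  measurable _ := measurable_const
  nonneg j _ := (m.cost_pos j).le
  integrable _ := integrable_const _
  integral_eq j := by simp
  mean_pos := m.cost_pos
  exists_mgf_le := ⟨0, le_rfl, fun j l => by simp⟩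

lemma wait_ae (j : Fin M) : (fun x : ℝ => max x 0) =ᵐ[m.waitLaw j] fun x => x := by
  filter_upwards [m.waitLaw_nonneg j] with x hx using max_eq_left hx

lemma isReward_wait : m.IsReward (fun _ x => max x 0) m.meanWait where
  measurable _ := measurable_id.max measurable_const
  nonneg _ _ := le_max_right _ _
  integrable j := (m.integrable_wait j).congr (m.wait_ae j).symm
  integral_eq j := integral_congr_ae (m.wait_ae j)
  mean_pos := m.meanWait_pos
  exists_mgf_le := by
    obtain ⟨ψ, _, h'⟩ := m.waitLaw_subgaussian
    have h : ∀ j, HasSubgaussianMGF (fun x => x - m.meanWait j) (ψ ^ 2) (m.waitLaw j) := h'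
    refine ⟨(ψ : ℝ) ^ 2 / 2, by positivity, fun j l => ?_⟩
    have h1 : ∫⁻ x, ENNReal.ofReal (Real.exp (l * max x 0)) ∂(m.waitLaw j)
        = ∫⁻ x, ENNReal.ofReal (Real.exp (l * m.meanWait j))
          * ENNReal.ofReal (Real.exp (l * (x - m.meanWait j))) ∂(m.waitLaw j) := by
      refine lintegral_congr_ae ?_
      filter_upwards [m.wait_ae j] with x hx
      rw [hx, ← ENNReal.ofReal_mul (Real.exp_pos _).le, ← Real.exp_add]
      ring_nf
    rw [h1, lintegral_const_mul' _ _ ENNReal.ofReal_ne_top,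
      ← ofReal_integral_eq_lintegral_ofReal ((h j).integrable_exp_mul l)
        (ae_of_all _ fun _ => (Real.exp_pos _).le), Real.exp_add,
      ENNReal.ofReal_mul (Real.exp_pos _).le]
    gcongr
    refine ((h j).mgf_le l).trans (le_of_eq ?_)
    push_cast
    ring_nf

open Classical in
/-- Total reward collected until testing stops. -/
noncomputable def totalReward (π : Policy M) (α : ℝ) (r : Fin M → ℝ → ℝ) (ω : Sample M) : ℝ≥0∞ :=
  ∑' t : ℕ, if m.Alive π α ω t then
    ENNReal.ofReal (r (π.chosen ω t) (ω t (π.chosen ω t)).2) else 0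

lemma totalCost_eq (π : Policy M) (α : ℝ) (ω : Sample M) :
    m.totalCost π α ω = m.totalReward π α (fun j _ => m.cost j) ω := by
  refine tsum_congr fun t => ?_
  have := m.lt_stopTime_iff π α ω t
  by_cases h : m.Alive π α ω t <;> simp [this, h]

lemma totalWait_eq (π : Policy M) (α : ℝ) (ω : Sample M) :
    m.totalWait π α ω = m.totalReward π α (fun _ x => max x 0) ω := by
  refine tsum_congr fun t => ?_
  have := m.lt_stopTime_iff π α ω t
  by_cases h : m.Alive π α ω t
  · simp only [this, h, if_true, Policy.waitAt]
    rcases le_total 0 (ω t (π.chosen ω t)).2 with h0 | h0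
    · rw [max_eq_left h0]
    · rw [max_eq_right h0, ENNReal.ofReal_of_nonpos h0, ENNReal.ofReal_zero]
  · simp [this, h]

/-- Reward collected until testing stops or time `N` is reached. -/
noncomputable def stoppedReward (π : Policy M) (α : ℝ) (r : Fin M → ℝ → ℝ) (N : ℕ)
    (ω : Sample M) : ℝ :=
  m.stoppedSum π α (fun j z => r j z.2) N ω

lemma sum_range_totalReward (π : Policy M) (α : ℝ) (r : Fin M → ℝ → ℝ) (hr : ∀ j x, 0 ≤ r j x)
    (N : ℕ) (ω : Sample M) [∀ t, Decidable (m.Alive π α ω t)] :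
    ∑ t ∈ Finset.range N, (if m.Alive π α ω t then
      ENNReal.ofReal (r (π.chosen ω t) (ω t (π.chosen ω t)).2) else 0)
      = ENNReal.ofReal (m.stoppedReward π α r N ω) := by
  rw [stoppedReward, stoppedSum, ENNReal.ofReal_sum_of_nonneg fun t _ =>
    mul_nonneg (m.aliveInd_nonneg _ _ _ _) (hr _ _)]
  refine Finset.sum_congr rfl fun t _ => ?_
  by_cases h : m.Alive π α ω t <;> simp [h, aliveInd_of_alive, aliveInd_of_not]

lemma ofReal_stoppedReward_le (π : Policy M) (α : ℝ) (r : Fin M → ℝ → ℝ) (hr : ∀ j x, 0 ≤ r j x)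
    (N : ℕ) (ω : Sample M) :
    ENNReal.ofReal (m.stoppedReward π α r N ω) ≤ m.totalReward π α r ω := by
  classical
  rw [← m.sum_range_totalReward π α r hr N ω]
  exact ENNReal.sum_le_tsum _

lemma measurable_stoppedReward (π : Policy M) (α : ℝ) (r : Fin M → ℝ → ℝ)
    (hr : ∀ j, Measurable (r j)) (N : ℕ) : Measurable (m.stoppedReward π α r N) :=
  m.measurable_stoppedSum π α _ (fun j => (hr j).comp measurable_snd) N

/-- A bound on the moments of the rewards truncated at time `N` that is uniform in `N` carries over
to the total reward. -/
lemma lintegral_totalReward_rpow_le (θ : Label) (π : Policy M) (α : ℝ) (r : Fin M → ℝ → ℝ)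
    (hrm : ∀ j, Measurable (r j)) (hr : ∀ j x, 0 ≤ r j x) (p : ℝ) (b : ℝ≥0∞)
    (h : ∀ N, ∫⁻ ω, ENNReal.ofReal (m.stoppedReward π α r N ω) ^ p ∂(m.law θ) ≤ b) :
    ∫⁻ ω, m.totalReward π α r ω ^ p ∂(m.law θ) ≤ b := by
  classical
  have hlim : ∀ ω, Tendsto (fun N => ENNReal.ofReal (m.stoppedReward π α r N ω) ^ p) atTop
      (𝓝 (m.totalReward π α r ω ^ p)) := by
    intro ω
    have h1 : Tendsto (fun N => ENNReal.ofReal (m.stoppedReward π α r N ω)) atTop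
        (𝓝 (m.totalReward π α r ω)) := by
      simp only [← m.sum_range_totalReward π α r hr]
      exact ENNReal.tendsto_nat_tsum _
    exact (ENNReal.continuous_rpow_const.tendsto _).comp h1
  calc ∫⁻ ω, m.totalReward π α r ω ^ p ∂(m.law θ)
      = ∫⁻ ω, liminf (fun N => ENNReal.ofReal (m.stoppedReward π α r N ω) ^ p) atTop
          ∂(m.law θ) := lintegral_congr fun ω => (hlim ω).liminf_eq.symm
    _ ≤ liminf (fun N => ∫⁻ ω, ENNReal.ofReal (m.stoppedReward π α r N ω) ^ p ∂(m.law θ)) atTop :=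
        lintegral_liminf_le fun N =>
          (ENNReal.measurable_ofReal.comp (m.measurable_stoppedReward π α r hrm N)).pow_const p
    _ ≤ liminf (fun _ : ℕ => b) atTop := liminf_le_liminf (Eventually.of_forall h)
    _ = b := by simp

/-- The exponential moment of one answer at parameter `κ`. -/
noncomputable def answerMgf (κ : ℝ) (j : Fin M) (θ : Label) : ℝ :=
  m.acc j θ * Real.exp (-(κ * m.step θ j θ))
    + (1 - m.acc j θ) * Real.exp (-(κ * m.step θ j θ.other))

lemma lintegral_exp_reward_sub_step (θ : Label) (j : Fin M) (r : Fin M → ℝ → ℝ)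
    (hr : ∀ j, Measurable (r j)) (l κ : ℝ) :
    ∫⁻ z, ENNReal.ofReal (Real.exp (l * r j z.2 - κ * m.step θ j z.1)) ∂(m.stepLaw j θ)
      = ENNReal.ofReal (m.answerMgf κ j θ)
        * ∫⁻ x, ENNReal.ofReal (Real.exp (l * r j x)) ∂(m.waitLaw j) := by
  have h1 : ∀ z : Label × ℝ, ENNReal.ofReal (Real.exp (l * r j z.2 - κ * m.step θ j z.1))
      = ENNReal.ofReal (Real.exp (-(κ * m.step θ j z.1)))
        * ENNReal.ofReal (Real.exp (l * r j z.2)) := by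
    intro z
    rw [← ENNReal.ofReal_mul (Real.exp_pos _).le, ← Real.exp_add]
    ring_nf
  have hm2 : Measurable fun x => ENNReal.ofReal (Real.exp (l * r j x)) :=
    ENNReal.measurable_ofReal.comp (Real.measurable_exp.comp ((hr j).const_mul l))
  rw [lintegral_congr h1, stepLaw, lintegral_prod_mul
    (f := fun y => ENNReal.ofReal (Real.exp (-(κ * m.step θ j y))))
    (g := fun x => ENNReal.ofReal (Real.exp (l * r j x)))
    (measurable_of_countable _).aemeasurable hm2.aemeasurable,
    m.lintegral_outLaw j θ (fun y => Real.exp (-(κ * m.step θ j y))) fun _ => (Real.exp_pos _).le]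
  rfl

lemma answerMgf_pos (κ : ℝ) (j : Fin M) (θ : Label) : 0 < m.answerMgf κ j θ := by
  have := m.acc_pos j θ
  have := m.one_sub_acc_pos j θ
  unfold answerMgf
  positivity

lemma answerMgf_add_half_le {κ : ℝ} (hκ : 0 ≤ κ) (j : Fin M) (θ : Label) :
    m.answerMgf (κ + 1 / 2) j θ ≤ Real.exp (κ * m.llrBound) * m.bhatt j θ := by
  have h1 := m.acc_pos j θ
  have h2 := m.one_sub_acc_pos j θ
  have key : ∀ y, Real.exp (-((κ + 1 / 2) * m.step θ j y))
      ≤ Real.exp (κ * m.llrBound) * Real.exp (-(m.step θ j y / 2)) := by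
    intro y
    rw [← Real.exp_add]
    apply Real.exp_le_exp.2
    nlinarith [(abs_le.1 (m.abs_step_le θ j y)).1]
  unfold answerMgf bhatt
  nlinarith [mul_le_mul_of_nonneg_left (key θ) h1.le, mul_le_mul_of_nonneg_left (key θ.other) h2.le]

/-- Parameters for the exponential supermartingale: to first order in `l`, the exponent `κ` is the
reward of LLM `j₀` per unit of information, and a multiple of the Bhattacharyya factor
compensates for the queries of the other LLMs. -/
lemma exists_supermartingale_parameters (θ : Label) (j₀ : Fin M) (μ : Fin M → ℝ)
    (hμ : ∀ j, 0 < μ j) (ψ : ℝ) (hψ : 0 ≤ ψ) :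
    ∃ K D δ : ℝ, 0 ≤ K ∧ 0 < D ∧ 0 < δ ∧ ∀ᶠ l in 𝓝[>] (0 : ℝ), ∀ κ : ℝ,
      κ = l * (μ j₀ / m.info j₀ θ) + K * l ^ 2 →
      Real.exp (l * μ j₀ + ψ * l ^ 2) * m.answerMgf κ j₀ θ ≤ 1 ∧
      ∀ i, Real.exp (l * μ i + ψ * l ^ 2) * m.answerMgf (κ + 1 / 2) i θ ≤ 1 - δ ∧
        Real.exp (l * μ i + ψ * l ^ 2) * m.answerMgf κ i θ ≤ 1 + l * D * δ := by
  set C := m.llrBound with hC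
  have hC0 : 0 < C := m.llrBound_pos j₀
  have hI := m.info_pos j₀ θ
  set q := μ j₀ / m.info j₀ θ with hq
  have hq0 : 0 < q := div_pos (hμ j₀) hI
  set K := (ψ + C ^ 2 * (q + 1) ^ 2) / m.info j₀ θ with hK
  have hK0 : 0 ≤ K := by positivity
  obtain ⟨δ, hδ, hδ'⟩ := exists_pos_forall_le (fun i => (1 - m.bhatt i θ) / 2)
    fun i => by linarith [m.bhatt_lt_one i θ]
  obtain ⟨E, hE, hE'⟩ := exists_pos_forall_ge fun i => μ i + ψ + C ^ 2 * (q + 1) ^ 2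
  have e1 : ∀ᶠ l in 𝓝[>] (0 : ℝ), 0 < l := self_mem_nhdsWithin
  have small : ∀ c : ℝ, ∀ᶠ l in 𝓝[>] (0 : ℝ), c * l < 1 := by
    intro c
    have : Tendsto (fun l : ℝ => c * l) (𝓝[>] 0) (𝓝 (c * 0)) :=
      ((continuous_const.mul continuous_id).tendsto 0).mono_left nhdsWithin_le_nhds
    rw [mul_zero] at this
    exact this.eventually_lt_const one_pos
  have e2 : ∀ i, ∀ᶠ l in 𝓝[>] (0 : ℝ), Real.exp (l * μ i + ψ * l ^ 2)
      * (Real.exp ((l * q + K * l ^ 2) * C) * m.bhatt i θ) < 1 - δ := by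
    intro i
    have hcont : Continuous fun l : ℝ => Real.exp (l * μ i + ψ * l ^ 2)
      * (Real.exp ((l * q + K * l ^ 2) * C) * m.bhatt i θ) := by fun_prop
    have := (hcont.tendsto 0).mono_left (nhdsWithin_le_nhds (s := Set.Ioi 0))
    refine this.eventually_lt_const ?_
    have h3 := hδ' i
    have h4 := m.bhatt_lt_one i θ
    simp
    linarith
  refine ⟨K, 2 * E / δ, δ, hK0, by positivity, hδ, ?_⟩
  filter_upwards [e1, small 1, small K, small ((q + 1) * C), small E, eventually_all.2 e2]
    with l hl hl1 hlK hlC hlE hb κ hκ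
  have hκ0 : 0 ≤ κ := by rw [hκ]; positivity
  have hκ1 : κ ≤ (q + 1) * l := by rw [hκ]; nlinarith
  have hκC : κ * C ≤ 1 := by nlinarith
  have hκ2 : C ^ 2 * κ ^ 2 ≤ C ^ 2 * (q + 1) ^ 2 * l ^ 2 := by
    have : κ ^ 2 ≤ ((q + 1) * l) ^ 2 := pow_le_pow_left₀ hκ0 hκ1 2
    nlinarith [sq_nonneg C]
  have hmgf : ∀ i, Real.exp (l * μ i + ψ * l ^ 2) * m.answerMgf κ i θ
      ≤ Real.exp (l * μ i + ψ * l ^ 2 + (-(κ * m.info i θ) + C ^ 2 * κ ^ 2)) := by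
    intro i
    rw [Real.exp_add (l * μ i + ψ * l ^ 2)]
    exact mul_le_mul_of_nonneg_left (m.mean_exp_neg_mul_step_le i θ hκ0 hκC) (Real.exp_pos _).le
  refine ⟨(hmgf j₀).trans ?_, fun i => ⟨?_, (hmgf i).trans ?_⟩⟩
  · rw [← Real.exp_zero]
    apply Real.exp_le_exp.2
    have h1 : κ * m.info j₀ θ = l * μ j₀ + (ψ + C ^ 2 * (q + 1) ^ 2) * l ^ 2 := by
      have h2 : q * m.info j₀ θ = μ j₀ := div_mul_cancel₀ _ hI.ne'
      have h3 : K * m.info j₀ θ = ψ + C ^ 2 * (q + 1) ^ 2 := div_mul_cancel₀ _ hI.ne'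
      rw [hκ]
      linear_combination l * h2 + l ^ 2 * h3
    rw [h1]
    nlinarith
  · refine le_trans ?_ (hb i).le
    rw [← hκ]
    exact mul_le_mul_of_nonneg_left (m.answerMgf_add_half_le hκ0 i θ) (Real.exp_pos _).le
  · have h1 : l * μ i + ψ * l ^ 2 + (-(κ * m.info i θ) + C ^ 2 * κ ^ 2) ≤ E * l := by
      have h2 := mul_nonneg hκ0 (m.info_pos i θ).le
      have h3 := mul_le_mul_of_nonneg_left (hE' i) hl.le
      nlinarith [mul_nonneg hψ hl.le, mul_nonneg (sq_nonneg (C * (q + 1))) hl.le]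
    refine (Real.exp_le_exp.2 h1).trans ((exp_le_one_add_two_mul (by positivity) hlE.le).trans ?_)
    have : l * (2 * E / δ) * δ = 2 * E * l := by field_simp
    rw [this]
    linarith

/-! ### Upper bounds for the moments of the rewards -/

lemma stoppedSum_reward_sub_step (π : Policy M) (α : ℝ) (θ : Label) (r : Fin M → ℝ → ℝ) (l κ : ℝ)
    (N : ℕ) (ω : Sample M) :
    m.stoppedSum π α (fun j z => l * r j z.2 - κ * m.step θ j z.1) N ω
      = l * m.stoppedReward π α r N ω - κ * m.stoppedEvid π α θ N ω := by
  rw [stoppedSum_sub _ _ _ (fun j z => l * r j z.2) (fun j z => κ * m.step θ j z.1),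
    stoppedSum_const_mul _ _ _ _ (fun j z => r j z.2),
    stoppedSum_const_mul _ _ _ _ (fun j z => m.step θ j z.1)]
  rfl

/-- If LLM `j₀` is queried whenever the evidence for `θ` is positive, then
`exp (l X - κ E) (1 + l D exp (-E / 2))`, where `X` is the collected reward and `E` the evidence for
`θ`, is a supermartingale under `θ`. -/
lemma lintegral_exp_supermartingale (θ : Label) (j₀ : Fin M) (π : Policy M) (α : ℝ)
    (hπ : ∀ ω t, 0 < m.evid π θ ω t → π.chosen ω t = j₀)
    (r : Fin M → ℝ → ℝ) (hr : ∀ j, Measurable (r j)) {l κ D δ : ℝ} {φ : Fin M → ℝ}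
    (hl : 0 < l) (hD : 0 < D) (hδ : 0 < δ) (hφ : ∀ j, 0 < φ j)
    (hmgf : ∀ j, ∫⁻ x, ENNReal.ofReal (Real.exp (l * r j x)) ∂(m.waitLaw j)
      ≤ ENNReal.ofReal (φ j))
    (h0 : φ j₀ * m.answerMgf κ j₀ θ ≤ 1)
    (h1 : ∀ i, φ i * m.answerMgf (κ + 1 / 2) i θ ≤ 1 - δ)
    (h2 : ∀ i, φ i * m.answerMgf κ i θ ≤ 1 + l * D * δ) (N : ℕ) :
    ∫⁻ ω, ENNReal.ofReal (Real.exp (l * m.stoppedReward π α r N ω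
        - κ * m.stoppedEvid π α θ N ω)) ∂(m.law θ)
      + ENNReal.ofReal (l * D) * ∫⁻ ω, ENNReal.ofReal (Real.exp (l * m.stoppedReward π α r N ω
        - (κ + 1 / 2) * m.stoppedEvid π α θ N ω)) ∂(m.law θ) ≤ ENNReal.ofReal (1 + l * D) := by
  classical
  have hlD : 0 < l * D := mul_pos hl hD
  have hf : ∀ κ : ℝ, ∀ j, Measurable fun z : Label × ℝ => l * r j z.2 - κ * m.step θ j z.1 :=
    fun κ j => (((hr j).comp measurable_snd).const_mul l).sub ((m.measurable_step θ j).const_mul κ)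
  simp only [← stoppedSum_reward_sub_step]
  induction N with
  | zero =>
    simp only [stoppedSum, Finset.range_zero, Finset.sum_empty, Real.exp_zero, ENNReal.ofReal_one,
      lintegral_one, measure_univ, mul_one]
    rw [ENNReal.ofReal_add zero_le_one hlD.le, ENNReal.ofReal_one]
  | succ N ih =>
    refine le_trans ?_ ih
    have hmeas : ∀ κ : ℝ, Measurable fun ω => ENNReal.ofReal (Real.exp
        (m.stoppedSum π α (fun j z => l * r j z.2 - κ * m.step θ j z.1) N ω)) := fun κ =>
      ENNReal.measurable_ofReal.comp (Real.measurable_exp.comp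
        (m.measurable_stoppedSum π α _ (hf κ) N))
    rw [m.lintegral_exp_stoppedSum_succ θ π α _ (hf κ),
      m.lintegral_exp_stoppedSum_succ θ π α _ (hf (κ + 1 / 2)),
      ← lintegral_const_mul _ (hmeas _), ← lintegral_add_left (hmeas κ)]
    rw [← lintegral_const_mul' _ _ ENNReal.ofReal_ne_top]
    refine (le_lintegral_add _ _).trans (lintegral_mono fun ω => ?_)
    by_cases h : m.Alive π α ω N
    swap
    · simp [h]
    simp only [h, if_true]
    set i := π.chosen ω N with hi
    simp only [stoppedSum_reward_sub_step]
    rw [m.lintegral_exp_reward_sub_step θ i r hr, m.lintegral_exp_reward_sub_step θ i r hr]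
    set a := Real.exp (l * m.stoppedReward π α r N ω - κ * m.stoppedEvid π α θ N ω) with ha
    set b := Real.exp (l * m.stoppedReward π α r N ω
      - (κ + 1 / 2) * m.stoppedEvid π α θ N ω) with hb
    have ha0 : 0 < a := Real.exp_pos _
    have hb0 : 0 < b := Real.exp_pos _
    have hA1 := m.answerMgf_pos κ i θ
    have hA2 := m.answerMgf_pos (κ + 1 / 2) i θ
    have hreal : a * (m.answerMgf κ i θ * φ i)
        + l * D * (b * (m.answerMgf (κ + 1 / 2) i θ * φ i)) ≤ a + l * D * b := by
      have h1' := h1 i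
      have h2' := h2 i
      by_cases hpos : 0 < m.evid π θ ω N
      · have : i = j₀ := hπ ω N hpos
        have h0' : m.answerMgf κ i θ * φ i ≤ 1 := by rw [this, mul_comm]; exact h0
        have h3 : m.answerMgf (κ + 1 / 2) i θ * φ i ≤ 1 := by linarith
        nlinarith [mul_le_mul_of_nonneg_left h0' ha0.le,
          mul_le_mul_of_nonneg_left h3 (mul_pos hlD hb0).le]
      · have hab : a ≤ b := by
          rw [ha, hb]
          apply Real.exp_le_exp.2
          rw [m.stoppedEvid_of_alive π α θ ω N h]
          linarith
        have e1 := mul_le_mul_of_nonneg_left h2' ha0.le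
        have e2 := mul_le_mul_of_nonneg_left h1' (mul_pos hlD hb0).le
        have e3 := mul_le_mul_of_nonneg_left hab (mul_pos hlD hδ).le
        nlinarith
    calc ENNReal.ofReal a * (ENNReal.ofReal (m.answerMgf κ i θ)
            * ∫⁻ x, ENNReal.ofReal (Real.exp (l * r i x)) ∂(m.waitLaw i))
          + ENNReal.ofReal (l * D) * (ENNReal.ofReal b
            * (ENNReal.ofReal (m.answerMgf (κ + 1 / 2) i θ)
            * ∫⁻ x, ENNReal.ofReal (Real.exp (l * r i x)) ∂(m.waitLaw i)))
        ≤ ENNReal.ofReal a * (ENNReal.ofReal (m.answerMgf κ i θ) * ENNReal.ofReal (φ i))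
          + ENNReal.ofReal (l * D) * (ENNReal.ofReal b
            * (ENNReal.ofReal (m.answerMgf (κ + 1 / 2) i θ) * ENNReal.ofReal (φ i))) := by
          gcongr <;> exact hmgf i
      _ = ENNReal.ofReal (a * (m.answerMgf κ i θ * φ i)
          + l * D * (b * (m.answerMgf (κ + 1 / 2) i θ * φ i))) := by
          have := hφ i
          rw [ENNReal.ofReal_add (by positivity) (by positivity), ENNReal.ofReal_mul ha0.le,
            ENNReal.ofReal_mul hA1.le, ENNReal.ofReal_mul hlD.le, ENNReal.ofReal_mul hb0.le,
            ENNReal.ofReal_mul hA2.le]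
      _ ≤ ENNReal.ofReal (a + l * D * b) := ENNReal.ofReal_le_ofReal hreal
      _ = _ := by
          rw [ENNReal.ofReal_add ha0.le (by positivity), ENNReal.ofReal_mul hlD.le]

/-- Moments of the rewards of a policy that queries LLM `j₀` whenever the evidence for `θ` is
positive: the `p`-th moment exceeds the `p`-th power of the reward that LLM `j₀` needs, on average,
for `S` units of information by a term of lower order. The moment is bounded by an exponential
moment through `(x / b) ^ p ≤ exp (p (x / b - 1))`. -/
lemma exists_lintegral_totalReward_rpow_le (θ : Label) (j₀ : Fin M) {r : Fin M → ℝ → ℝ}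
    {μ : Fin M → ℝ} (hr : m.IsReward r μ) {p : ℝ} (hp : 1 ≤ p) :
    ∃ K S₀ : ℝ, 0 ≤ K ∧ ∀ S, S₀ ≤ S → ∀ (α : ℝ) (π : Policy M),
      (∀ ω t, 0 < m.evid π θ ω t → π.chosen ω t = j₀) →
      0 < m.thr α θ → 0 < m.thr α θ.other → m.thr α θ ≤ S + 1 →
      ∫⁻ ω, m.totalReward π α r ω ^ p ∂(m.law θ)
        ≤ ENNReal.ofReal ((μ j₀ * (S / m.info j₀ θ)) ^ p + K * S ^ (p - 1)) := by
  obtain ⟨ψ, hψ, hmgf⟩ := hr.exists_mgf_le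
  obtain ⟨K, D, δ, hK, hD, hδ, hev⟩ :=
    m.exists_supermartingale_parameters θ j₀ μ hr.mean_pos ψ hψ
  set q := μ j₀ / m.info j₀ θ with hq
  have hq0 : 0 < q := div_pos (hr.mean_pos j₀) (m.info_pos j₀ θ)
  have hp0 : 0 < p := by linarith
  set C := m.llrBound with hC
  have hC0 : 0 < C := m.llrBound_pos j₀
  have htend : Tendsto (fun S : ℝ => p / (q * S)) atTop (𝓝[>] 0) := by
    refine tendsto_nhdsWithin_iff.2 ⟨?_, ?_⟩
    · exact tendsto_const_nhds.div_atTop (tendsto_id.const_mul_atTop hq0)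
    · filter_upwards [eventually_gt_atTop 0] with S hS
      exact div_pos hp0 (mul_pos hq0 hS)
  -- the exponent `l D + κ (S + 1 + C) - p` is at most `B / S`
  set B := p * D / q + p * (1 + C) + K * p ^ 2 / q ^ 2 * (2 + C) with hB
  have hB0 : 0 ≤ B := by positivity
  obtain ⟨S₁, hS₁⟩ := eventually_atTop.1 (htend.eventually hev)
  refine ⟨q ^ p * (2 * B), max S₁ (max 1 B), by positivity, ?_⟩
  intro S hS α π hπ hθ hθ' hthr
  have hS1 : 1 ≤ S := le_trans (by simp) hS
  have hSB : B ≤ S := le_trans (by simp) hS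
  have hS0 : 0 < S := by linarith
  set l := p / (q * S) with hl
  have hl0 : 0 < l := div_pos hp0 (mul_pos hq0 hS0)
  set κ := l * q + K * l ^ 2 with hκ
  have hκ0 : 0 ≤ κ := by positivity
  obtain ⟨h0, h12⟩ := hS₁ S (le_trans (by simp) hS) κ hκ
  set b := q * S with hb
  have hb0 : 0 < b := mul_pos hq0 hS0
  have hb' : μ j₀ * (S / m.info j₀ θ) = b := by rw [hb, hq]; ring
  have hexp : l * D + κ * (S + 1 + C) ≤ p + B / S := by
    have e1 : l * D = p * D / q / S := by rw [hl, hb]; field_simp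
    have e2 : κ * (S + 1 + C) = p + p * (1 + C) / S + K * p ^ 2 / q ^ 2 / S
        * ((S + 1 + C) / S) := by
      rw [hκ, hl]; field_simp; ring
    have e3 : (S + 1 + C) / S ≤ 2 + C := by
      rw [div_le_iff₀ hS0]; nlinarith
    have e4 : K * p ^ 2 / q ^ 2 / S * ((S + 1 + C) / S) ≤ K * p ^ 2 / q ^ 2 / S * (2 + C) :=
      mul_le_mul_of_nonneg_left e3 (by positivity)
    have e5 : B / S = p * D / q / S + p * (1 + C) / S + K * p ^ 2 / q ^ 2 / S * (2 + C) := by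
      rw [hB]; ring
    rw [e1, e2, e5]
    linarith
  rw [hb']
  refine m.lintegral_totalReward_rpow_le θ π α r hr.measurable hr.nonneg p _ fun N => ?_
  have hsup := m.lintegral_exp_supermartingale θ j₀ π α hπ r hr.measurable hl0 hD hδ
    (fun j => Real.exp_pos (l * μ j + ψ * l ^ 2)) (fun j => hmgf j l) h0 (fun i => (h12 i).1)
    (fun i => (h12 i).2) N
  have hsup' := le_trans le_self_add hsup
  have hpt : ∀ ω, ENNReal.ofReal (m.stoppedReward π α r N ω) ^ p
      ≤ ENNReal.ofReal (b ^ p * Real.exp (-p + κ * (S + 1 + C)))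
        * ENNReal.ofReal (Real.exp (l * m.stoppedReward π α r N ω
          - κ * m.stoppedEvid π α θ N ω)) := by
    intro ω
    have hX : 0 ≤ m.stoppedReward π α r N ω :=
      m.stoppedSum_nonneg π α (fun _ _ => hr.nonneg _ _) _ _
    rw [ENNReal.ofReal_rpow_of_nonneg hX hp0.le,
      ← ENNReal.ofReal_mul (mul_pos (Real.rpow_pos_of_pos hb0 p) (Real.exp_pos _)).le, mul_assoc,
      ← Real.exp_add]
    apply ENNReal.ofReal_le_ofReal
    have h3 : m.stoppedReward π α r N ω / b
        ≤ Real.exp (m.stoppedReward π α r N ω / b - 1) := by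
      have := Real.add_one_le_exp (m.stoppedReward π α r N ω / b - 1)
      linarith
    have h4 := Real.rpow_le_rpow (by positivity) h3 hp0.le
    rw [Real.div_rpow hX hb0.le, div_le_iff₀ (Real.rpow_pos_of_pos hb0 p), ← Real.exp_mul] at h4
    rw [mul_comm (b ^ p)]
    refine h4.trans (mul_le_mul_of_nonneg_right (Real.exp_le_exp.2 ?_)
      (Real.rpow_pos_of_pos hb0 p).le)
    have h5 := (m.stoppedEvid_bounds π α θ hθ hθ' N ω).2
    have h6 : κ * m.stoppedEvid π α θ N ω ≤ κ * (S + 1 + C) :=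
      mul_le_mul_of_nonneg_left (by linarith) hκ0
    have h7 : (m.stoppedReward π α r N ω / b - 1) * p = l * m.stoppedReward π α r N ω - p := by
      rw [hl]; field_simp
    rw [h7]
    linarith
  refine (lintegral_mono hpt).trans ?_
  rw [lintegral_const_mul' _ _ ENNReal.ofReal_ne_top]
  refine (mul_le_mul_right hsup' _).trans ?_
  rw [← ENNReal.ofReal_mul (by positivity)]
  apply ENNReal.ofReal_le_ofReal
  have h8 : 1 + l * D ≤ Real.exp (l * D) := by linarith [Real.add_one_le_exp (l * D)]
  have h9 : Real.exp (-p + κ * (S + 1 + C)) * (1 + l * D) ≤ 1 + 2 * (B / S) := by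
    calc _ ≤ Real.exp (-p + κ * (S + 1 + C)) * Real.exp (l * D) :=
          mul_le_mul_of_nonneg_left h8 (Real.exp_pos _).le
      _ ≤ Real.exp (B / S) := by
          rw [← Real.exp_add]
          apply Real.exp_le_exp.2
          linarith
      _ ≤ _ := exp_le_one_add_two_mul (by positivity) ((div_le_one hS0).2 hSB)
  have h10 : S ^ p = S ^ (p - 1) * S := by
    rw [Real.rpow_sub_one hS0.ne', div_mul_cancel₀ _ hS0.ne']
  have h11 : b ^ p = q ^ p * (S ^ (p - 1) * S) := by
    rw [hb, Real.mul_rpow hq0.le hS0.le, h10]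
  calc _ = b ^ p * (Real.exp (-p + κ * (S + 1 + C)) * (1 + l * D)) := by ring
    _ ≤ b ^ p * (1 + 2 * (B / S)) := mul_le_mul_of_nonneg_left h9 (by positivity)
    _ = b ^ p + q ^ p * (2 * B) * S ^ (p - 1) := by
        rw [h11]; field_simp

/-! ### The allocation problem -/

/-- Cost under `θ` of collecting exactly `S` units of information from LLM `j` alone. -/
noncomputable def singleCost (θ : Label) (j : Fin M) (S : ℝ) : ℝ :=
  m.cost j * (S / m.info j θ) + m.g (m.meanWait j * (S / m.info j θ))

/-- The marginal waiting penalty at the expected waiting time that LLM `j` needs for `S` units of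
information under `θ`. -/
noncomputable def slope (θ : Label) (j : Fin M) (S : ℝ) : ℝ :=
  m.gCoef * m.ρ * (m.meanWait j * (S / m.info j θ)) ^ (m.ρ - 1)

/-- When waiting is charged at the linear rate `y`, no LLM is cheaper than LLM `j` per unit of
information under `θ`. -/
def DominatesAt (θ : Label) (j : Fin M) (y : ℝ) : Prop :=
  ∀ i, (m.cost j + y * m.meanWait j) * m.info i θ ≤ (m.cost i + y * m.meanWait i) * m.info j θ

lemma exists_dominatesAt [NeZero M] (θ : Label) (y : ℝ) : ∃ j, m.DominatesAt θ j y := by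
  obtain ⟨j, hj⟩ := Finite.exists_min fun i => (m.cost i + y * m.meanWait i) / m.info i θ
  exact ⟨j, fun i => (div_le_div_iff₀ (m.info_pos j θ) (m.info_pos i θ)).1 (hj i)⟩

/-- For large rates the LLM that is lexicographically optimal, first in waiting time and then in
cost per unit of information, dominates. -/
lemma exists_dominatesAt_atTop [NeZero M] (θ : Label) :
    ∃ j, ∀ᶠ y in atTop, m.DominatesAt θ j y := by
  obtain ⟨j, hj⟩ := Finite.exists_min fun i =>
    toLex (m.meanWait i / m.info i θ, m.cost i / m.info i θ)
  refine ⟨j, eventually_all.2 fun i => ?_⟩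
  have hIj := m.info_pos j θ
  have hIi := m.info_pos i θ
  rcases Prod.Lex.toLex_le_toLex.1 (hj i) with h | ⟨h1, h2⟩
  · rw [div_lt_div_iff₀ hIj hIi] at h
    have hgap : 0 < m.meanWait i * m.info j θ - m.meanWait j * m.info i θ := by linarith
    filter_upwards [eventually_ge_atTop ((m.cost j * m.info i θ - m.cost i * m.info j θ)
      / (m.meanWait i * m.info j θ - m.meanWait j * m.info i θ))] with y hy
    rw [div_le_iff₀ hgap] at hy
    nlinarith
  · rw [div_eq_div_iff hIj.ne' hIi.ne'] at h1
    rw [div_le_div_iff₀ hIj hIi] at h2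
    filter_upwards with y
    linear_combination h2 + y * h1

lemma slope_nonneg (θ : Label) (j : Fin M) {S : ℝ} (hS : 0 ≤ S) : 0 ≤ m.slope θ j S := by
  have := m.gCoef_nonneg
  have := m.one_le_ρ
  have := m.meanWait_pos j
  have := m.info_pos j θ
  unfold slope
  positivity

lemma tendsto_slope (θ : Label) (j : Fin M) (hρ : 1 < m.ρ) (hg : 0 < m.gCoef) :
    Tendsto (m.slope θ j) atTop atTop := by
  have h1 : Tendsto (fun S : ℝ => m.meanWait j * (S / m.info j θ)) atTop atTop :=
    (tendsto_id.atTop_div_const (m.info_pos j θ)).const_mul_atTop (m.meanWait_pos j)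
  exact ((tendsto_rpow_atTop (by linarith)).comp h1).const_mul_atTop
    (mul_pos hg (by linarith))

/-- For all large budgets `S`, collecting `S` units of information from LLM `j` alone is optimal
under `θ`. -/
def Dominant (θ : Label) (j : Fin M) : Prop :=
  ∀ᶠ S in atTop, m.DominatesAt θ j (m.slope θ j S)

lemma exists_dominant [NeZero M] (θ : Label) : ∃ j, m.Dominant θ j := by
  by_cases h : 1 < m.ρ ∧ 0 < m.gCoef
  · obtain ⟨j, hj⟩ := m.exists_dominatesAt_atTop θ
    exact ⟨j, (m.tendsto_slope θ j h.1 h.2).eventually hj⟩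
  · obtain ⟨j, hj⟩ := m.exists_dominatesAt θ m.gCoef
    refine ⟨j, Eventually.of_forall fun S => ?_⟩
    have : m.slope θ j S = m.gCoef := by
      have h1 := m.one_le_ρ
      have h2 := m.gCoef_nonneg
      rw [slope]
      rcases h1.lt_or_eq with h3 | h3
      · have : m.gCoef = 0 := le_antisymm (not_lt.1 fun h4 => h ⟨h3, h4⟩) h2
        rw [this]; ring
      · rw [← h3]; simp
    rwa [this]

lemma g_nonneg {x : ℝ} (hx : 0 ≤ x) : 0 ≤ m.g x :=
  mul_nonneg m.gCoef_nonneg (Real.rpow_nonneg hx _)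

/-- The graph of the waiting penalty lies above its tangent lines. -/
lemma g_tangent_le {b x : ℝ} (hb : 0 < b) (hx : 0 ≤ x) :
    m.g b + m.gCoef * m.ρ * b ^ (m.ρ - 1) * (x - b) ≤ m.g x := by
  have h1 := one_add_mul_self_le_rpow_one_add (s := x / b - 1)
    (by have := div_nonneg hx hb.le; linarith) m.one_le_ρ
  rw [add_sub_cancel, Real.div_rpow hx hb.le, le_div_iff₀ (Real.rpow_pos_of_pos hb _)] at h1
  have h2 : b ^ m.ρ = b ^ (m.ρ - 1) * b := by
    rw [Real.rpow_sub_one hb.ne', div_mul_cancel₀ _ hb.ne']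
  have h3 : (1 + m.ρ * (x / b - 1)) * b ^ m.ρ
      = b ^ m.ρ + m.ρ * b ^ (m.ρ - 1) * (x - b) := by
    rw [h2]; field_simp
  rw [h3] at h1
  unfold g
  nlinarith [mul_le_mul_of_nonneg_left h1 m.gCoef_nonneg]

/-- The cost of LLM `j` is the value of the tangent of the penalty at its expected waiting time. -/
lemma singleCost_eq (θ : Label) (j : Fin M) (S : ℝ) :
    m.singleCost θ j S = m.g (m.meanWait j * (S / m.info j θ))
      - m.slope θ j S * (m.meanWait j * (S / m.info j θ))
      + (m.cost j + m.slope θ j S * m.meanWait j) / m.info j θ * S := by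
  unfold singleCost
  ring

lemma singleCost_nonneg (θ : Label) (j : Fin M) {S : ℝ} (hS : 0 ≤ S) :
    0 ≤ m.singleCost θ j S := by
  have := m.gCoef_nonneg
  have := m.meanWait_pos j
  have := m.info_pos j θ
  have := m.cost_pos j
  unfold singleCost g
  positivity

lemma singleCost_le_alloc (θ : Label) (j : Fin M) {S : ℝ} (hS : 0 < S)
    (hdom : m.DominatesAt θ j (m.slope θ j S)) (n : Fin M → ℝ) (hn : ∀ i, 0 ≤ n i)
    (hS' : S ≤ ∑ i, m.info i θ * n i) :
    m.singleCost θ j S ≤ ∑ i, m.cost i * n i + m.g (∑ i, m.meanWait i * n i) := by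
  have hI := m.info_pos j θ
  have hb : 0 < m.meanWait j * (S / m.info j θ) := mul_pos (m.meanWait_pos j) (div_pos hS hI)
  have hy := m.slope_nonneg θ j hS.le
  have h1 := m.g_tangent_le hb (x := ∑ i, m.meanWait i * n i)
    (Finset.sum_nonneg fun i _ => mul_nonneg (m.meanWait_pos i).le (hn i))
  have hr : 0 ≤ (m.cost j + m.slope θ j S * m.meanWait j) / m.info j θ := by
    have := m.cost_pos j
    have := m.meanWait_pos j
    positivity
  have h2 : (m.cost j + m.slope θ j S * m.meanWait j) / m.info j θ * ∑ i, m.info i θ * n i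
      ≤ ∑ i, m.cost i * n i + m.slope θ j S * ∑ i, m.meanWait i * n i := by
    rw [Finset.mul_sum, Finset.mul_sum, ← Finset.sum_add_distrib]
    refine Finset.sum_le_sum fun i _ => ?_
    have h3 : (m.cost j + m.slope θ j S * m.meanWait j) / m.info j θ * m.info i θ
        ≤ m.cost i + m.slope θ j S * m.meanWait i := by
      rw [div_mul_eq_mul_div, div_le_iff₀ hI]
      exact hdom i
    nlinarith [mul_le_mul_of_nonneg_right h3 (hn i)]
  have h4 := mul_le_mul_of_nonneg_left hS' hr
  rw [singleCost_eq]
  unfold slope at *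
  linarith

lemma alloc_single (θ : Label) (j : Fin M) (S : ℝ) (v : Fin M → ℝ) :
    ∑ i, v i * (if i = j then S / m.info j θ else 0) = v j * (S / m.info j θ) := by
  simp

/-- Allocation that uses a single LLM under each hypothesis. -/
lemma single_mem_feasible (J : Label → Fin M) (α : ℝ) (hS : ∀ θ, 0 ≤ m.budget α θ) :
    (fun θ i => if i = J θ then m.budget α θ / m.info (J θ) θ else 0) ∈ m.feasible α := by
  refine ⟨fun θ i => ?_, fun θ => ?_⟩
  · dsimp only
    split_ifs
    exacts [div_nonneg (hS θ) (m.info_pos _ _).le, le_rfl]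
  · rw [m.alloc_single θ (J θ) (m.budget α θ) fun i => m.info i θ,
      mul_div_cancel₀ _ (m.info_pos _ _).ne']

lemma allocCost_single (J : Label → Fin M) (α : ℝ) :
    m.allocCost (fun θ i => if i = J θ then m.budget α θ / m.info (J θ) θ else 0)
      = m.prior Label.A * m.singleCost Label.A (J Label.A) (m.budget α Label.A)
        + m.prior Label.B * m.singleCost Label.B (J Label.B) (m.budget α Label.B) := by
  simp only [allocCost, alloc_single, singleCost]
  ring

lemma allocCost_nonneg {n : Label → Fin M → ℝ} (hn : ∀ θ j, 0 ≤ n θ j) : 0 ≤ m.allocCost n := by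
  have hA := m.prior_pos Label.A
  have hB := m.prior_pos Label.B
  have hc := fun θ => Finset.sum_nonneg fun j (_ : j ∈ Finset.univ) =>
    mul_nonneg (m.cost_pos j).le (hn θ j)
  have hw := fun θ => Finset.sum_nonneg fun j (_ : j ∈ Finset.univ) =>
    mul_nonneg (m.meanWait_pos j).le (hn θ j)
  unfold allocCost
  have := m.g_nonneg (hw Label.A)
  have := m.g_nonneg (hw Label.B)
  have := hc Label.A
  have := hc Label.B
  positivity

lemma benchmark_le (J : Label → Fin M) (α : ℝ) (hS : ∀ θ, 0 ≤ m.budget α θ) :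
    m.benchmark α ≤ m.prior Label.A * m.singleCost Label.A (J Label.A) (m.budget α Label.A)
        + m.prior Label.B * m.singleCost Label.B (J Label.B) (m.budget α Label.B) := by
  rw [← allocCost_single]
  refine csInf_le ⟨0, ?_⟩ ⟨_, m.single_mem_feasible J α hS, rfl⟩
  rintro _ ⟨n, hn, rfl⟩
  exact m.allocCost_nonneg hn.1

lemma le_benchmark (J : Label → Fin M) (α : ℝ) (hS : ∀ θ, 0 < m.budget α θ)
    (hdom : ∀ θ, m.DominatesAt θ (J θ) (m.slope θ (J θ) (m.budget α θ))) :
    m.prior Label.A * m.singleCost Label.A (J Label.A) (m.budget α Label.A)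
        + m.prior Label.B * m.singleCost Label.B (J Label.B) (m.budget α Label.B)
      ≤ m.benchmark α := by
  refine le_csInf ⟨_, _, m.single_mem_feasible J α fun θ => (hS θ).le, rfl⟩ ?_
  rintro _ ⟨n, hn, rfl⟩
  have h := fun θ => mul_le_mul_of_nonneg_left
    (m.singleCost_le_alloc θ (J θ) (hS θ) (hdom θ) (n θ) (hn.1 θ) (hn.2 θ)) (m.prior_pos θ).le
  have hA := h Label.A
  have hB := h Label.B
  unfold allocCost
  linarith

/-! ### Lower bounds for the conditional risk -/

/-- Expected cost and waiting penalty under hypothesis `θ`. -/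
noncomputable def condRisk (π : Policy M) (α : ℝ) (θ : Label) : ℝ≥0∞ :=
  ∫⁻ ω, m.totalCost π α ω ∂(m.law θ) + ∫⁻ ω, m.gE (m.totalWait π α ω) ∂(m.law θ)

lemma risk_eq (π : Policy M) (α : ℝ) :
    m.risk π α = ENNReal.ofReal (m.prior Label.A) * m.condRisk π α Label.A
      + ENNReal.ofReal (m.prior Label.B) * m.condRisk π α Label.B := by
  unfold risk bayesExp condRisk
  ring

/-- Query cost until testing stops or time `N` is reached. -/
noncomputable def costTo (π : Policy M) (α : ℝ) (N : ℕ) (ω : Sample M) : ℝ :=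
  m.stoppedReward π α (fun j _ => m.cost j) N ω

/-- Waiting time until testing stops or time `N` is reached. A single waiting time is nonnegative only
almost surely; its positive part agrees with the truncation in `totalWait`. -/
noncomputable def waitTo (π : Policy M) (α : ℝ) (N : ℕ) (ω : Sample M) : ℝ :=
  m.stoppedReward π α (fun _ x => max x 0) N ω

lemma costTo_nonneg (π : Policy M) (α : ℝ) (N : ℕ) (ω : Sample M) : 0 ≤ m.costTo π α N ω :=
  m.stoppedSum_nonneg π α (f := fun j _ => m.cost j) (fun j _ => (m.cost_pos j).le) N ω

lemma waitTo_nonneg (π : Policy M) (α : ℝ) (N : ℕ) (ω : Sample M) : 0 ≤ m.waitTo π α N ω :=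
  m.stoppedSum_nonneg π α (f := fun _ z => max z.2 0) (fun _ _ => le_max_right _ _) N ω

lemma _root_.SeqTest.ofReal_integral_le {Ω : Type*} [MeasurableSpace Ω] {μ : Measure Ω} {h : Ω → ℝ}
    (hh : Integrable h μ) : ENNReal.ofReal (∫ ω, h ω ∂μ) ≤ ∫⁻ ω, ENNReal.ofReal (h ω) ∂μ := by
  have h1 : ∫ ω, h ω ∂μ ≤ ∫ ω, max (h ω) 0 ∂μ :=
    integral_mono hh hh.pos_part fun ω => le_max_left _ _
  refine (ENNReal.ofReal_le_ofReal h1).trans (le_of_eq ?_)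
  rw [ofReal_integral_eq_lintegral_ofReal hh.pos_part (ae_of_all _ fun _ => le_max_right _ _)]
  refine lintegral_congr fun ω => ?_
  rcases le_total 0 (h ω) with h0 | h0
  · rw [max_eq_left h0]
  · rw [max_eq_right h0, ENNReal.ofReal_of_nonpos h0, ENNReal.ofReal_zero]

lemma ofReal_integral_le_condRisk (π : Policy M) (α : ℝ) (θ : Label) (N : ℕ) {h : Sample M → ℝ}
    (hh : Integrable h (m.law θ))
    (hle : ∀ ω, h ω ≤ m.costTo π α N ω + m.g (m.waitTo π α N ω)) :
    ENNReal.ofReal (∫ ω, h ω ∂(m.law θ)) ≤ m.condRisk π α θ := by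
  have hmeas : Measurable fun ω => ENNReal.ofReal (m.costTo π α N ω) :=
    ENNReal.measurable_ofReal.comp
      (m.measurable_stoppedReward π α (fun j _ => m.cost j) (fun _ => measurable_const) N)
  have hρ := m.one_le_ρ
  calc ENNReal.ofReal (∫ ω, h ω ∂(m.law θ)) ≤ ∫⁻ ω, ENNReal.ofReal (h ω) ∂(m.law θ) :=
        ofReal_integral_le hh
    _ ≤ ∫⁻ ω, (ENNReal.ofReal (m.costTo π α N ω) + ENNReal.ofReal (m.g (m.waitTo π α N ω)))
          ∂(m.law θ) := lintegral_mono fun ω => by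
        rw [← ENNReal.ofReal_add (m.costTo_nonneg π α N ω)
          (m.g_nonneg (m.waitTo_nonneg π α N ω))]
        exact ENNReal.ofReal_le_ofReal (hle ω)
    _ = ∫⁻ ω, ENNReal.ofReal (m.costTo π α N ω) ∂(m.law θ)
          + ∫⁻ ω, ENNReal.ofReal (m.g (m.waitTo π α N ω)) ∂(m.law θ) :=
        lintegral_add_left hmeas _
    _ ≤ m.condRisk π α θ := by
        refine add_le_add (lintegral_mono fun ω => ?_) (lintegral_mono fun ω => ?_)
        · rw [totalCost_eq]
          exact m.ofReal_stoppedReward_le π α _ (fun j _ => (m.cost_pos j).le) N ω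
        · have h2 : ENNReal.ofReal (m.waitTo π α N ω) ≤ m.totalWait π α ω := by
            rw [totalWait_eq]
            exact m.ofReal_stoppedReward_le π α _ (fun _ _ => le_max_right _ _) N ω
          rw [g, gE, ENNReal.ofReal_mul m.gCoef_nonneg,
            ← ENNReal.ofReal_rpow_of_nonneg (m.waitTo_nonneg π α N ω) (by linarith)]
          gcongr

lemma costTo_ge (π : Policy M) (α : ℝ) {c : ℝ} (hc : ∀ j, c ≤ m.cost j) (N : ℕ)
    (ω : Sample M) : c * N * m.aliveInd π α ω N ≤ m.costTo π α N ω := by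
  by_cases h : m.Alive π α ω N
  · rw [aliveInd_of_alive _ h, mul_one, costTo, stoppedReward, stoppedSum, mul_comm]
    calc (N : ℝ) * c = ∑ _t ∈ Finset.range N, c := by simp
      _ ≤ _ := Finset.sum_le_sum fun t ht => by
        rw [aliveInd_of_alive _ (h.mono m (Finset.mem_range.1 ht).le), one_mul]
        exact hc _
  · rw [aliveInd_of_not _ h, mul_zero]
    exact m.costTo_nonneg π α N ω

/-- A policy of finite risk stops almost surely. -/
lemma tendsto_integral_aliveInd (π : Policy M) (α : ℝ) (θ : Label) (h : m.condRisk π α θ ≠ ⊤) :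
    Tendsto (fun N => ∫ ω, m.aliveInd π α ω N ∂(m.law θ)) atTop (𝓝 0) := by
  obtain ⟨c, hc, hc'⟩ := exists_pos_forall_le m.cost m.cost_pos
  have hle : ∀ N : ℕ, 0 < N → ∫ ω, m.aliveInd π α ω N ∂(m.law θ)
      ≤ (m.condRisk π α θ).toReal / c / N := by
    intro N hN
    have hN' : (0 : ℝ) < N := by exact_mod_cast hN
    have h1 := m.ofReal_integral_le_condRisk π α θ N
      (h := fun ω => c * N * m.aliveInd π α ω N)
      ((m.integrable_aliveInd θ π α N).const_mul _) fun ω => by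
        have := m.g_nonneg (m.waitTo_nonneg π α N ω)
        have := m.costTo_ge π α hc' N ω
        linarith
    have h2 := (ENNReal.ofReal_le_iff_le_toReal h).1 h1
    rw [integral_const_mul] at h2
    rw [le_div_iff₀ hN', le_div_iff₀ hc]
    linarith
  refine squeeze_zero' (Eventually.of_forall fun N => integral_nonneg fun ω =>
    m.aliveInd_nonneg π α ω N) ((eventually_gt_atTop 0).mono hle) ?_
  exact tendsto_const_nhds.div_atTop tendsto_natCast_atTop_atTop

/-- To bound the conditional risk from below, an error that vanishes together with the probability
of not having stopped by time `N` is harmless. -/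
lemma ofReal_le_condRisk_of_eventually (π : Policy M) (α : ℝ) (θ : Label) (v K : ℝ)
    (h : ∀ᶠ N in atTop, ENNReal.ofReal (v - K * ∫ ω, m.aliveInd π α ω N ∂(m.law θ))
      ≤ m.condRisk π α θ) : ENNReal.ofReal v ≤ m.condRisk π α θ := by
  by_cases htop : m.condRisk π α θ = ⊤
  · rw [htop]; exact le_top
  have h1 := ((m.tendsto_integral_aliveInd π α θ htop).const_mul K).const_sub v
  rw [mul_zero, sub_zero] at h1
  exact le_of_tendsto ((ENNReal.continuous_ofReal.tendsto _).comp h1) h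

lemma integrable_reward_snd (θ : Label) {r : Fin M → ℝ → ℝ} {μ : Fin M → ℝ}
    (hr : m.IsReward r μ) (j : Fin M) :
    Integrable (fun z : Label × ℝ => r j z.2) (m.stepLaw j θ) :=
  (hr.integrable j).comp_snd _

lemma integral_reward_snd (θ : Label) {r : Fin M → ℝ → ℝ} {μ : Fin M → ℝ}
    (hr : m.IsReward r μ) (j : Fin M) : ∫ z, r j z.2 ∂(m.stepLaw j θ) = μ j := by
  rw [stepLaw, integral_fun_snd]
  simp [hr.integral_eq]

lemma integrable_fst (θ : Label) (j : Fin M) (h : Label → ℝ) :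
    Integrable (fun z : Label × ℝ => h z.1) (m.stepLaw j θ) :=
  (m.integrable_outLaw j θ h).comp_fst _

lemma integral_fst (θ : Label) (j : Fin M) (h : Label → ℝ) :
    ∫ z, h z.1 ∂(m.stepLaw j θ) = ∫ y, h y ∂(m.outLaw j θ) := by
  rw [stepLaw, integral_fun_fst]
  simp

lemma integrable_stoppedReward (θ : Label) (π : Policy M) (α : ℝ) {r : Fin M → ℝ → ℝ}
    {μ : Fin M → ℝ} (hr : m.IsReward r μ) (N : ℕ) :
    Integrable (m.stoppedReward π α r N) (m.law θ) :=
  m.integrable_stoppedSum θ π α _ (fun j => (hr.measurable j).comp measurable_snd)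
    (m.integrable_reward_snd θ hr) N

lemma integral_stoppedReward (θ : Label) (π : Policy M) (α : ℝ) {r : Fin M → ℝ → ℝ}
    {μ : Fin M → ℝ} (hr : m.IsReward r μ) (N : ℕ) :
    ∫ ω, m.stoppedReward π α r N ω ∂(m.law θ)
      = ∫ ω, m.stoppedSum π α (fun j _ => μ j) N ω ∂(m.law θ) := by
  have := m.integral_stoppedSum θ π α (fun j z => r j z.2)
    (fun j => (hr.measurable j).comp measurable_snd) (m.integrable_reward_snd θ hr) N
  simp only [m.integral_reward_snd θ hr] at this
  exact this

lemma integrable_stoppedSum_const (θ : Label) (π : Policy M) (α : ℝ) (v : Fin M → ℝ) (N : ℕ) :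
    Integrable (m.stoppedSum π α (fun j _ => v j) N) (m.law θ) :=
  m.integrable_stoppedSum θ π α _ (fun _ => measurable_const) (fun _ => integrable_const _) N

lemma integrable_stoppedEvid (θ : Label) (π : Policy M) (α : ℝ) (N : ℕ) :
    Integrable (m.stoppedEvid π α θ N) (m.law θ) :=
  m.integrable_stoppedSum θ π α _ (m.measurable_step θ)
    (fun j => m.integrable_fst θ j (m.step θ j)) N

lemma integral_stoppedEvid (θ : Label) (π : Policy M) (α : ℝ) (N : ℕ) :
    ∫ ω, m.stoppedEvid π α θ N ω ∂(m.law θ)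
      = ∫ ω, m.stoppedSum π α (fun j _ => m.info j θ) N ω ∂(m.law θ) := by
  have := m.integral_stoppedSum θ π α (fun j z => m.step θ j z.1) (m.measurable_step θ)
    (fun j => m.integrable_fst θ j (m.step θ j)) N
  simp only [m.integral_fst θ _ (m.step θ _), m.integral_step] at this
  exact this

open Classical in
/-- Counts the two ways in which the stopped evidence can fall short of the threshold: accepting the
wrong hypothesis, or not having stopped by time `N`. -/
noncomputable def failInd (π : Policy M) (α : ℝ) (θ : Label) (N : ℕ) (ω : Sample M) : ℝ :=
  {ω | m.stoppedEvid π α θ N ω ≤ -m.thr α θ.other}.indicator 1 ω + m.aliveInd π α ω N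

lemma failInd_nonneg (π : Policy M) (α : ℝ) (θ : Label) (N : ℕ) (ω : Sample M) :
    0 ≤ m.failInd π α θ N ω :=
  add_nonneg (Set.indicator_nonneg (fun _ _ => zero_le_one) _) (m.aliveInd_nonneg _ _ _ _)

lemma measurableSet_error (π : Policy M) (α : ℝ) (θ : Label) (N : ℕ) :
    MeasurableSet {ω | m.stoppedEvid π α θ N ω ≤ -m.thr α θ.other} :=
  measurableSet_le (m.measurable_stoppedSum π α _ (m.measurable_step θ) N) measurable_const

lemma integrable_failInd (π : Policy M) (α : ℝ) (θ : Label) (N : ℕ) :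
    Integrable (m.failInd π α θ N) (m.law θ) :=
  ((integrable_const (1 : ℝ)).indicator (m.measurableSet_error π α θ N)).add
    (m.integrable_aliveInd θ π α N)

lemma integral_failInd_le (π : Policy M) (α : ℝ) (θ : Label) (N : ℕ) :
    ∫ ω, m.failInd π α θ N ω ∂(m.law θ)
      ≤ Real.exp (-m.thr α θ.other) + ∫ ω, m.aliveInd π α ω N ∂(m.law θ) := by
  have hi : Integrable (fun ω => {ω | m.stoppedEvid π α θ N ω ≤ -m.thr α θ.other}.indicator
      (1 : Sample M → ℝ) ω) (m.law θ) :=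
    (integrable_const (1 : ℝ)).indicator (m.measurableSet_error π α θ N)
  unfold failInd
  rw [integral_add hi (m.integrable_aliveInd θ π α N),
    integral_indicator_one (m.measurableSet_error π α θ N)]
  gcongr
  exact m.measure_error_le π α θ N _

/-- Width of the continuation region plus one step. -/
noncomputable def width (α : ℝ) : ℝ := m.upper α + m.lower α + m.llrBound

lemma width_eq (α : ℝ) (θ : Label) :
    m.width α = m.thr α θ + m.thr α θ.other + m.llrBound := by
  cases θ
  · rfl
  · simp only [width, thr, Label.other]; ring

lemma le_min_stoppedEvid (π : Policy M) (α : ℝ) (θ : Label) (hθ : 0 < m.thr α θ)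
    (hθ' : 0 < m.thr α θ.other) (N : ℕ) (ω : Sample M) :
    m.thr α θ - m.width α * m.failInd π α θ N ω ≤ min (m.stoppedEvid π α θ N ω) (m.thr α θ) := by
  have hC := m.llrBound_nonneg
  have hw := m.width_eq α θ
  have hb := m.stoppedEvid_bounds π α θ hθ hθ' N ω
  have hf := m.failInd_nonneg π α θ N ω
  have hw0 : 0 ≤ m.width α := by linarith
  refine le_min ?_ (by nlinarith)
  by_cases h1 : 1 ≤ m.failInd π α θ N ω
  · nlinarith
  · have h2 : ¬m.Alive π α ω N := fun h => h1 (by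
      rw [failInd, aliveInd_of_alive _ h]
      linarith [Set.indicator_nonneg (s := {ω | m.stoppedEvid π α θ N ω ≤ -m.thr α θ.other})
        (f := (1 : Sample M → ℝ)) (fun _ _ => zero_le_one) ω])
    have h3 : ¬m.stoppedEvid π α θ N ω ≤ -m.thr α θ.other := fun h => h1 (by
      rw [failInd, Set.indicator_of_mem (by exact h), Pi.one_apply]
      linarith [m.aliveInd_nonneg π α ω N])
    rcases m.stoppedEvid_of_not_alive π α θ N ω h2 with h | h
    · nlinarith
    · exact absurd h h3

lemma exp_neg_thr_le {α : ℝ} (h0 : 0 < α) (h1 : α ≤ 1 / 2) (θ : Label) :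
    Real.exp (-m.thr α θ) ≤ m.errConst * α := by
  have hA := m.prior_pos Label.A
  have hB := m.prior_pos Label.B
  have h2 : 0 < (1 - α) / α := div_pos (by linarith) h0
  have h3 : ((1 - α) / α)⁻¹ ≤ 2 * α := by
    rw [inv_div, div_le_iff₀ (by linarith)]
    nlinarith
  have h4 : ((1 - α) / α)⁻¹ ≥ 0 := by positivity
  have hr : 0 < m.prior Label.A / m.prior Label.B := div_pos hA hB
  cases θ
  · have : Real.exp (-m.thr α Label.A)
        = ((1 - α) / α)⁻¹ * (m.prior Label.A / m.prior Label.B) := by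
      rw [thr, upper, logOdds, neg_sub, sub_eq_add_neg, Real.exp_add, Real.exp_log hr,
        Real.exp_neg, Real.exp_log h2, mul_comm]
    rw [this, errConst]
    nlinarith [mul_le_mul h3 (le_max_left (m.prior Label.A / m.prior Label.B)
      (m.prior Label.B / m.prior Label.A)) hr.le (by linarith)]
  · have : Real.exp (-m.thr α Label.B)
        = ((1 - α) / α)⁻¹ * (m.prior Label.B / m.prior Label.A) := by
      rw [thr, lower, logOdds, neg_add, Real.exp_add, Real.exp_neg, Real.exp_neg,
        Real.exp_log hr, Real.exp_log h2, inv_div (m.prior Label.A)]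
    rw [this, errConst]
    nlinarith [mul_le_mul h3 (le_max_right (m.prior Label.A / m.prior Label.B)
      (m.prior Label.B / m.prior Label.A)) (div_pos hB hA).le (by linarith)]

/-- The expected shortfall of the evidence is covered by the slack in the budgets. -/
lemma budget_le_integral (π : Policy M) {α : ℝ} (h0 : 0 < α) (h1 : α ≤ 1 / 2) (θ : Label)
    (hθ : 0 < m.thr α θ) (hθ' : 0 < m.thr α θ.other) (N : ℕ) :
    m.budget α θ - m.width α * ∫ ω, m.aliveInd π α ω N ∂(m.law θ)
      ≤ m.thr α θ - m.width α * ∫ ω, m.failInd π α θ N ω ∂(m.law θ) := by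
  have hw0 : 0 ≤ m.width α := by linarith [m.width_eq α θ, m.llrBound_nonneg]
  have h2 := m.integral_failInd_le π α θ N
  have h3 := m.exp_neg_thr_le h0 h1 θ.other
  rw [budget_eq]
  have : m.slack α = m.errConst * α * m.width α := rfl
  rw [this]
  nlinarith

/-- Linearizing the penalty at `b` turns the conditional risk into a sum of per-query charges. -/
lemma ofReal_linearized_le_condRisk (π : Policy M) (α : ℝ) (θ : Label) {b y : ℝ} (hb : 0 < b)
    (hyb : y = m.gCoef * m.ρ * b ^ (m.ρ - 1)) (N : ℕ) :
    ENNReal.ofReal (m.g b - y * b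
      + ∫ ω, m.stoppedSum π α (fun i _ => m.cost i + y * m.meanWait i) N ω ∂(m.law θ))
      ≤ m.condRisk π α θ := by
  have hci : Integrable (fun ω => m.costTo π α N ω) (m.law θ) :=
    m.integrable_stoppedReward θ π α m.isReward_cost N
  have hwi : Integrable (fun ω => y * m.waitTo π α N ω) (m.law θ) :=
    (m.integrable_stoppedReward θ π α m.isReward_wait N).const_mul y
  have hcwi : Integrable (fun ω => m.costTo π α N ω + y * m.waitTo π α N ω) (m.law θ) :=
    hci.add hwi
  have hint : Integrable (fun ω => (m.g b - y * b)
      + (m.costTo π α N ω + y * m.waitTo π α N ω)) (m.law θ) := (integrable_const _).add hcwi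
  refine le_trans (ENNReal.ofReal_le_ofReal (le_of_eq ?_))
    (m.ofReal_integral_le_condRisk π α θ N hint fun ω => ?_)
  · rw [integral_add (integrable_const _) hcwi, integral_add hci hwi, integral_const_mul]
    simp only [costTo, waitTo]
    rw [m.integral_stoppedReward θ π α m.isReward_cost,
      m.integral_stoppedReward θ π α m.isReward_wait, ← integral_const_mul,
      ← integral_add (m.integrable_stoppedSum_const θ π α _ N)
        ((m.integrable_stoppedSum_const θ π α _ N).const_mul y)]
    simp only [stoppedSum_add _ _ _ (fun i _ => m.cost i) (fun i _ => y * m.meanWait i),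
      stoppedSum_const_mul _ _ _ _ (fun i _ => m.meanWait i)]
    simp
  · have := m.g_tangent_le hb (m.waitTo_nonneg π α N ω)
    rw [← hyb] at this
    linarith

lemma thr_sub_le_integral_min (π : Policy M) (α : ℝ) (θ : Label) (hθ : 0 < m.thr α θ)
    (hθ' : 0 < m.thr α θ.other) (N : ℕ) :
    m.thr α θ - m.width α * ∫ ω, m.failInd π α θ N ω ∂(m.law θ)
      ≤ ∫ ω, min (m.stoppedEvid π α θ N ω) (m.thr α θ) ∂(m.law θ) := by
  rw [← integral_const_mul]
  have hi : Integrable (fun ω => m.thr α θ - m.width α * m.failInd π α θ N ω) (m.law θ) :=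
    (integrable_const _).sub ((m.integrable_failInd π α θ N).const_mul (m.width α))
  have := integral_mono hi ((m.integrable_stoppedEvid θ π α N).inf (integrable_const (m.thr α θ)))
    fun ω => m.le_min_stoppedEvid π α θ hθ hθ' N ω
  rwa [integral_sub (integrable_const _) ((m.integrable_failInd π α θ N).const_mul _),
    integral_const, probReal_univ, one_smul] at this

/-- Jensen's inequality and Wald's identity: no policy beats the cost of the dominant LLM. -/
lemma singleCost_le_condRisk (π : Policy M) {α : ℝ} (h0 : 0 < α) (h1 : α ≤ 1 / 2) (θ : Label)
    (hθ' : 0 < m.thr α θ.other) (hθ : 0 < m.thr α θ) (j : Fin M) (hS : 0 < m.budget α θ)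
    (hdom : m.DominatesAt θ j (m.slope θ j (m.budget α θ))) :
    ENNReal.ofReal (m.singleCost θ j (m.budget α θ)) ≤ m.condRisk π α θ := by
  set S := m.budget α θ with hSdef
  have hI := m.info_pos j θ
  have hb : 0 < m.meanWait j * (S / m.info j θ) := mul_pos (m.meanWait_pos j) (div_pos hS hI)
  set y := m.slope θ j S with hydef
  have hy : 0 ≤ y := m.slope_nonneg θ j hS.le
  set q := (m.cost j + y * m.meanWait j) / m.info j θ with hq
  have hq0 : 0 ≤ q := by
    have := m.cost_pos j
    have := m.meanWait_pos j
    positivity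
  refine m.ofReal_le_condRisk_of_eventually π α θ _ (q * m.width α)
    (Eventually.of_forall fun N => ?_)
  refine le_trans (ENNReal.ofReal_le_ofReal ?_)
    (m.ofReal_linearized_le_condRisk π α θ hb (y := y) rfl N)
  have e2 : q * ∫ ω, m.stoppedEvid π α θ N ω ∂(m.law θ)
      ≤ ∫ ω, m.stoppedSum π α (fun i _ => m.cost i + y * m.meanWait i) N ω ∂(m.law θ) := by
    rw [integral_stoppedEvid, ← integral_const_mul]
    refine integral_mono ((m.integrable_stoppedSum_const θ π α _ N).const_mul q)
      (m.integrable_stoppedSum_const θ π α _ N) fun ω => ?_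
    dsimp only
    rw [← stoppedSum_const_mul]
    refine m.stoppedSum_le π α (fun i _ => ?_) N ω
    rw [hq, div_mul_eq_mul_div, div_le_iff₀ hI]
    exact hdom i
  have e3 : ∫ ω, min (m.stoppedEvid π α θ N ω) (m.thr α θ) ∂(m.law θ)
      ≤ ∫ ω, m.stoppedEvid π α θ N ω ∂(m.law θ) :=
    integral_mono ((m.integrable_stoppedEvid θ π α N).inf (integrable_const _))
      (m.integrable_stoppedEvid θ π α N) fun ω => min_le_left _ _
  have e4 := m.budget_le_integral π h0 h1 θ hθ hθ' N
  have e5 := mul_le_mul_of_nonneg_left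
    (e4.trans ((m.thr_sub_le_integral_min π α θ hθ hθ' N).trans e3)) hq0
  rw [singleCost_eq]
  rw [← hSdef] at e5
  linarith

/-! ### Small error levels -/

lemma tendsto_log_one_div : Tendsto (fun α : ℝ => Real.log (1 / α)) (𝓝[>] 0) atTop := by
  have h : (fun α : ℝ => Real.log (1 / α)) = fun α => -Real.log α := by
    funext α; rw [one_div, Real.log_inv]
  rw [h]
  exact tendsto_neg_atBot_atTop.comp Real.tendsto_log_nhdsGT_zero

/-- The thresholds are within a bounded distance of `log (1 / α)`. -/
lemma exists_abs_thr_sub_le : ∃ c, 0 < c ∧ ∀ α, 0 < α → α ≤ 1 / 2 → ∀ θ,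
    |m.thr α θ - Real.log (1 / α)| ≤ c := by
  refine ⟨Real.log 2 + |m.logOdds|, by positivity, fun α h0 h1 θ => ?_⟩
  have h2 : Real.log ((1 - α) / α) = Real.log (1 - α) + Real.log (1 / α) := by
    rw [div_eq_mul_one_div, Real.log_mul (by linarith) (by positivity)]
  have h3 : Real.log (1 - α) ≤ 0 := Real.log_nonpos (by linarith) (by linarith)
  have h4 : -Real.log 2 ≤ Real.log (1 - α) := by
    rw [← Real.log_inv]
    exact Real.log_le_log (by norm_num) (by linarith)
  have h5 := abs_le.1 (le_refl |m.logOdds|)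
  cases θ
  · simp only [thr, upper, h2]
    rw [abs_le]; constructor <;> linarith
  · simp only [thr, lower, h2]
    rw [abs_le]; constructor <;> linarith

lemma errConst_pos : 0 < m.errConst := by
  have := div_pos (m.prior_pos Label.A) (m.prior_pos Label.B)
  have := lt_max_of_lt_left (c := m.prior Label.B / m.prior Label.A) this
  unfold errConst
  linarith

lemma tendsto_slack : Tendsto m.slack (𝓝[>] 0) (𝓝 0) := by
  obtain ⟨c, hc, hc'⟩ := m.exists_abs_thr_sub_le
  have h1 : Tendsto (fun α : ℝ => α * Real.log (1 / α)) (𝓝[>] 0) (𝓝 0) := by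
    have h := (tendsto_log_mul_rpow_nhdsGT_zero one_pos).neg
    rw [neg_zero] at h
    refine h.congr fun α => ?_
    rw [one_div, Real.log_inv, Real.rpow_one]
    ring
  have h2 : Tendsto (fun α : ℝ => α) (𝓝[>] 0) (𝓝 0) :=
    (continuous_id.tendsto 0).mono_left nhdsWithin_le_nhds
  have hup : Tendsto (fun α : ℝ => m.errConst * (2 * (α * Real.log (1 / α))
      + α * (2 * c + m.llrBound))) (𝓝[>] 0) (𝓝 0) := by
    have := ((h1.const_mul 2).add (h2.mul_const (2 * c + m.llrBound))).const_mul m.errConst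
    simpa using this
  have hE := m.errConst_pos
  have hα : ∀ᶠ α : ℝ in 𝓝[>] 0, 0 < α ∧ α ≤ 1 / 2 ∧ c ≤ Real.log (1 / α) := by
    filter_upwards [Ioc_mem_nhdsGT (show (0 : ℝ) < 1 / 2 by norm_num),
      tendsto_log_one_div.eventually_ge_atTop c] with α h3 h4 using ⟨h3.1, h3.2, h4⟩
  refine tendsto_of_tendsto_of_tendsto_of_le_of_le' tendsto_const_nhds hup ?_ ?_
  · filter_upwards [hα] with α ⟨h3, h4, h5⟩
    have hA := abs_le.1 (hc' α h3 h4 Label.A)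
    have hB := abs_le.1 (hc' α h3 h4 Label.B)
    have hC := m.llrBound_nonneg
    have : 0 ≤ m.upper α + m.lower α + m.llrBound := by
      simp only [thr] at hA hB
      linarith
    unfold slack
    positivity
  · filter_upwards [hα] with α ⟨h3, h4, h5⟩
    have hA := abs_le.1 (hc' α h3 h4 Label.A)
    have hB := abs_le.1 (hc' α h3 h4 Label.B)
    simp only [thr] at hA hB
    have h6 : m.upper α + m.lower α + m.llrBound
        ≤ 2 * Real.log (1 / α) + (2 * c + m.llrBound) := by linarith
    have h7 := mul_le_mul_of_nonneg_left h6 (mul_pos hE h3).le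
    unfold slack
    linarith

/-- For small `α` the thresholds and budgets are large, close to each other, and comparable to
`log (1 / α)`. -/
lemma eventually_thresholds (R ε : ℝ) (hε : 0 < ε) : ∀ᶠ α in 𝓝[>] (0 : ℝ),
    0 < α ∧ α ≤ 1 / 2 ∧ R ≤ Real.log (1 / α) ∧ m.slack α ≤ ε ∧
      ∀ θ, R ≤ m.budget α θ ∧ m.budget α θ ≤ m.thr α θ ∧ m.thr α θ ≤ m.budget α θ + 1 ∧
        Real.log (1 / α) / 2 ≤ m.budget α θ ∧ m.thr α θ ≤ 2 * Real.log (1 / α) := by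
  obtain ⟨c, hc, hc'⟩ := m.exists_abs_thr_sub_le
  have hC := m.llrBound_nonneg
  filter_upwards [Ioc_mem_nhdsGT (show (0 : ℝ) < 1 / 2 by norm_num),
    tendsto_log_one_div.eventually_ge_atTop (2 * (c + 1)),
    tendsto_log_one_div.eventually_ge_atTop (R + c + 1),
    m.tendsto_slack.eventually_lt_const (show (0 : ℝ) < min ε 1 by positivity)] with α h1 h2 h3 h4
  have h5 : 0 ≤ m.slack α := by
    have hA := abs_le.1 (hc' α h1.1 h1.2 Label.A)
    have hB := abs_le.1 (hc' α h1.1 h1.2 Label.B)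
    simp only [thr] at hA hB
    have := m.errConst_pos
    have := h1.1
    have : 0 ≤ m.upper α + m.lower α + m.llrBound := by linarith
    unfold slack
    positivity
  have h6 := lt_min_iff.1 h4
  refine ⟨h1.1, h1.2, by linarith, h6.1.le, fun θ => ?_⟩
  have h7 := abs_le.1 (hc' α h1.1 h1.2 θ)
  rw [budget_eq]
  refine ⟨?_, ?_, ?_, ?_, ?_⟩ <;> linarith

/-! ### The two-LLM policy -/

lemma twoLLM_chosen (J : Label → Fin M) (θ : Label) (ω : Sample M) (t : ℕ)
    (h : 0 < m.evid (m.twoLLM (J Label.A) (J Label.B)) θ ω t) :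
    (m.twoLLM (J Label.A) (J Label.B)).chosen ω t = J θ := by
  have hch : (m.twoLLM (J Label.A) (J Label.B)).chosen ω t
      = if 0 ≤ m.cumLLR (m.twoLLM (J Label.A) (J Label.B)) ω t then J Label.A else J Label.B := rfl
  rw [hch]
  cases θ
  · simp only [evid, Label.sign, one_mul] at h
    rw [if_pos h.le]
  · simp only [evid, Label.sign] at h
    rw [if_neg (by linarith)]

/-- Upper bound for the conditional risk of a policy that queries `j` as long as the evidence
favours the true hypothesis `θ`. -/
lemma exists_condRisk_le (θ : Label) (j : Fin M) :
    ∃ K S₀ : ℝ, 0 ≤ K ∧ ∀ (α : ℝ) (π : Policy M),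
      (∀ ω t, 0 < m.evid π θ ω t → π.chosen ω t = j) →
      0 < m.thr α θ → 0 < m.thr α θ.other → m.thr α θ ≤ m.budget α θ + 1 →
      S₀ ≤ m.budget α θ →
      m.condRisk π α θ ≤ ENNReal.ofReal (m.singleCost θ j (m.budget α θ)
        + K * m.budget α θ ^ (m.ρ - 1)) := by
  obtain ⟨K₁, S₁, hK₁, h₁⟩ := m.exists_lintegral_totalReward_rpow_le θ j m.isReward_cost le_rfl
  obtain ⟨K₂, S₂, hK₂, h₂⟩ := m.exists_lintegral_totalReward_rpow_le θ j m.isReward_wait m.one_le_ρ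
  have hg := m.gCoef_nonneg
  refine ⟨K₁ + m.gCoef * K₂, max 1 (max S₁ S₂), by positivity, ?_⟩
  intro α π hπ hθ hθ' hthr hS
  set S := m.budget α θ
  have hS1 : 1 ≤ S := le_trans (by simp) hS
  have hC := h₁ S (le_trans (by simp) hS) α π hπ hθ hθ' hthr
  have hW := h₂ S (le_trans (by simp) hS) α π hπ hθ hθ' hthr
  simp only [ENNReal.rpow_one, Real.rpow_one, sub_self, Real.rpow_zero, mul_one,
    ← totalCost_eq] at hC
  simp only [← totalWait_eq] at hW
  have hI := m.info_pos j θ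
  have hc := m.cost_pos j
  have hμ := m.meanWait_pos j
  have hS0 : 0 < S := by linarith
  calc m.condRisk π α θ
      ≤ ENNReal.ofReal (m.cost j * (S / m.info j θ) + K₁)
        + ENNReal.ofReal m.gCoef * ENNReal.ofReal
          ((m.meanWait j * (S / m.info j θ)) ^ m.ρ + K₂ * S ^ (m.ρ - 1)) := by
        unfold condRisk gE
        rw [lintegral_const_mul' _ _ ENNReal.ofReal_ne_top]
        gcongr
    _ = ENNReal.ofReal (m.cost j * (S / m.info j θ) + K₁ + m.gCoef *
          ((m.meanWait j * (S / m.info j θ)) ^ m.ρ + K₂ * S ^ (m.ρ - 1))) := by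
        rw [← ENNReal.ofReal_mul hg, ← ENNReal.ofReal_add (by positivity) (by positivity)]
    _ ≤ _ := by
        apply ENNReal.ofReal_le_ofReal
        have h3 : 1 ≤ S ^ (m.ρ - 1) := Real.one_le_rpow hS1 (by linarith [m.one_le_ρ])
        unfold singleCost g
        nlinarith

/-- Combining bounds for the two conditional risks. -/
lemma le_risk (π : Policy M) (α : ℝ) (v : Label → ℝ) (hv : ∀ θ, 0 ≤ v θ)
    (h : ∀ θ, ENNReal.ofReal (v θ) ≤ m.condRisk π α θ) :
    ENNReal.ofReal (m.prior Label.A * v Label.A + m.prior Label.B * v Label.B) ≤ m.risk π α := by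
  have hA := m.prior_pos Label.A
  have hB := m.prior_pos Label.B
  rw [risk_eq, ENNReal.ofReal_add (mul_nonneg hA.le (hv _)) (mul_nonneg hB.le (hv _)),
    ENNReal.ofReal_mul hA.le, ENNReal.ofReal_mul hB.le]
  gcongr <;> exact h _

lemma risk_le (π : Policy M) (α : ℝ) (v : Label → ℝ) (hv : ∀ θ, 0 ≤ v θ)
    (h : ∀ θ, m.condRisk π α θ ≤ ENNReal.ofReal (v θ)) :
    m.risk π α ≤ ENNReal.ofReal (m.prior Label.A * v Label.A + m.prior Label.B * v Label.B) := by
  have hA := m.prior_pos Label.A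
  have hB := m.prior_pos Label.B
  rw [risk_eq, ENNReal.ofReal_add (mul_nonneg hA.le (hv _)) (mul_nonneg hB.le (hv _)),
    ENNReal.ofReal_mul hA.le, ENNReal.ofReal_mul hB.le]
  gcongr <;> exact h _

/-- The policy that uses a dominant LLM for each hypothesis attains the benchmark up to
`O ((log (1 / α)) ^ (ρ - 1))`. -/
lemma twoLLM_isBigO (J : Label → Fin M) (hJ : ∀ θ, m.Dominant θ (J θ)) :
    (∀ᶠ α in 𝓝[>] (0 : ℝ), m.risk (m.twoLLM (J Label.A) (J Label.B)) α ≠ ⊤) ∧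
      (fun α : ℝ => (m.risk (m.twoLLM (J Label.A) (J Label.B)) α).toReal - m.benchmark α)
        =O[𝓝[>] (0 : ℝ)] (fun α : ℝ => Real.log (1 / α) ^ (m.ρ - 1)) := by
  choose K S₀ hK hup using fun θ => m.exists_condRisk_le θ (J θ)
  choose S₁ hdom using fun θ => eventually_atTop.1 (hJ θ)
  have hA := m.prior_pos Label.A
  have hB := m.prior_pos Label.B
  set R := max 1 (max (max (S₀ Label.A) (S₀ Label.B)) (max (S₁ Label.A) (S₁ Label.B))) with hR
  have hR1 : 1 ≤ R := le_max_left _ _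
  have hR0 : ∀ θ, S₀ θ ≤ R := fun θ => by cases θ <;> simp [hR]
  have hR2 : ∀ θ, S₁ θ ≤ R := fun θ => by cases θ <;> simp [hR]
  set K' := m.prior Label.A * K Label.A + m.prior Label.B * K Label.B with hK'
  have hK'0 : 0 ≤ K' := add_nonneg (mul_nonneg hA.le (hK _)) (mul_nonneg hB.le (hK _))
  have main : ∀ᶠ α in 𝓝[>] (0 : ℝ), 0 < Real.log (1 / α) ∧
      ENNReal.ofReal (m.benchmark α) ≤ m.risk (m.twoLLM (J Label.A) (J Label.B)) α ∧
      0 ≤ m.benchmark α ∧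
      m.risk (m.twoLLM (J Label.A) (J Label.B)) α ≤ ENNReal.ofReal (m.benchmark α
        + K' * 2 ^ (m.ρ - 1) * Real.log (1 / α) ^ (m.ρ - 1)) := by
    filter_upwards [m.eventually_thresholds R 1 one_pos] with α ⟨h0, h1, h2, _, h3⟩
    have hΛ : 0 < Real.log (1 / α) := by linarith
    have hS0 : ∀ θ, 0 < m.budget α θ := fun θ => by linarith [(h3 θ).1]
    have ht0 : ∀ θ, 0 < m.thr α θ := fun θ => by linarith [hS0 θ, (h3 θ).2.1]
    have hd : ∀ θ, m.DominatesAt θ (J θ) (m.slope θ (J θ) (m.budget α θ)) := fun θ =>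
      hdom θ _ ((hR2 θ).trans (h3 θ).1)
    have hge := m.le_benchmark J α hS0 hd
    have hle := m.benchmark_le J α fun θ => (hS0 θ).le
    have hsc : ∀ θ, 0 ≤ m.singleCost θ (J θ) (m.budget α θ) := fun θ =>
      m.singleCost_nonneg θ (J θ) (hS0 θ).le
    have hbn : 0 ≤ m.benchmark α := le_trans
      (add_nonneg (mul_nonneg hA.le (hsc _)) (mul_nonneg hB.le (hsc _))) hge
    refine ⟨hΛ, ?_, hbn, ?_⟩
    · exact (ENNReal.ofReal_le_ofReal hle).trans (m.le_risk _ α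
        (fun θ => m.singleCost θ (J θ) (m.budget α θ)) hsc fun θ =>
          m.singleCost_le_condRisk _ h0 h1 θ (ht0 _) (ht0 _) (J θ) (hS0 θ) (hd θ))
    · have hpow : ∀ θ, m.budget α θ ^ (m.ρ - 1)
          ≤ 2 ^ (m.ρ - 1) * Real.log (1 / α) ^ (m.ρ - 1) := fun θ => by
        rw [← Real.mul_rpow zero_le_two hΛ.le]
        exact Real.rpow_le_rpow (hS0 θ).le ((h3 θ).2.1.trans (h3 θ).2.2.2.2)
          (by linarith [m.one_le_ρ])
      refine (m.risk_le _ α (fun θ => m.singleCost θ (J θ) (m.budget α θ)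
        + K θ * m.budget α θ ^ (m.ρ - 1)) (fun θ => add_nonneg (hsc θ)
          (mul_nonneg (hK θ) (Real.rpow_nonneg (hS0 θ).le _))) fun θ =>
        hup θ α _ (m.twoLLM_chosen J θ) (ht0 _) (ht0 _) (h3 θ).2.2.1
          ((hR0 θ).trans (h3 θ).1)).trans (ENNReal.ofReal_le_ofReal ?_)
      have hpA := mul_le_mul_of_nonneg_left (hpow Label.A) (mul_nonneg hA.le (hK Label.A))
      have hpB := mul_le_mul_of_nonneg_left (hpow Label.B) (mul_nonneg hB.le (hK Label.B))
      rw [hK']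
      linarith
  constructor
  · filter_upwards [main] with α ⟨_, _, _, h⟩
    exact ne_top_of_le_ne_top ENNReal.ofReal_ne_top h
  · refine Asymptotics.IsBigO.of_bound (K' * 2 ^ (m.ρ - 1)) ?_
    filter_upwards [main] with α ⟨hΛ, h1, h2, h3⟩
    have htop := ne_top_of_le_ne_top ENNReal.ofReal_ne_top h3
    have hpos : 0 ≤ K' * 2 ^ (m.ρ - 1) * Real.log (1 / α) ^ (m.ρ - 1) := by positivity
    have h4 := (ENNReal.ofReal_le_iff_le_toReal htop).1 h1
    have h5 := ENNReal.toReal_le_of_le_ofReal (by linarith) h3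
    rw [Real.norm_eq_abs, Real.norm_eq_abs, abs_of_nonneg (by linarith),
      abs_of_nonneg (Real.rpow_nonneg hΛ.le _)]
    linarith

/-! ### Superlinear penalty: the gain from the fluctuations of the waiting time -/

lemma abs_stoppedSum_le (π : Policy M) (α : ℝ) {f : Fin M → Label × ℝ → ℝ} {B : ℝ}
    (hf : ∀ j z, |f j z| ≤ B) (N : ℕ) (ω : Sample M) : |m.stoppedSum π α f N ω| ≤ N * B := by
  unfold stoppedSum
  refine (Finset.abs_sum_le_sum_abs _ _).trans ?_
  calc _ ≤ ∑ _t ∈ Finset.range N, B := Finset.sum_le_sum fun t _ => by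
        rw [abs_mul, abs_of_nonneg (m.aliveInd_nonneg _ _ _ _)]
        nlinarith [m.aliveInd_nonneg π α ω t, m.aliveInd_le_one π α ω t,
          hf (π.chosen ω t) (ω t (π.chosen ω t)),
          abs_nonneg (f (π.chosen ω t) (ω t (π.chosen ω t)))]
    _ = N * B := by simp

lemma aliveInd_mul_self (π : Policy M) (α : ℝ) (ω : Sample M) (t : ℕ) :
    m.aliveInd π α ω t * m.aliveInd π α ω t = m.aliveInd π α ω t := by
  unfold aliveInd; split_ifs <;> simp

/-- Covariance of two stopped sums of centred terms: increments at different times are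
orthogonal. -/
lemma integral_stoppedSum_mul_stoppedSum (θ : Label) (π : Policy M) (α : ℝ)
    {f h : Fin M → Label × ℝ → ℝ} {B : ℝ} (hfm : ∀ j, Measurable (f j)) (hfB : ∀ j z, |f j z| ≤ B)
    (hhm : ∀ j, Measurable (h j)) (hhi : ∀ j, Integrable (h j) (m.stepLaw j θ))
    (hf0 : ∀ j, ∫ z, f j z ∂(m.stepLaw j θ) = 0) (hh0 : ∀ j, ∫ z, h j z ∂(m.stepLaw j θ) = 0)
    {n N : ℕ} (hnN : n ≤ N) :
    Integrable (fun ω => m.stoppedSum π α f n ω * m.stoppedSum π α h N ω) (m.law θ) ∧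
    ∫ ω, m.stoppedSum π α f n ω * m.stoppedSum π α h N ω ∂(m.law θ)
      = ∫ ω, m.stoppedSum π α (fun j _ => ∫ z, f j z * h j z ∂(m.stepLaw j θ)) n ω ∂(m.law θ) := by
  have hfi : ∀ j, Integrable (f j) (m.stepLaw j θ) := fun j =>
    Integrable.of_bound (hfm j).aestronglyMeasurable B (ae_of_all _ (hfB j))
  have hfhi : ∀ j, Integrable (fun z => f j z * h j z) (m.stepLaw j θ) := fun j =>
    (hhi j).bdd_mul (hfm j).aestronglyMeasurable (ae_of_all _ (hfB j))
  have hfpm := m.measurable_past_stoppedSum π α f hfm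
  have hhpm := m.measurable_past_stoppedSum π α h hhm
  have hfint := m.integrable_stoppedSum θ π α f hfm hfi
  have hhint := m.integrable_stoppedSum θ π α h hhm hhi
  have cross1 : ∀ n N, n ≤ N → Integrable (fun ω => m.stoppedSum π α f n ω *
      (m.aliveInd π α ω N * h (π.chosen ω N) (ω N (π.chosen ω N)))) (m.law θ) ∧
      ∫ ω, m.stoppedSum π α f n ω *
      (m.aliveInd π α ω N * h (π.chosen ω N) (ω N (π.chosen ω N))) ∂(m.law θ) = 0 := by
    intro n N hn
    have hG : Integrable (fun ω => m.stoppedSum π α f n ω * m.aliveInd π α ω N) (m.law θ) :=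
      (m.integrable_aliveInd θ π α N).bdd_mul (hfint n).aestronglyMeasurable
        (ae_of_all _ fun ω => m.abs_stoppedSum_le π α hfB n ω)
    have := m.integrable_step_mul θ π N _
      (((hfpm n).mono (past_mono hn) le_rfl).mul (m.measurable_past_aliveInd π α N)) hG h hhm hhi
    simp only [hh0, mul_zero, integral_zero, Pi.mul_apply, mul_assoc] at this
    exact this
  have cross2 : ∀ n, Integrable (fun ω => (m.aliveInd π α ω n
      * f (π.chosen ω n) (ω n (π.chosen ω n))) * m.stoppedSum π α h n ω) (m.law θ) ∧
      ∫ ω, (m.aliveInd π α ω n * f (π.chosen ω n) (ω n (π.chosen ω n)))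
        * m.stoppedSum π α h n ω ∂(m.law θ) = 0 := by
    intro n
    have hG : Integrable (fun ω => m.aliveInd π α ω n * m.stoppedSum π α h n ω) (m.law θ) := by
      refine (hhint n).bdd_mul (c := 1) (m.integrable_aliveInd θ π α n).aestronglyMeasurable
        (ae_of_all _ fun ω => ?_)
      rw [Real.norm_eq_abs, abs_of_nonneg (m.aliveInd_nonneg _ _ _ _)]
      exact m.aliveInd_le_one _ _ _ _
    have := m.integrable_step_mul θ π n _
      ((m.measurable_past_aliveInd π α n).mul (hhpm n)) hG f hfm hfi
    simp only [hf0, mul_zero, integral_zero, Pi.mul_apply] at this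
    simpa only [mul_right_comm] using this
  have diag : ∀ n, Integrable (fun ω => (m.aliveInd π α ω n
      * f (π.chosen ω n) (ω n (π.chosen ω n))) * (m.aliveInd π α ω n
      * h (π.chosen ω n) (ω n (π.chosen ω n)))) (m.law θ) ∧
      ∫ ω, (m.aliveInd π α ω n * f (π.chosen ω n) (ω n (π.chosen ω n)))
        * (m.aliveInd π α ω n * h (π.chosen ω n) (ω n (π.chosen ω n))) ∂(m.law θ)
      = ∫ ω, m.aliveInd π α ω n * ∫ z, f (π.chosen ω n) z * h (π.chosen ω n) z
          ∂(m.stepLaw (π.chosen ω n) θ) ∂(m.law θ) := by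
    intro n
    have := m.integrable_step_mul θ π n _ (m.measurable_past_aliveInd π α n)
      (m.integrable_aliveInd θ π α n) (fun j z => f j z * h j z)
      (fun j => (hfm j).mul (hhm j)) hfhi
    have heq : ∀ ω, (m.aliveInd π α ω n * f (π.chosen ω n) (ω n (π.chosen ω n)))
        * (m.aliveInd π α ω n * h (π.chosen ω n) (ω n (π.chosen ω n)))
        = m.aliveInd π α ω n * (f (π.chosen ω n) (ω n (π.chosen ω n))
          * h (π.chosen ω n) (ω n (π.chosen ω n))) := fun ω => by
      rw [mul_mul_mul_comm, aliveInd_mul_self]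
    simpa only [heq] using this
  -- extending the second factor beyond `n` does not change the expectation
  have extend : ∀ n N, n ≤ N → Integrable (fun ω => m.stoppedSum π α f n ω
      * m.stoppedSum π α h n ω) (m.law θ) →
      Integrable (fun ω => m.stoppedSum π α f n ω * m.stoppedSum π α h N ω) (m.law θ) ∧
      ∫ ω, m.stoppedSum π α f n ω * m.stoppedSum π α h N ω ∂(m.law θ)
        = ∫ ω, m.stoppedSum π α f n ω * m.stoppedSum π α h n ω ∂(m.law θ) := by
    intro n N hn h0
    induction N, hn using Nat.le_induction with
    | base => exact ⟨h0, rfl⟩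
    | succ N hN ih =>
      obtain ⟨c1, c2⟩ := cross1 n N hN
      simp only [stoppedSum_succ _ _ _ h N, mul_add]
      exact ⟨ih.1.add c1, by rw [integral_add ih.1 c1, c2, add_zero, ih.2]⟩
  have square : ∀ n, Integrable (fun ω => m.stoppedSum π α f n ω
      * m.stoppedSum π α h n ω) (m.law θ) ∧
      ∫ ω, m.stoppedSum π α f n ω * m.stoppedSum π α h n ω ∂(m.law θ)
      = ∫ ω, m.stoppedSum π α (fun j _ => ∫ z, f j z * h j z ∂(m.stepLaw j θ)) n ω
          ∂(m.law θ) := by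
    intro n
    induction n with
    | zero => simp [stoppedSum]
    | succ n ih =>
      obtain ⟨a1, a2⟩ := cross1 n n le_rfl
      obtain ⟨b1, b2⟩ := cross2 n
      obtain ⟨d1, d2⟩ := diag n
      obtain ⟨e1, e2⟩ := extend n (n + 1) n.le_succ ih.1
      have hbd : Integrable (fun ω =>
          m.aliveInd π α ω n * f (π.chosen ω n) (ω n (π.chosen ω n)) * m.stoppedSum π α h n ω
          + m.aliveInd π α ω n * f (π.chosen ω n) (ω n (π.chosen ω n))
            * (m.aliveInd π α ω n * h (π.chosen ω n) (ω n (π.chosen ω n)))) (m.law θ) :=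
        b1.add d1
      have hc : Integrable (fun ω => m.aliveInd π α ω n * ∫ z, f (π.chosen ω n) z
          * h (π.chosen ω n) z ∂(m.stepLaw (π.chosen ω n) θ)) (m.law θ) :=
        (m.integrable_step_mul θ π n _ (m.measurable_past_aliveInd π α n)
          (m.integrable_aliveInd θ π α n) (fun j _ => ∫ z, f j z * h j z ∂(m.stepLaw j θ))
          (fun _ => measurable_const) (fun _ => integrable_const _)).1
      have hsplit : ∀ ω, m.stoppedSum π α f (n + 1) ω * m.stoppedSum π α h (n + 1) ω
          = m.stoppedSum π α f n ω * m.stoppedSum π α h (n + 1) ω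
            + ((m.aliveInd π α ω n * f (π.chosen ω n) (ω n (π.chosen ω n)))
              * m.stoppedSum π α h n ω
            + (m.aliveInd π α ω n * f (π.chosen ω n) (ω n (π.chosen ω n)))
              * (m.aliveInd π α ω n * h (π.chosen ω n) (ω n (π.chosen ω n)))) := fun ω => by
        rw [stoppedSum_succ _ _ _ f, stoppedSum_succ _ _ _ h]
        ring
      simp only [hsplit]
      refine ⟨e1.add hbd, ?_⟩
      rw [integral_add e1 hbd, integral_add b1 d1, e2, ih.2, b2, d2, zero_add]
      simp only [stoppedSum_succ _ _ _ (fun j _ => ∫ z, f j z * h j z ∂(m.stepLaw j θ))]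
      rw [integral_add (m.integrable_stoppedSum_const θ π α _ n) hc]
  obtain ⟨s1, s2⟩ := square n
  obtain ⟨t1, t2⟩ := extend n N hnN s1
  exact ⟨t1, t2.trans s2⟩

/-- The centred evidence of one query. -/
noncomputable def centredStep (θ : Label) (j : Fin M) (z : Label × ℝ) : ℝ :=
  m.step θ j z.1 - m.info j θ

lemma measurable_centredStep (θ : Label) (j : Fin M) : Measurable (m.centredStep θ j) :=
  (m.measurable_step θ j).sub measurable_const

lemma abs_centredStep_le (θ : Label) (j : Fin M) (z : Label × ℝ) :
    |m.centredStep θ j z| ≤ 2 * m.llrBound := by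
  have h1 := abs_le.1 (m.abs_step_le θ j z.1)
  have h2 := m.info_pos j θ
  have h3 := m.info_le j θ
  unfold centredStep
  rw [abs_le]
  constructor <;> linarith

lemma integral_centredStep (θ : Label) (j : Fin M) :
    ∫ z, m.centredStep θ j z ∂(m.stepLaw j θ) = 0 := by
  unfold centredStep
  rw [m.integral_fst θ j fun y => m.step θ j y - m.info j θ,
    integral_sub (m.integrable_outLaw _ _ _) (integrable_const _), integral_step]
  simp

lemma integrable_centredStep (θ : Label) (j : Fin M) :
    Integrable (m.centredStep θ j) (m.stepLaw j θ) :=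
  m.integrable_fst θ j fun y => m.step θ j y - m.info j θ

lemma integral_centredStep_mul_self (θ : Label) (j : Fin M) :
    ∫ z, m.centredStep θ j z * m.centredStep θ j z ∂(m.stepLaw j θ) = m.stepVar j θ := by
  have := m.integral_fst θ j fun y => (m.step θ j y - m.info j θ) ^ 2
  simp only [sq] at this
  simp only [stepVar, sq]
  exact this

/-- Answers and waiting times are uncorrelated. -/
lemma integral_centredStep_mul_wait (θ : Label) (j : Fin M) :
    ∫ z, m.centredStep θ j z * (max z.2 0 - m.meanWait j) ∂(m.stepLaw j θ) = 0 := by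
  have h := integral_prod_mul (μ := m.outLaw j θ) (ν := m.waitLaw j)
    (fun y => m.step θ j y - m.info j θ) (fun x => max x 0 - m.meanWait j)
  have h0 : ∫ y, (m.step θ j y - m.info j θ) ∂(m.outLaw j θ) = 0 := by
    rw [integral_sub (m.integrable_outLaw _ _ _) (integrable_const _), integral_step]
    simp
  rw [h0, zero_mul] at h
  exact h

/-- Young's inequality in the form of a tangent bound with a perturbed slope. -/
lemma _root_.SeqTest.rpow_perturbed_tangent_le {ρ b w u : ℝ} (hρ : 1 < ρ) (hb : 0 < b) (hw : 0 ≤ w)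
    (hu : |u| ≤ (ρ - 1) / ρ) :
    b ^ ρ + ρ * b ^ (ρ - 1) * (1 + u) * (w - b) - ρ ^ 2 / (ρ - 1) * b ^ ρ * u ^ 2 ≤ w ^ ρ := by
  have hρ0 : 0 < ρ := by linarith
  have hρ1 : 0 < ρ - 1 := by linarith
  set q := ρ / (ρ - 1) with hq
  have hpq : ρ.HolderConjugate q := Real.HolderConjugate.conjExponent hρ
  have hq0 : 0 < q := div_pos hρ0 hρ1
  have hu1 : |u| < 1 := hu.trans_lt ((div_lt_one hρ0).2 (by linarith))
  have hu2 : 0 < 1 + u := by linarith [(abs_lt.1 hu1).1]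
  have hqu : |q * u| ≤ 1 := by
    rw [abs_mul, abs_of_pos hq0]
    calc q * |u| ≤ q * ((ρ - 1) / ρ) := mul_le_mul_of_nonneg_left hu hq0.le
      _ = 1 := by rw [hq]; field_simp
  have hs : (1 + u) ^ q ≤ 1 + q * u + (q * u) ^ 2 := by
    have h1 : 1 + u ≤ Real.exp u := by linarith [Real.add_one_le_exp u]
    have h2 := Real.rpow_le_rpow hu2.le h1 hq0.le
    rw [← Real.exp_mul, mul_comm u q] at h2
    have h3 := (abs_le.1 (Real.abs_exp_sub_one_sub_id_le hqu)).2
    linarith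
  have hbq : (b ^ (ρ - 1)) ^ q = b ^ ρ := by
    rw [← Real.rpow_mul hb.le, hq]
    congr 1
    field_simp
  have hb1 : b ^ (ρ - 1) * b = b ^ ρ := by
    rw [Real.rpow_sub_one hb.ne', div_mul_cancel₀ _ hb.ne']
  have hy := Real.young_inequality_of_nonneg hw
    (mul_pos (Real.rpow_pos_of_pos hb (ρ - 1)) hu2).le hpq
  rw [Real.mul_rpow (Real.rpow_nonneg hb.le _) hu2.le, hbq] at hy
  have hbp := Real.rpow_pos_of_pos hb ρ
  have h4 : b ^ ρ * (1 + u) ^ q ≤ b ^ ρ * (1 + q * u + (q * u) ^ 2) :=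
    mul_le_mul_of_nonneg_left hs hbp.le
  have h5 : w * (b ^ (ρ - 1) * (1 + u))
      ≤ w ^ ρ / ρ + b ^ ρ * (1 + q * u + (q * u) ^ 2) / q :=
    hy.trans (by gcongr)
  have h6 := mul_le_mul_of_nonneg_left h5 hρ0.le
  have h7 : ρ * (w ^ ρ / ρ + b ^ ρ * (1 + q * u + (q * u) ^ 2) / q)
      = w ^ ρ + ((ρ - 1) * b ^ ρ + ρ * b ^ ρ * u + ρ ^ 2 / (ρ - 1) * b ^ ρ * u ^ 2) := by
    rw [hq]
    field_simp
  rw [h7] at h6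
  have h8 : ρ * b ^ (ρ - 1) * (1 + u) * (w - b)
      = ρ * (w * (b ^ (ρ - 1) * (1 + u))) - ρ * b ^ ρ * (1 + u) := by
    rw [← hb1]; ring
  rw [h8]
  linarith

lemma alive_of_mul_lt (π : Policy M) (α : ℝ) (θ : Label) (ω : Sample M) (t : ℕ)
    (h : t * m.llrBound < m.thr α θ) (h' : t * m.llrBound < m.thr α θ.other) :
    m.Alive π α ω t := by
  refine (m.alive_iff π α θ ω t).2 fun s hs => ?_
  have h1 := abs_le.1 (m.abs_evid_le π θ ω s)
  have h2 : (s : ℝ) * m.llrBound ≤ t * m.llrBound :=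
    mul_le_mul_of_nonneg_right (by exact_mod_cast hs) m.llrBound_nonneg
  constructor <;> linarith

lemma stoppedEvid_eq_add (π : Policy M) (α : ℝ) (θ : Label) (N : ℕ) (ω : Sample M) :
    m.stoppedEvid π α θ N ω = m.stoppedSum π α (fun j _ => m.info j θ) N ω
      + m.stoppedSum π α (m.centredStep θ) N ω := by
  rw [← stoppedSum_add]
  simp [stoppedEvid, centredStep]

/-- Lower bound for the conditional risk under a superlinear penalty. The slope of the tangent to
the penalty is perturbed by the factor `1 + u`, where `u` is a small negative multiple of the evidence
martingale at time `n`: if little evidence has been collected by then, a longer waiting time is to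
be expected, whatever the policy. -/
lemma condRisk_ge_perturbed (π : Policy M) {α : ℝ} (h0 : 0 < α) (h1 : α ≤ 1 / 2) (θ : Label)
    (hθ : 0 < m.thr α θ) (hθ' : 0 < m.thr α θ.other) (j : Fin M) (hρ : 1 < m.ρ)
    {S : ℝ} (hSb : S = m.budget α θ) (hS : 0 < S)
    (hdom : ∀ y, m.slope θ j S / 2 ≤ y → m.DominatesAt θ j y)
    {n : ℕ} (hn : ∀ ω, ∀ t < n, m.Alive π α ω t) {η v : ℝ} (hη : 0 < η)
    (hη1 : η / S * (n * (2 * m.llrBound)) ≤ 1 / 2)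
    (hη2 : η / S * (n * (2 * m.llrBound)) ≤ (m.ρ - 1) / m.ρ)
    (hη3 : m.ρ ^ 2 / (m.ρ - 1) * η ≤ m.ρ) (hv : ∀ i, v ≤ m.stepVar i θ) :
    ENNReal.ofReal (m.singleCost θ j S
        - (m.cost j + m.slope θ j S * m.meanWait j) / m.info j θ * m.slack α
        + m.g (m.meanWait j * (S / m.info j θ)) / S ^ 2
          * (m.ρ * η - m.ρ ^ 2 / (m.ρ - 1) * η ^ 2) * (v * n))
      ≤ m.condRisk π α θ := by
  have hI := m.info_pos j θ
  have hμ := m.meanWait_pos j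
  have hc := m.cost_pos j
  have hg := m.gCoef_nonneg
  set b := m.meanWait j * (S / m.info j θ) with hbdef
  have hb : 0 < b := mul_pos hμ (div_pos hS hI)
  set y := m.slope θ j S with hydef
  have hy : 0 ≤ y := m.slope_nonneg θ j hS.le
  have hyb : y * b = m.ρ * m.g b := by
    have : b ^ (m.ρ - 1) * b = b ^ m.ρ := by
      rw [Real.rpow_sub_one hb.ne', div_mul_cancel₀ _ hb.ne']
    rw [hydef, slope, ← hbdef, g, ← this]
    ring
  set q := (m.cost j + y * m.meanWait j) / m.info j θ with hq
  have hq0 : 0 ≤ q := by positivity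
  set κ := m.meanWait j / m.info j θ with hκ
  have hκ0 : 0 < κ := div_pos hμ hI
  have hbκ : b = κ * S := by rw [hbdef, hκ]; ring
  have hyκ : y * κ ≤ q := by
    rw [hq, hκ, ← mul_div_assoc]
    gcongr
    linarith
  set K := m.ρ ^ 2 / (m.ρ - 1) with hK
  have hK0 : 0 < K := div_pos (by positivity) (by linarith)
  set a := η / S with ha
  have ha0 : 0 < a := div_pos hη hS
  have hw0 : 0 ≤ m.width α := by linarith [m.width_eq α θ, m.llrBound_nonneg]
  set Mn := m.stoppedSum π α (m.centredStep θ) n with hMn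
  have hMn_le : ∀ ω, a * |Mn ω| ≤ a * (n * (2 * m.llrBound)) := fun ω =>
    mul_le_mul_of_nonneg_left (m.abs_stoppedSum_le π α (m.abs_centredStep_le θ) n ω) ha0.le
  set V := ∫ ω, m.stoppedSum π α (fun i _ => m.stepVar i θ) n ω ∂(m.law θ) with hV
  have hVn : v * n ≤ V := by
    have h2 : ∀ ω, v * n ≤ m.stoppedSum π α (fun i _ => m.stepVar i θ) n ω := fun ω => by
      rw [stoppedSum, mul_comm]
      calc (n : ℝ) * v = ∑ _t ∈ Finset.range n, v := by simp
        _ ≤ _ := Finset.sum_le_sum fun t ht => by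
          rw [aliveInd_of_alive _ (hn ω t (Finset.mem_range.1 ht)), one_mul]
          exact hv _
    have h3 := integral_mono (integrable_const (v * n))
      (m.integrable_stoppedSum_const θ π α (fun i => m.stepVar i θ) n) h2
    simpa using h3
  refine m.ofReal_le_condRisk_of_eventually π α θ _ (2 * q * m.width α) ?_
  filter_upwards [eventually_ge_atTop n] with N hnN
  set Ξ := m.stoppedSum π α (m.centredStep θ) N with hΞ
  set Δ := m.stoppedSum π α (fun i z => max z.2 0 - m.meanWait i) N with hΔ
  have hΔm : ∀ i : Fin M, Measurable fun z : Label × ℝ => max z.2 0 - m.meanWait i := fun i =>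
    (measurable_snd.max measurable_const).sub measurable_const
  have hΔi : ∀ i, Integrable (fun z : Label × ℝ => max z.2 0 - m.meanWait i) (m.stepLaw i θ) :=
    fun i => (m.integrable_reward_snd θ m.isReward_wait i).sub (integrable_const _)
  have hΔ0 : ∀ i, ∫ z, (max z.2 0 - m.meanWait i) ∂(m.stepLaw i θ) = 0 := fun i => by
    rw [integral_sub (m.integrable_reward_snd θ m.isReward_wait i) (integrable_const _),
      m.integral_reward_snd θ m.isReward_wait i]
    simp
  -- the ingredients of the lower bound, with their integrals
  let P : (Sample M → ℝ) → ℝ → Prop := fun F x => Integrable F (m.law θ) ∧ ∫ ω, F ω ∂(m.law θ) = x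
  have padd : ∀ {F G x z}, P F x → P G z → P (fun ω => F ω + G ω) (x + z) :=
    fun hF hG => ⟨hF.1.add hG.1, by rw [integral_add hF.1 hG.1, hF.2, hG.2]⟩
  have pmul : ∀ {F x} (c : ℝ), P F x → P (fun ω => c * F ω) (c * x) :=
    fun c hF => ⟨hF.1.const_mul c, by rw [integral_const_mul, hF.2]⟩
  have pconst : ∀ c : ℝ, P (fun _ => c) c := fun c => ⟨integrable_const c, by simp⟩
  have centred : ∀ (f : Fin M → Label × ℝ → ℝ) (L : ℕ), (∀ i, Measurable (f i)) →
      (∀ i, Integrable (f i) (m.stepLaw i θ)) → (∀ i, ∫ z, f i z ∂(m.stepLaw i θ) = 0) →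
      P (m.stoppedSum π α f L) 0 := fun f L hf hfi hf0 =>
    ⟨m.integrable_stoppedSum θ π α f hf hfi L, by
      rw [m.integral_stoppedSum θ π α f hf hfi L]; simp [hf0, stoppedSum]⟩
  have pM : P Mn 0 := centred _ n (m.measurable_centredStep θ) (m.integrable_centredStep θ)
    (m.integral_centredStep θ)
  have pΞ : P Ξ 0 := centred _ N (m.measurable_centredStep θ) (m.integrable_centredStep θ)
    (m.integral_centredStep θ)
  have pΔ : P Δ 0 := centred _ N hΔm hΔi hΔ0
  have hMΞ : ∀ L, n ≤ L → P (fun ω => Mn ω * m.stoppedSum π α (m.centredStep θ) L ω) V := by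
    intro L hL
    have := m.integral_stoppedSum_mul_stoppedSum θ π α (m.measurable_centredStep θ)
      (m.abs_centredStep_le θ) (m.measurable_centredStep θ) (m.integrable_centredStep θ)
      (m.integral_centredStep θ) (m.integral_centredStep θ) hL
    simp only [integral_centredStep_mul_self] at this
    exact this
  have pMΞ := hMΞ N hnN
  have pMM := hMΞ n le_rfl
  have pMΔ : P (fun ω => Mn ω * Δ ω) 0 := by
    have := m.integral_stoppedSum_mul_stoppedSum θ π α (m.measurable_centredStep θ)
      (m.abs_centredStep_le θ) hΔm hΔi (m.integral_centredStep θ) hΔ0 hnN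
    simp only [integral_centredStep_mul_wait] at this
    refine ⟨this.1, this.2.trans ?_⟩
    simp [stoppedSum]
  have pF : P (m.failInd π α θ N) (∫ ω, m.failInd π α θ N ω ∂(m.law θ)) :=
    ⟨m.integrable_failInd π α θ N, rfl⟩
  have ptot := padd (padd (padd (padd (padd (padd (padd (pconst (q * m.thr α θ + m.g b - y * b))
    (pmul (-(a * (y * κ * m.thr α θ - y * b))) pM)) (pmul (-(2 * q * m.width α)) pF))
    (pmul (-q) pΞ)) (pmul (y * κ * a) pMΞ)) (pmul y pΔ)) (pmul (-(y * a)) pMΔ))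
    (pmul (-(K * m.g b * a ^ 2)) pMM)
  refine le_trans (ENNReal.ofReal_le_ofReal ?_)
    (m.ofReal_integral_le_condRisk π α θ N ptot.1 fun ω => ?_)
  · rw [ptot.2]
    have e1 := m.budget_le_integral π h0 h1 θ hθ hθ' N
    have e2 : m.thr α θ = S + m.slack α := by rw [hSb, budget_eq]; ring
    have e3 : y * κ * a * V + -(K * m.g b * a ^ 2) * V
        = m.g b / S ^ 2 * (m.ρ * η - K * η ^ 2) * V := by
      have : y * κ = m.ρ * m.g b / S := by
        rw [eq_div_iff hS.ne', ← hyb, hbκ]; ring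
      rw [this, ha]
      field_simp
      ring
    have e4 : 0 ≤ m.g b / S ^ 2 * (m.ρ * η - K * η ^ 2) :=
      mul_nonneg (div_nonneg (m.g_nonneg hb.le) (sq_nonneg S)) (by nlinarith)
    have e5 := mul_le_mul_of_nonneg_left hVn e4
    have e6 := mul_le_mul_of_nonneg_left e1 (mul_nonneg zero_le_two hq0)
    have e7 : m.singleCost θ j S = m.g b - y * b + q * S := m.singleCost_eq θ j S
    rw [← hSb] at e6
    rw [e7]
    rw [e2] at e6 ⊢
    linarith
  · set u := -(a * Mn ω) with hu
    have hua : |u| ≤ a * (n * (2 * m.llrBound)) := by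
      rw [hu, abs_neg, abs_mul, abs_of_pos ha0]
      exact hMn_le ω
    have hu1 := abs_le.1 (hua.trans hη1)
    set W := m.waitTo π α N ω with hW
    have hW0 : 0 ≤ W := m.waitTo_nonneg π α N ω
    have hyoung := rpow_perturbed_tangent_le hρ hb hW0 (hua.trans hη2)
    have hgW : m.g b + y * (1 + u) * (W - b) - K * m.g b * u ^ 2 ≤ m.g W := by
      have := mul_le_mul_of_nonneg_left hyoung hg
      have e : y = m.gCoef * m.ρ * b ^ (m.ρ - 1) := rfl
      unfold g
      rw [e]
      linarith
    have hWeq : W = m.stoppedSum π α (fun i _ => m.meanWait i) N ω + Δ ω := by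
      rw [hΔ, ← stoppedSum_add]
      simp [hW, waitTo, stoppedReward]
    have hu2 : 1 / 2 * y ≤ (1 + u) * y :=
      mul_le_mul_of_nonneg_right (by linarith [hu1.1]) hy
    have hdomu := hdom ((1 + u) * y) (by linarith)
    have hcw : (q + y * κ * u) * m.stoppedSum π α (fun i _ => m.info i θ) N ω
        ≤ m.costTo π α N ω + (1 + u) * y * m.stoppedSum π α (fun i _ => m.meanWait i) N ω := by
      rw [← stoppedSum_const_mul, ← stoppedSum_const_mul, costTo, stoppedReward, ← stoppedSum_add]
      refine m.stoppedSum_le π α (fun i _ => ?_) N ω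
      have : q + y * κ * u = (m.cost j + (1 + u) * y * m.meanWait j) / m.info j θ := by
        rw [hq, hκ]; ring
      rw [this, div_mul_eq_mul_div, div_le_iff₀ hI]
      exact hdomu i
    have hE := m.stoppedEvid_eq_add π α θ N ω
    have hEge := (m.le_min_stoppedEvid π α θ hθ hθ' N ω).trans (min_le_left _ _)
    have hyκ0 : 0 ≤ y * κ := mul_nonneg hy hκ0.le
    have hyκu := mul_le_mul_of_nonneg_left hu1.1 hyκ0
    have hyκu' := mul_le_mul_of_nonneg_left hu1.2 hyκ0
    have hcoef0 : 0 ≤ q + y * κ * u := by linarith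
    have hcoef1 : q + y * κ * u ≤ 2 * q := by linarith
    have hfail := mul_nonneg hw0 (m.failInd_nonneg π α θ N ω)
    have e1 := mul_le_mul_of_nonneg_left hEge hcoef0
    have e2 := mul_le_mul_of_nonneg_right hcoef1 hfail
    rw [hE] at e1
    have hMu : a * Mn ω = -u := by rw [hu, neg_neg]
    have e3 : q * m.thr α θ + m.g b - y * b + -(a * (y * κ * m.thr α θ - y * b)) * Mn ω
        + -(2 * q * m.width α) * m.failInd π α θ N ω + -q * Ξ ω + y * κ * a * (Mn ω * Ξ ω)
        + y * Δ ω + -(y * a) * (Mn ω * Δ ω) + -(K * m.g b * a ^ 2) * (Mn ω * Mn ω)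
        = (q + y * κ * u) * m.thr α θ - 2 * q * (m.width α * m.failInd π α θ N ω)
          - (q + y * κ * u) * Ξ ω + y * (1 + u) * Δ ω + (m.g b - y * b) - y * b * u
          - K * m.g b * u ^ 2 := by
      rw [hu]; ring
    rw [e3]
    rw [hWeq] at hgW
    rw [hWeq]
    linarith

/-- Superlinear penalties: whatever the policy, the conditional risk exceeds the cost of the
dominant LLM by a multiple of `S ^ (ρ - 1)`, where `S` is the budget. In a number of early
queries proportional to `S`, during which testing cannot stop, the evidence martingale builds up a
variance of order `S`; by strict convexity each unit of variance costs a multiple of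
`S ^ (ρ - 2)`. -/
lemma exists_condRisk_ge_of_superlinear (θ : Label) (j : Fin M) (hρ : 1 < m.ρ) (hg : 0 < m.gCoef)
    (hj : ∀ᶠ y in atTop, m.DominatesAt θ j y) :
    ∃ k, 0 < k ∧ ∀ᶠ α in 𝓝[>] (0 : ℝ), ∀ π : Policy M,
      ENNReal.ofReal (m.singleCost θ j (m.budget α θ) + k * m.budget α θ ^ (m.ρ - 1))
        ≤ m.condRisk π α θ := by
  obtain ⟨Y, hY⟩ := eventually_atTop.1 hj
  obtain ⟨R, hR⟩ := eventually_atTop.1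
    (((m.tendsto_slope θ j hρ hg).eventually_ge_atTop (2 * Y)))
  obtain ⟨v, hv, hv'⟩ := exists_pos_forall_le (fun i => m.stepVar i θ) fun i => m.stepVar_pos i θ
  have hI := m.info_pos j θ
  have hμ := m.meanWait_pos j
  have hc := m.cost_pos j
  set C := m.llrBound with hC
  have hC0 : 0 < C := m.llrBound_pos j
  have hρ0 : 0 < m.ρ := by linarith
  have hρ1 : 0 < m.ρ - 1 := by linarith
  set K := m.ρ ^ 2 / (m.ρ - 1) with hK
  have hK0 : 0 < K := by positivity
  set η := min (min (1 / 2) ((m.ρ - 1) / m.ρ)) (m.ρ / (2 * K)) with hη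
  have hη0 : 0 < η := by positivity
  have hηK : K * η ≤ m.ρ / 2 := by
    have : η ≤ m.ρ / (2 * K) := min_le_right _ _
    rw [le_div_iff₀ (by positivity)] at this
    linarith
  set κ := m.meanWait j / m.info j θ with hκ
  have hκ0 : 0 < κ := div_pos hμ hI
  -- `k₀ S ^ (ρ - 1)` is gained, and a unit of slack costs at most `k₁ S ^ (ρ - 1)`
  set k₀ := m.gCoef * κ ^ m.ρ * (m.ρ * η / 2) * (v / (8 * C)) with hk₀
  have hk₀0 : 0 < k₀ := by positivity
  set k₁ := m.cost j / m.info j θ + m.gCoef * m.ρ * κ ^ (m.ρ - 1) * κ with hk₁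
  have hk₁0 : 0 < k₁ := by positivity
  refine ⟨k₀ / 2, by positivity, ?_⟩
  filter_upwards [m.eventually_thresholds (max R (max 1 (8 * C))) (k₀ / (2 * k₁)) (by positivity)]
    with α ⟨h0, h1, h2, h3, h4⟩ π
  obtain ⟨hSR, hSt, _, _, htΛ⟩ := h4 θ
  set S := m.budget α θ with hSdef
  have hS1 : 1 ≤ S := le_trans (by simp) hSR
  have hS8 : 8 * C ≤ S := le_trans (by simp) hSR
  have hSR' : R ≤ S := le_trans (by simp) hSR
  have hS0 : 0 < S := by linarith
  have hot := (h4 θ.other).2.1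
  have hoΛ := (h4 θ.other).2.2.2.1
  have ht4 : S / 4 ≤ m.thr α θ.other := by linarith
  set n := ⌊S / (4 * C)⌋₊ with hn
  have hn1 : (n : ℝ) ≤ S / (4 * C) := Nat.floor_le (by positivity)
  have hn1' : (n : ℝ) * C ≤ S / 4 := by
    rw [le_div_iff₀ (by positivity)] at hn1
    linarith
  have hn2 : S / (8 * C) ≤ n := by
    have h5 := Nat.lt_floor_add_one (S / (4 * C))
    have h6 : 1 ≤ S / (8 * C) := (one_le_div (by positivity)).2 hS8
    have h7 : S / (4 * C) = S / (8 * C) + S / (8 * C) := by field_simp; norm_num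
    rw [← hn] at h5
    linarith
  have halive : ∀ ω, ∀ t < n, m.Alive π α ω t := by
    intro ω t ht
    have h5 : (t : ℝ) * C < n * C := mul_lt_mul_of_pos_right (by exact_mod_cast ht) hC0
    exact m.alive_of_mul_lt π α θ ω t (by linarith) (by linarith)
  have hηn : η / S * (n * (2 * C)) ≤ η := by
    rw [div_mul_eq_mul_div, div_le_iff₀ hS0]
    exact mul_le_mul_of_nonneg_left (by linarith) hη0.le
  have main := m.condRisk_ge_perturbed π h0 h1 θ (by linarith) (by linarith) j hρ hSdef hS0
    (fun y hy => hY y (by linarith [hR S hSR'])) halive hη0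
    (hηn.trans ((min_le_left _ _).trans (min_le_left _ _)))
    (hηn.trans ((min_le_left _ _).trans (min_le_right _ _))) (by linarith) hv'
  refine le_trans (ENNReal.ofReal_le_ofReal ?_) main
  have hb : m.meanWait j * (S / m.info j θ) = κ * S := by rw [hκ]; ring
  have hSρ : S ^ m.ρ = S ^ (m.ρ - 1) * S := by
    rw [Real.rpow_sub_one hS0.ne', div_mul_cancel₀ _ hS0.ne']
  have hSp : 1 ≤ S ^ (m.ρ - 1) := Real.one_le_rpow hS1 hρ1.le
  have hgain : k₀ * S ^ (m.ρ - 1) ≤ m.g (m.meanWait j * (S / m.info j θ)) / S ^ 2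
      * (m.ρ * η - K * η ^ 2) * (v * n) := by
    have e1 : m.g (m.meanWait j * (S / m.info j θ)) / S ^ 2
        = m.gCoef * κ ^ m.ρ * S ^ (m.ρ - 1) / S := by
      rw [hb, g, Real.mul_rpow hκ0.le hS0.le, hSρ]
      field_simp
    have e2 : m.ρ * η / 2 ≤ m.ρ * η - K * η ^ 2 := by
      have e4 := mul_le_mul_of_nonneg_right hηK hη0.le
      have e5 : K * η ^ 2 = K * η * η := by ring
      linarith
    have e3 : v * (S / (8 * C)) ≤ v * n := mul_le_mul_of_nonneg_left hn2 hv.le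
    rw [e1]
    calc k₀ * S ^ (m.ρ - 1)
        = m.gCoef * κ ^ m.ρ * S ^ (m.ρ - 1) / S * (m.ρ * η / 2) * (v * (S / (8 * C))) := by
          rw [hk₀]; field_simp
      _ ≤ _ := mul_le_mul (mul_le_mul_of_nonneg_left e2 (by positivity)) e3 (by positivity)
          (mul_nonneg (by positivity) (le_trans (by positivity) e2))
  have hloss : (m.cost j + m.slope θ j S * m.meanWait j) / m.info j θ * m.slack α
      ≤ k₀ / 2 * S ^ (m.ρ - 1) := by
    have e1 : (m.cost j + m.slope θ j S * m.meanWait j) / m.info j θ ≤ k₁ * S ^ (m.ρ - 1) := by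
      rw [slope, hb, Real.mul_rpow hκ0.le hS0.le]
      have e2 : (m.cost j + m.gCoef * m.ρ * (κ ^ (m.ρ - 1) * S ^ (m.ρ - 1)) * m.meanWait j)
          / m.info j θ = m.cost j / m.info j θ
            + m.gCoef * m.ρ * κ ^ (m.ρ - 1) * κ * S ^ (m.ρ - 1) := by
        rw [add_div, hκ]; ring
      rw [e2, hk₁, add_mul]
      have := le_mul_of_one_le_right (div_pos hc hI).le hSp
      linarith
    have e4 : 0 ≤ (m.cost j + m.slope θ j S * m.meanWait j) / m.info j θ := by
      have := m.slope_nonneg θ j hS0.le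
      positivity
    calc _ ≤ (m.cost j + m.slope θ j S * m.meanWait j) / m.info j θ * (k₀ / (2 * k₁)) :=
          mul_le_mul_of_nonneg_left h3 e4
      _ ≤ k₁ * S ^ (m.ρ - 1) * (k₀ / (2 * k₁)) :=
          mul_le_mul_of_nonneg_right e1 (by positivity)
      _ = _ := by field_simp
  linarith

/-! ### Linear penalty: the gain from the overshoot -/

/-- For `0 ≤ x`, the distance from `x` to the first multiple of `a` that is at least `x`. -/
noncomputable def _root_.SeqTest.overshoot (a x : ℝ) : ℝ := ⌈x / a⌉₊ * a - x

lemma _root_.SeqTest.overshoot_nonneg {a : ℝ} (ha : 0 < a) (x : ℝ) : 0 ≤ overshoot a x := by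
  have := Nat.le_ceil (x / a)
  rw [div_le_iff₀ ha] at this
  unfold overshoot
  linarith

lemma _root_.SeqTest.measurable_overshoot (a : ℝ) : Measurable (overshoot a) := by
  unfold overshoot
  have h : Measurable fun x : ℝ => ⌈x / a⌉₊ := Nat.measurable_ceil.comp (measurable_id.div_const a)
  have h2 : Measurable fun n : ℕ => (n : ℝ) := measurable_of_countable _
  exact ((h2.comp h).mul_const a).sub measurable_id

/-- If `d` is not an integer multiple of `a`, then the overshoots at `x` and at `x + d` cannot both
be small. -/
lemma _root_.SeqTest.exists_overshoot_ge {a d : ℝ} (ha : 0 < a) (hd : 0 ≤ d)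
    (h : ∀ k : ℕ, d ≠ k * a) :
    ∃ ε, 0 < ε ∧ ∀ x, ε ≤ overshoot a x ∨ ε ≤ overshoot a (x + d) := by
  set f := ⌊d / a⌋₊ with hf
  have h1 : (f : ℝ) * a < d := by
    have := Nat.floor_le (div_nonneg hd ha.le)
    rw [le_div_iff₀ ha] at this
    exact lt_of_le_of_ne this (h f).symm
  have h2 : d < (f + 1) * a := by
    have := Nat.lt_floor_add_one (d / a)
    rwa [div_lt_iff₀ ha] at this
  refine ⟨min (d - f * a) ((f + 1) * a - d), lt_min (by linarith) (by linarith), fun x => ?_⟩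
  by_contra hc
  push Not at hc
  have h3 := overshoot_nonneg ha x
  have h4 := overshoot_nonneg ha (x + d)
  have hle : ⌈x / a⌉₊ ≤ ⌈(x + d) / a⌉₊ := Nat.ceil_mono (by gcongr; linarith)
  obtain ⟨k, hk⟩ := Nat.exists_eq_add_of_le hle
  have h5 : overshoot a (x + d) - overshoot a x = k * a - d := by
    unfold overshoot
    rw [hk]
    push_cast
    ring
  have h6 := lt_min_iff.1 hc.1
  have h7 := lt_min_iff.1 hc.2
  rcases le_or_gt k f with hkf | hkf
  · have : (k : ℝ) * a ≤ f * a := mul_le_mul_of_nonneg_right (by exact_mod_cast hkf) ha.le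
    linarith
  · have : ((f : ℝ) + 1) * a ≤ k * a := mul_le_mul_of_nonneg_right (by exact_mod_cast hkf) ha.le
    linarith

/-- A prescribed block of answers of LLM `j` has probability bounded below given the past. -/
lemma measure_pattern_ge (θ : Label) (j : Fin M) (s : ℕ) {E : Set (Sample M)}
    (hE : MeasurableSet[past M s] E) (y : ℕ → Label) {p : ℝ} (hp : 0 ≤ p)
    (hpy : ∀ z, p ≤ m.outProb j θ z) (R : ℕ) :
    MeasurableSet[past M (s + R)] (E ∩ {ω | ∀ r < R, (ω (s + r) j).1 = y r}) ∧
      p ^ R * (m.law θ).real E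
        ≤ (m.law θ).real (E ∩ {ω | ∀ r < R, (ω (s + r) j).1 = y r}) := by
  induction R with
  | zero => simpa using hE
  | succ R ih =>
    obtain ⟨ih1, ih2⟩ := ih
    have hsplit : E ∩ {ω : Sample M | ∀ r < R + 1, (ω (s + r) j).1 = y r}
        = (E ∩ {ω | ∀ r < R, (ω (s + r) j).1 = y r}) ∩ {ω | (ω (s + R) j).1 = y R} := by
      ext ω
      simp only [Set.mem_inter_iff, Set.mem_ofPred_eq]
      constructor
      · rintro ⟨h1, h2⟩
        exact ⟨⟨h1, fun r hr => h2 r (by omega)⟩, h2 R (by omega)⟩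
      · rintro ⟨⟨h1, h2⟩, h3⟩
        refine ⟨h1, fun r hr => ?_⟩
        rcases Nat.lt_succ_iff_lt_or_eq.1 hr with hr | rfl
        exacts [h2 r hr, h3]
    have hcoord : Measurable fun x : Fin M → Label × ℝ => (x j).1 :=
      measurable_fst.comp (measurable_pi_apply j)
    have hlast : MeasurableSet[MeasurableSpace.comap (fun ω : Sample M => ω (s + R)) inferInstance]
        {ω : Sample M | (ω (s + R) j).1 = y R} :=
      ⟨{x | (x j).1 = y R}, hcoord (measurableSet_singleton _), rfl⟩
    have hlast' : MeasurableSet[past M (s + (R + 1))] {ω : Sample M | (ω (s + R) j).1 = y R} :=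
      (hcoord.comp (measurable_past_eval (by omega))) (measurableSet_singleton _)
    have hprob : p ≤ (m.law θ).real {ω : Sample M | (ω (s + R) j).1 = y R} := by
      have h1 := (m.measurePreserving_coord θ (s + R) j).measure_preimage
        (s := Prod.fst ⁻¹' {y R}) (measurable_fst (measurableSet_singleton _)).nullMeasurableSet
      have h2 := (measurePreserving_fst (μ := m.outLaw j θ) (ν := m.waitLaw j)).measure_preimage
        (s := {y R}) (measurableSet_singleton _).nullMeasurableSet
      have h3 : (m.law θ) {ω : Sample M | (ω (s + R) j).1 = y R} = m.outLaw j θ {y R} :=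
        h1.trans h2
      have h4 : m.outLaw j θ {y R} = ENNReal.ofReal (m.outProb j θ (y R)) := by
        rw [outLaw]
        cases y R <;> simp
      rw [measureReal_def, h3, h4, ENNReal.toReal_ofReal (m.outProb_pos _ _ _).le]
      exact hpy _
    have hind := (Indep_iff _ _ _).1 (m.indep_past θ (s + R)) _ _ ih1 hlast
    rw [hsplit]
    refine ⟨(past_mono (by omega) _ ih1).inter hlast', ?_⟩
    have hreal : (m.law θ).real ((E ∩ {ω | ∀ r < R, (ω (s + r) j).1 = y r})
          ∩ {ω | (ω (s + R) j).1 = y R})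
        = (m.law θ).real (E ∩ {ω | ∀ r < R, (ω (s + r) j).1 = y r})
          * (m.law θ).real {ω | (ω (s + R) j).1 = y R} := by
      simp only [measureReal_def]
      rw [hind, ENNReal.toReal_mul]
    rw [hreal, pow_succ]
    have h5 := mul_le_mul ih2 hprob hp measureReal_nonneg
    linarith

/-- As long as LLM `j` is queried and answers in favour of `θ`, the evidence climbs in equal steps
and leaves the continuation region with the corresponding overshoot. -/
lemma stoppedEvid_of_run (π : Policy M) (α : ℝ) (θ : Label) (j : Fin M) (ω : Sample M) (t N : ℕ)
    (ht : m.Alive π α ω t)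
    (hj : ∀ r, t + r < t + ⌈(m.thr α θ - m.evid π θ ω t) / m.step θ j θ⌉₊ →
      m.Alive π α ω (t + r) → π.chosen ω (t + r) = j)
    (hans : ∀ r < ⌈(m.thr α θ - m.evid π θ ω t) / m.step θ j θ⌉₊, (ω (t + r) j).1 = θ)
    (hN : t + ⌈(m.thr α θ - m.evid π θ ω t) / m.step θ j θ⌉₊ ≤ N) :
    m.stoppedEvid π α θ N ω
      = m.thr α θ + overshoot (m.step θ j θ) (m.thr α θ - m.evid π θ ω t) := by
  set x := m.thr α θ - m.evid π θ ω t with hx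
  set a := m.step θ j θ with ha
  have ha0 : 0 < a := m.step_self_pos θ j
  have hlow := ((m.alive_iff π α θ ω t).1 ht t le_rfl).1
  have hx0 : 0 < x := by
    have := ((m.alive_iff π α θ ω t).1 ht t le_rfl).2
    linarith
  set n := ⌈x / a⌉₊ with hn
  have climb : ∀ r ≤ n, m.evid π θ ω (t + r) = m.evid π θ ω t + r * a ∧
      (r < n → m.Alive π α ω (t + r)) := by
    intro r
    induction r with
    | zero => exact fun _ => ⟨by simp, fun _ => ht⟩
    | succ r ih =>
      intro hr
      obtain ⟨h1, h2⟩ := ih (by omega)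
      have h3 := h2 (by omega)
      have h4 : m.evid π θ ω (t + (r + 1)) = m.evid π θ ω t + ((r + 1 : ℕ) : ℝ) * a := by
        rw [← add_assoc, evid_succ, hj r (by omega) h3, hans r (by omega), h1]
        push_cast
        ring
      refine ⟨h4, fun hlt => (m.alive_iff π α θ ω _).2 fun u hu => ?_⟩
      rcases hu.lt_or_eq with hu | rfl
      · exact (m.alive_iff π α θ ω _).1 h3 u (by omega)
      · have h5 := Nat.lt_ceil.1 hlt
        rw [lt_div_iff₀ ha0] at h5
        have h6 : 0 ≤ ((r + 1 : ℕ) : ℝ) * a := by positivity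
        rw [h4]
        constructor <;> linarith
  have hend := (climb n le_rfl).1
  have hn0 : 0 < n := Nat.ceil_pos.2 (div_pos hx0 ha0)
  have hover : m.evid π θ ω (t + n) = m.thr α θ + overshoot a x := by
    rw [hend, overshoot]
    linarith
  have hdead : ¬m.Alive π α ω (t + n) := fun h => by
    have h1 := ((m.alive_iff π α θ ω _).1 h _ le_rfl).2
    rw [hover] at h1
    linarith [overshoot_nonneg ha0 x]
  have halive : ∀ s < t + n, m.Alive π α ω s := fun s hs =>
    ((climb (n - 1) (by omega)).2 (by omega)).mono m (by omega)
  have h1 := m.stoppedEvid_eq π α θ ω (t + n) halive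
  have h2 := m.stoppedSum_eq_of_not_alive π α (fun j z => m.step θ j z.1) ω hN hdead
  exact h2.trans (h1.trans hover)

/-- The event that testing is still running at time `s`, and that `s` is the first time at which the
evidence is within one step of the threshold. -/
def entrance (π : Policy M) (α : ℝ) (θ : Label) (s : ℕ) : Set (Sample M) :=
  {ω | m.Alive π α ω s ∧ m.thr α θ - m.llrBound ≤ m.evid π θ ω s ∧
    ∀ r < s, m.evid π θ ω r < m.thr α θ - m.llrBound}

lemma measurable_past_evid (π : Policy M) (θ : Label) (t : ℕ) :
    Measurable[past M t] fun ω : Sample M => m.evid π θ ω t :=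
  (m.measurable_past_cumLLR π t).const_mul _

lemma measurableSet_entrance (π : Policy M) (α : ℝ) (θ : Label) (s : ℕ) :
    MeasurableSet[past M s] (m.entrance π α θ s) := by
  have h1 : m.entrance π α θ s = {ω | m.Alive π α ω s}
      ∩ ({ω | m.evid π θ ω s ∈ Set.Ici (m.thr α θ - m.llrBound)}
      ∩ ⋂ r ∈ Set.Iio s, {ω | m.evid π θ ω r ∈ Set.Iio (m.thr α θ - m.llrBound)}) := by
    ext ω
    simp [entrance]
  rw [h1]
  refine (m.measurableSet_past_alive π α s).inter
    (((m.measurable_past_evid π θ s) measurableSet_Ici).inter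
      (MeasurableSet.biInter (Set.to_countable _) fun r hr => ?_))
  exact ((m.measurable_past_evid π θ r).mono (past_mono (le_of_lt hr)) le_rfl) measurableSet_Iio

lemma entrance_unique (π : Policy M) (α : ℝ) (θ : Label) {s t : ℕ} {ω : Sample M}
    (hs : ω ∈ m.entrance π α θ s) (ht : ω ∈ m.entrance π α θ t) : s = t := by
  rcases lt_trichotomy s t with h | h | h
  · linarith [ht.2.2 s h, hs.2.1]
  · exact h
  · linarith [hs.2.2 t h, ht.2.1]

/-- A run that ends by accepting `θ` passes within one step of the threshold. -/
lemma exists_mem_entrance (π : Policy M) (α : ℝ) (θ : Label) (hθ : 0 < m.thr α θ) (N : ℕ)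
    (ω : Sample M) (h1 : ¬m.Alive π α ω N) (h2 : ¬m.stoppedEvid π α θ N ω ≤ -m.thr α θ.other) :
    ∃ s < N, ω ∈ m.entrance π α θ s := by
  classical
  obtain ⟨t, htN, ha, hna, he⟩ := m.exists_exit π α θ ω N h1
  have hup : m.thr α θ ≤ m.evid π θ ω t := by
    rcases m.exit_evid π α θ ω t ha hna with h | h
    · exact h
    · exact absurd (he.trans_le h) h2
  have hC := m.llrBound_nonneg
  have hex : ∃ s, m.thr α θ - m.llrBound ≤ m.evid π θ ω s := ⟨t, by linarith⟩
  set s := Nat.find hex with hs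
  have hst : s ≤ t := Nat.find_min' hex (by linarith)
  have hne : s ≠ t := by
    intro hEq
    cases t with
    | zero => rw [evid_zero] at hup; linarith
    | succ t =>
      have h3 := Nat.find_min hex (m := t) (by omega)
      rw [evid_succ] at hup
      have := (abs_le.1 (m.abs_step_le θ (π.chosen ω t) (ω t (π.chosen ω t)).1)).2
      exact h3 (by linarith)
  have hlt : s < t := lt_of_le_of_ne hst hne
  exact ⟨s, by omega, ha s hlt, Nat.find_spec hex, fun r hr => not_le.1 (Nat.find_min hex hr)⟩

open Classical in
/-- Counts the queries made to LLMs other than `j`, plus the overshoot in units of `ε`. -/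
noncomputable def deviation (π : Policy M) (α : ℝ) (θ : Label) (j : Fin M) (ε : ℝ) (N : ℕ)
    (ω : Sample M) : ℝ :=
  m.stoppedSum π α (fun i _ => if i = j then 0 else 1) N ω
    + (m.stoppedEvid π α θ N ω - min (m.stoppedEvid π α θ N ω) (m.thr α θ)) / ε

lemma deviation_nonneg (π : Policy M) (α : ℝ) (θ : Label) (j : Fin M) {ε : ℝ} (hε : 0 < ε)
    (N : ℕ) (ω : Sample M) : 0 ≤ m.deviation π α θ j ε N ω := by
  classical
  refine add_nonneg (m.stoppedSum_nonneg π α (f := fun i _ => if i = j then 0 else 1)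
    (fun i _ => by split_ifs <;> simp) N ω) (div_nonneg ?_ hε.le)
  linarith [min_le_left (m.stoppedEvid π α θ N ω) (m.thr α θ)]

lemma one_le_deviation_of_other (π : Policy M) (α : ℝ) (θ : Label) (j : Fin M) {ε : ℝ}
    (hε : 0 < ε) (N : ℕ) (ω : Sample M) {t : ℕ} (ht : t < N) (ha : m.Alive π α ω t)
    (hne : π.chosen ω t ≠ j) : 1 ≤ m.deviation π α θ j ε N ω := by
  classical
  have h1 : 1 ≤ m.stoppedSum π α (fun i _ => if i = j then 0 else 1) N ω := by
    have := Finset.single_le_sum (f := fun t => m.aliveInd π α ω t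
      * (if π.chosen ω t = j then (0 : ℝ) else 1)) (fun t _ => mul_nonneg
        (m.aliveInd_nonneg π α ω t) (by split_ifs <;> simp)) (Finset.mem_range.2 ht)
    rw [aliveInd_of_alive _ ha, if_neg hne, mul_one] at this
    exact this
  have h2 : 0 ≤ (m.stoppedEvid π α θ N ω - min (m.stoppedEvid π α θ N ω) (m.thr α θ)) / ε :=
    div_nonneg (by linarith [min_le_left (m.stoppedEvid π α θ N ω) (m.thr α θ)]) hε.le
  unfold deviation
  linarith

lemma one_le_deviation_of_overshoot (π : Policy M) (α : ℝ) (θ : Label) (j : Fin M) {ε : ℝ}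
    (hε : 0 < ε) (N : ℕ) (ω : Sample M) (h : m.thr α θ + ε ≤ m.stoppedEvid π α θ N ω) :
    1 ≤ m.deviation π α θ j ε N ω := by
  classical
  have h1 := m.stoppedSum_nonneg π α (f := fun i _ => if i = j then 0 else 1)
    (fun i _ => by split_ifs <;> simp) N ω
  have h2 : 1 ≤ (m.stoppedEvid π α θ N ω - min (m.stoppedEvid π α θ N ω) (m.thr α θ)) / ε := by
    rw [one_le_div hε, min_eq_right (by linarith)]
    linarith
  unfold deviation
  linarith

/-- The answers awaited after the entrance: all in favour of `θ` if `first` holds, which will mean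
that they produce an overshoot of at least `ε`, and otherwise one against `θ` followed by answers in
favour of `θ`. -/
def awaited (θ : Label) (first : Prop) [Decidable first] (r : ℕ) : Label :=
  if r = 0 ∧ ¬first then θ.other else θ

open Classical in
/-- Entrance at time `s` followed by the awaited answers of LLM `j`. -/
noncomputable def goodBlock (π : Policy M) (α : ℝ) (θ : Label) (j : Fin M) (ε : ℝ) (R s : ℕ) :
    Set (Sample M) :=
  {ω | ω ∈ m.entrance π α θ s ∧ ∀ r < R, (ω (s + r) j).1
    = awaited θ (ε ≤ overshoot (m.step θ j θ) (m.thr α θ - m.evid π θ ω s)) r}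

/-- On a good block the policy either queries another LLM or overshoots. -/
lemma one_le_deviation_of_mem_goodBlock (π : Policy M) (α : ℝ) (θ : Label) (j : Fin M) {ε : ℝ}
    (hε : 0 < ε) (hover : ∀ x, ε ≤ overshoot (m.step θ j θ) x
      ∨ ε ≤ overshoot (m.step θ j θ) (x + -m.step θ j θ.other))
    (hwide : 2 * m.llrBound < m.thr α θ + m.thr α θ.other)
    {R s N : ℕ} (hR : 2 * m.llrBound / m.step θ j θ + 2 ≤ R) (hN : s + R ≤ N) {ω : Sample M}
    (hω : ω ∈ m.goodBlock π α θ j ε R s) : 1 ≤ m.deviation π α θ j ε N ω := by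
  obtain ⟨⟨halive, hlow, -⟩, hans⟩ := hω
  set a := m.step θ j θ with ha
  have ha0 : 0 < a := m.step_self_pos θ j
  set d := -m.step θ j θ.other with hd
  have hdC : d ≤ m.llrBound := by
    have := (abs_le.1 (m.abs_step_le θ j θ.other)).1
    linarith
  have hd0 : 0 < d := by linarith [m.step_other_neg θ j]
  by_contra hlt
  have hch : ∀ t < N, m.Alive π α ω t → π.chosen ω t = j := fun t ht hat => by
    by_contra hne
    exact hlt (m.one_le_deviation_of_other π α θ j hε N ω ht hat hne)
  set x := m.thr α θ - m.evid π θ ω s with hx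
  have hxC : x ≤ m.llrBound := by linarith
  have hceil : ∀ z, z ≤ 2 * m.llrBound → 1 + ⌈z / a⌉₊ ≤ R := by
    intro z hz
    have h1 : ⌈z / a⌉₊ ≤ ⌈2 * m.llrBound / a⌉₊ := Nat.ceil_mono (by gcongr)
    have h2 := Nat.ceil_lt_add_one (a := 2 * m.llrBound / a)
      (div_nonneg (by linarith [m.llrBound_nonneg]) ha0.le)
    have h3 : (⌈2 * m.llrBound / a⌉₊ : ℝ) + 1 < R := by linarith
    have h4 : ⌈2 * m.llrBound / a⌉₊ + 1 < R := by exact_mod_cast h3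
    omega
  have hC := m.llrBound_nonneg
  by_cases hfirst : ε ≤ overshoot a x
  · have hn : 1 + ⌈(m.thr α θ - m.evid π θ ω s) / m.step θ j θ⌉₊ ≤ R :=
      hceil x (by linarith)
    have hrun := m.stoppedEvid_of_run π α θ j ω s N halive
      (fun r hr hal => hch _ (by omega) hal)
      (fun r hr => by rw [hans r (by omega)]; simp [awaited, hfirst]) (by omega)
    exact hlt (m.one_le_deviation_of_overshoot π α θ j hε N ω (by rw [hrun]; linarith))
  · have hsecond := (hover x).resolve_left hfirst
    have hev : m.evid π θ ω (s + 1) = m.evid π θ ω s - d := by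
      have h0 := hceil x (by linarith)
      have h1 := hans 0 (by omega)
      rw [evid_succ, hch s (by omega) halive]
      simp only [add_zero] at h1
      rw [h1]
      simp [awaited, hfirst, hd]
    have hx' : m.thr α θ - m.evid π θ ω (s + 1) = x + d := by rw [hev]; ring
    have hn : 1 + ⌈(x + d) / m.step θ j θ⌉₊ ≤ R := hceil (x + d) (by linarith)
    have halive' : m.Alive π α ω (s + 1) := (m.alive_iff π α θ ω _).2 fun u hu => by
      have hs := (m.alive_iff π α θ ω _).1 halive
      rcases hu.lt_or_eq with hu | rfl
      · exact hs u (by omega)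
      · have := (hs s le_rfl).2
        rw [hev]
        constructor <;> linarith
    have hrun := m.stoppedEvid_of_run π α θ j ω (s + 1) N halive'
      (fun r hr hal => hch _ (by rw [hx'] at hr; omega) hal)
      (fun r hr => by
        rw [hx'] at hr
        have := hans (r + 1) (by omega)
        rw [add_assoc, add_comm 1 r, this]
        simp [awaited]) (by rw [hx']; omega)
    rw [hx'] at hrun
    exact hlt (m.one_le_deviation_of_overshoot π α θ j hε N ω (by rw [hrun]; linarith))

lemma measurableSet_goodBlock_and_measure_ge (π : Policy M) (α : ℝ) (θ : Label) (j : Fin M)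
    (ε : ℝ) {p : ℝ} (hp : 0 ≤ p) (hpy : ∀ z, p ≤ m.outProb j θ z) (R s : ℕ) :
    MeasurableSet (m.goodBlock π α θ j ε R s) ∧
      p ^ R * (m.law θ).real (m.entrance π α θ s)
        ≤ (m.law θ).real (m.goodBlock π α θ j ε R s) := by
  set F : Set (Sample M) :=
    {ω | ε ≤ overshoot (m.step θ j θ) (m.thr α θ - m.evid π θ ω s)} with hF
  have hFm : MeasurableSet[past M s] F :=
    ((measurable_overshoot _).comp ((m.measurable_past_evid π θ s).const_sub _)) measurableSet_Ici
  have hE := m.measurableSet_entrance π α θ s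
  obtain ⟨h1, h2⟩ := m.measure_pattern_ge θ j s (hE.inter hFm) (fun _ => θ) hp hpy R
  obtain ⟨h3, h4⟩ := m.measure_pattern_ge θ j s (hE.diff hFm)
    (fun r => if r = 0 then θ.other else θ) hp hpy R
  have hunion : m.goodBlock π α θ j ε R s
      = ((m.entrance π α θ s ∩ F) ∩ {ω | ∀ r < R, (ω (s + r) j).1 = θ})
        ∪ ((m.entrance π α θ s \ F)
          ∩ {ω | ∀ r < R, (ω (s + r) j).1 = if r = 0 then θ.other else θ}) := by
    ext ω
    by_cases hω : ε ≤ overshoot (m.step θ j θ) (m.thr α θ - m.evid π θ ω s)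
    · simp [goodBlock, awaited, hF, hω, not_lt.2 hω]
    · simp [goodBlock, awaited, hF, not_le.1 hω]
  have h1' := past_le _ _ h1
  have h3' := past_le _ _ h3
  have hdisj : Disjoint ((m.entrance π α θ s ∩ F) ∩ {ω | ∀ r < R, (ω (s + r) j).1 = θ})
      ((m.entrance π α θ s \ F)
        ∩ {ω | ∀ r < R, (ω (s + r) j).1 = if r = 0 then θ.other else θ}) :=
    Set.disjoint_left.2 fun ω ha hb => hb.1.2 ha.1.2
  rw [hunion]
  refine ⟨h1'.union h3', ?_⟩
  rw [measureReal_union hdisj h3',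
    ← measureReal_inter_add_sdiff (μ := m.law θ) (s := m.entrance π α θ s) (past_le _ _ hFm)]
  linarith

lemma sum_indicator_goodBlock_le (π : Policy M) (α : ℝ) (θ : Label) (j : Fin M) {ε : ℝ}
    (hε : 0 < ε) (hover : ∀ x, ε ≤ overshoot (m.step θ j θ) x
      ∨ ε ≤ overshoot (m.step θ j θ) (x + -m.step θ j θ.other))
    (hwide : 2 * m.llrBound < m.thr α θ + m.thr α θ.other)
    {R : ℕ} (hR : 2 * m.llrBound / m.step θ j θ + 2 ≤ R) (N : ℕ) (ω : Sample M) :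
    ∑ s ∈ Finset.range N, (m.goodBlock π α θ j ε R s).indicator (1 : Sample M → ℝ) ω
      ≤ m.deviation π α θ j ε (N + R) ω := by
  by_cases h : ∃ s < N, ω ∈ m.goodBlock π α θ j ε R s
  · obtain ⟨s, hs, hω⟩ := h
    rw [Finset.sum_eq_single_of_mem s (Finset.mem_range.2 hs) fun t _ hts =>
      Set.indicator_of_notMem (fun ht => hts (m.entrance_unique π α θ ht.1 hω.1)) _,
      Set.indicator_of_mem hω]
    exact m.one_le_deviation_of_mem_goodBlock π α θ j hε hover hwide hR (by omega) hω
  · push Not at h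
    rw [Finset.sum_eq_zero fun s hs =>
      Set.indicator_of_notMem (h s (Finset.mem_range.1 hs)) _]
    exact m.deviation_nonneg π α θ j hε _ ω

lemma one_sub_failInd_le (π : Policy M) (α : ℝ) (θ : Label) (hθ : 0 < m.thr α θ) (N : ℕ)
    (ω : Sample M) : 1 - m.failInd π α θ N ω
      ≤ ∑ s ∈ Finset.range N, (m.entrance π α θ s).indicator (1 : Sample M → ℝ) ω := by
  have hnn : ∀ s, 0 ≤ (m.entrance π α θ s).indicator (1 : Sample M → ℝ) ω := fun s =>
    Set.indicator_nonneg (fun _ _ => zero_le_one) _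
  have hsum := Finset.sum_nonneg fun s (_ : s ∈ Finset.range N) => hnn s
  by_cases h1 : m.Alive π α ω N
  · rw [failInd, aliveInd_of_alive _ h1]
    linarith [Set.indicator_nonneg (s := {ω | m.stoppedEvid π α θ N ω ≤ -m.thr α θ.other})
      (f := (1 : Sample M → ℝ)) (fun _ _ => zero_le_one) ω]
  by_cases h2 : m.stoppedEvid π α θ N ω ≤ -m.thr α θ.other
  · rw [failInd, Set.indicator_of_mem (by exact h2), Pi.one_apply]
    linarith [m.aliveInd_nonneg π α ω N]
  obtain ⟨s, hs, hω⟩ := m.exists_mem_entrance π α θ hθ N ω h1 h2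
  have h3 := Finset.single_le_sum (fun s (_ : s ∈ Finset.range N) => hnn s)
    (Finset.mem_range.2 hs)
  rw [Set.indicator_of_mem hω, Pi.one_apply] at h3
  linarith [m.failInd_nonneg π α θ N ω]

lemma integrable_deviation (π : Policy M) (α : ℝ) (θ : Label) (j : Fin M) (ε : ℝ) (N : ℕ) :
    Integrable (m.deviation π α θ j ε N) (m.law θ) := by
  classical
  unfold deviation
  exact (m.integrable_stoppedSum_const θ π α (fun i => if i = j then 0 else 1) N).add
    (((m.integrable_stoppedEvid θ π α N).sub
      ((m.integrable_stoppedEvid θ π α N).inf (integrable_const _))).div_const ε)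

/-- Unless the run fails, the evidence comes within one step of the threshold for the first time at
some time before `N`, and the awaited answers then follow with probability at least `p ^ R`. -/
lemma le_integral_deviation (π : Policy M) (α : ℝ) (θ : Label) (j : Fin M) {ε : ℝ}
    (hε : 0 < ε) (hover : ∀ x, ε ≤ overshoot (m.step θ j θ) x
      ∨ ε ≤ overshoot (m.step θ j θ) (x + -m.step θ j θ.other)) (hθ : 0 < m.thr α θ)
    (hwide : 2 * m.llrBound < m.thr α θ + m.thr α θ.other)
    {p : ℝ} (hp : 0 ≤ p) (hpy : ∀ z, p ≤ m.outProb j θ z)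
    {R : ℕ} (hR : 2 * m.llrBound / m.step θ j θ + 2 ≤ R) (N : ℕ) :
    p ^ R * (1 - Real.exp (-m.thr α θ.other) - ∫ ω, m.aliveInd π α ω N ∂(m.law θ))
      ≤ ∫ ω, m.deviation π α θ j ε (N + R) ω ∂(m.law θ) := by
  have hEm : ∀ s, MeasurableSet (m.entrance π α θ s) := fun s =>
    past_le _ _ (m.measurableSet_entrance π α θ s)
  have hG := fun s => m.measurableSet_goodBlock_and_measure_ge π α θ j ε hp hpy R s
  have hEi : ∀ s ∈ Finset.range N, Integrable
      (fun ω => (m.entrance π α θ s).indicator (1 : Sample M → ℝ) ω) (m.law θ) := fun s _ =>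
    (integrable_const (1 : ℝ)).indicator (hEm s)
  have hGi : ∀ s ∈ Finset.range N, Integrable
      (fun ω => (m.goodBlock π α θ j ε R s).indicator (1 : Sample M → ℝ) ω) (m.law θ) :=
    fun s _ =>
    (integrable_const (1 : ℝ)).indicator (hG s).1
  have h1 := integral_mono (integrable_finsetSum _ hGi) (m.integrable_deviation π α θ j ε (N + R))
    fun ω => m.sum_indicator_goodBlock_le π α θ j hε hover hwide hR N ω
  have h2 := integral_mono ((integrable_const 1).sub (m.integrable_failInd π α θ N))
    (integrable_finsetSum _ hEi) fun ω => m.one_sub_failInd_le π α θ hθ N ω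
  rw [integral_finsetSum _ hGi] at h1
  rw [integral_finsetSum _ hEi] at h2
  simp only [integral_indicator_one (hG _).1] at h1
  simp only [integral_indicator_one (hEm _), Pi.sub_apply] at h2
  rw [integral_sub (integrable_const _) (m.integrable_failInd π α θ N), integral_const,
    probReal_univ, one_smul] at h2
  have h3 := m.integral_failInd_le π α θ N
  refine le_trans ?_ h1
  calc _ ≤ p ^ R * ∑ s ∈ Finset.range N, (m.law θ).real (m.entrance π α θ s) := by
        gcongr
        linarith
    _ ≤ _ := by
        rw [Finset.mul_sum]
        exact Finset.sum_le_sum fun s _ => (hG s).2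

lemma step_self_eq_abs (θ : Label) (j : Fin M) : m.step θ j θ = |m.llr j θ| := by
  have h := m.step_self_pos θ j
  cases θ <;> simp only [step, Label.sign] at h ⊢ <;> grind

lemma neg_step_other_eq_abs (θ : Label) (j : Fin M) :
    -m.step θ j θ.other = |m.llr j θ.other| := by
  have h := m.step_other_neg θ j
  cases θ <;> simp only [step, Label.sign] at h ⊢ <;> grind

/-- With a linear penalty, whether a policy queries the best LLM or another one, it loses a constant:
the overshoot in the former case, the difference of the prices in the latter. -/
lemma exists_condRisk_ge_of_linear (θ : Label) (j : Fin M) (hρ : m.ρ = 1)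
    (hj : ∀ i, i ≠ j → (m.cost j + m.gCoef * m.meanWait j) / m.info j θ
      < (m.cost i + m.gCoef * m.meanWait i) / m.info i θ)
    (hk : ∀ k : ℕ, |m.llr j θ.other| ≠ k * |m.llr j θ|) :
    ∃ k, 0 < k ∧ ∀ᶠ α in 𝓝[>] (0 : ℝ), ∀ π : Policy M,
      ENNReal.ofReal (m.singleCost θ j (m.budget α θ) + k) ≤ m.condRisk π α θ := by
  classical
  have hI := m.info_pos j θ
  have hμ := m.meanWait_pos j
  have hc := m.cost_pos j
  have hg := m.gCoef_nonneg
  set q := (m.cost j + m.gCoef * m.meanWait j) / m.info j θ with hq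
  have hq0 : 0 < q := by positivity
  obtain ⟨u, hu, hu'⟩ := exists_pos_forall_le
    (fun i => if i = j then 1 else m.cost i + m.gCoef * m.meanWait i - q * m.info i θ) fun i => by
      by_cases hij : i = j
      · simp [hij]
      · have := hj i hij
        rw [lt_div_iff₀ (m.info_pos i θ)] at this
        simp only [hij, if_false]
        linarith
  obtain ⟨ε, hε, hover⟩ := exists_overshoot_ge (m.step_self_pos θ j)
    (d := -m.step θ j θ.other) (by linarith [m.step_other_neg θ j]) (by
      rw [m.step_self_eq_abs, m.neg_step_other_eq_abs]; exact hk)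
  obtain ⟨p, hp, hpy⟩ := exists_pos_forall_le (m.outProb j θ) (m.outProb_pos j θ)
  obtain ⟨R, hR⟩ := exists_nat_ge (2 * m.llrBound / m.step θ j θ + 2)
  set k₁ := min (q * ε) u with hk₁
  have hk₁0 : 0 < k₁ := lt_min (by positivity) hu
  refine ⟨k₁ * p ^ R / 2, by positivity, ?_⟩
  filter_upwards [m.eventually_thresholds (m.llrBound + 1) 1 one_pos] with α ⟨h0, h1, _, _, h4⟩ π
  have hC := m.llrBound_nonneg
  have ht := fun θ => (h4 θ).1.trans (h4 θ).2.1
  have hθ : 0 < m.thr α θ := by linarith [ht θ]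
  have hθ' : 0 < m.thr α θ.other := by linarith [ht θ.other]
  have hS : 0 < m.budget α θ := by linarith [(h4 θ).1]
  have hwide : 2 * m.llrBound < m.thr α θ + m.thr α θ.other := by linarith [ht θ, ht θ.other]
  set S := m.budget α θ with hSdef
  refine m.ofReal_le_condRisk_of_eventually π α θ _ (q * m.width α + k₁ * p ^ R)
    (Eventually.of_forall fun N => ?_)
  have hslope : m.slope θ j S = m.gCoef := by simp [slope, hρ]
  refine le_trans (ENNReal.ofReal_le_ofReal ?_)
    (m.ofReal_linearized_le_condRisk π α θ (mul_pos hμ (div_pos hS hI)) (y := m.gCoef)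
      (hslope.symm.trans rfl) (N + R))
  have hDi := m.integrable_stoppedEvid θ π α (N + R)
  have hmi : Integrable (fun ω => min (m.stoppedEvid π α θ (N + R) ω) (m.thr α θ)) (m.law θ) :=
    hDi.inf (integrable_const _)
  have hOi := m.integrable_stoppedSum_const θ π α (fun i => if i = j then 0 else 1) (N + R)
  have hIi := m.integrable_stoppedSum_const θ π α (fun i => m.info i θ) (N + R)
  have e1 : q * ∫ ω, m.stoppedEvid π α θ (N + R) ω ∂(m.law θ)
      + u * ∫ ω, m.stoppedSum π α (fun i _ => if i = j then 0 else 1) (N + R) ω ∂(m.law θ)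
      ≤ ∫ ω, m.stoppedSum π α (fun i _ => m.cost i + m.gCoef * m.meanWait i) (N + R) ω
        ∂(m.law θ) := by
    rw [integral_stoppedEvid, ← integral_const_mul, ← integral_const_mul,
      ← integral_add (hIi.const_mul q) (hOi.const_mul u)]
    refine integral_mono ((hIi.const_mul q).add (hOi.const_mul u))
      (m.integrable_stoppedSum_const θ π α _ _) fun ω => ?_
    dsimp only
    rw [← stoppedSum_const_mul, ← stoppedSum_const_mul, ← stoppedSum_add]
    refine m.stoppedSum_le π α (fun i _ => ?_) _ ω
    by_cases hij : i = j
    · subst hij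
      rw [hq, div_mul_cancel₀ _ hI.ne']
      simp
    · have := hu' i
      simp only [hij, if_false] at this ⊢
      linarith
  have e2 : q * ∫ ω, min (m.stoppedEvid π α θ (N + R) ω) (m.thr α θ) ∂(m.law θ)
      + k₁ * ∫ ω, m.deviation π α θ j ε (N + R) ω ∂(m.law θ)
      ≤ q * ∫ ω, m.stoppedEvid π α θ (N + R) ω ∂(m.law θ)
      + u * ∫ ω, m.stoppedSum π α (fun i _ => if i = j then 0 else 1) (N + R) ω ∂(m.law θ) := by
    have hdi := m.integrable_deviation π α θ j ε (N + R)
    simp only [← integral_const_mul]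
    rw [← integral_add (hmi.const_mul q) (hdi.const_mul k₁),
      ← integral_add (hDi.const_mul q) (hOi.const_mul u)]
    refine integral_mono ((hmi.const_mul q).add (hdi.const_mul k₁))
      ((hDi.const_mul q).add (hOi.const_mul u)) fun ω => ?_
    have h5 : 0 ≤ m.stoppedSum π α (fun i _ => if i = j then 0 else 1) (N + R) ω :=
      m.stoppedSum_nonneg π α (fun i _ => by split_ifs <;> simp) _ ω
    set D := m.stoppedEvid π α θ (N + R) ω with hD
    have h6 : 0 ≤ D - min D (m.thr α θ) := by linarith [min_le_left D (m.thr α θ)]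
    have h7 : k₁ * ((D - min D (m.thr α θ)) / ε) ≤ q * (D - min D (m.thr α θ)) := by
      calc _ ≤ (q * ε) * ((D - min D (m.thr α θ)) / ε) := by
            gcongr
            exact min_le_left _ _
        _ = _ := by field_simp
    have h8 := mul_le_mul_of_nonneg_right (min_le_right (q * ε) u) h5
    simp only [deviation, ← hD]
    rw [← hk₁] at h8
    linarith
  have e3 := m.le_integral_deviation π α θ j hε hover hθ hwide hp.le hpy hR N
  have e4 := m.budget_le_integral π h0 h1 θ hθ hθ' (N + R)
  have e5 := m.thr_sub_le_integral_min π α θ hθ hθ' (N + R)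
  have e6 : ∫ ω, m.aliveInd π α ω (N + R) ∂(m.law θ) ≤ ∫ ω, m.aliveInd π α ω N ∂(m.law θ) :=
    integral_mono (m.integrable_aliveInd θ π α _) (m.integrable_aliveInd θ π α _) fun ω => by
      by_cases hal : m.Alive π α ω (N + R)
      · dsimp only
        rw [aliveInd_of_alive _ hal, aliveInd_of_alive _ (hal.mono m (by omega))]
      · dsimp only
        rw [aliveInd_of_not _ hal]
        exact m.aliveInd_nonneg _ _ _ _
  have e7 : Real.exp (-m.thr α θ.other) ≤ 1 / 2 := by
    have h5 := Real.add_one_le_exp (m.thr α θ.other)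
    rw [Real.exp_neg, one_div]
    exact inv_anti₀ two_pos (by linarith [ht θ.other])
  have hw0 : 0 ≤ m.width α := by linarith [m.width_eq α θ]
  have e8 := mul_le_mul_of_nonneg_left (e4.trans e5) hq0.le
  have e9 := mul_le_mul_of_nonneg_left e3 hk₁0.le
  have e10 := mul_le_mul_of_nonneg_left e6 (mul_nonneg hq0.le hw0)
  have e11 := mul_le_mul_of_nonneg_left e7 (mul_nonneg hk₁0.le (pow_nonneg hp.le R))
  rw [singleCost_eq, hslope, ← hq]
  rw [← hSdef] at e8
  linarith

/-! ### Tightness of the remainder -/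

/-- A gain over the single-LLM cost under one hypothesis is a gain over the benchmark. -/
lemma exists_risk_ge_of_condRisk_ge (J : Label → Fin M) (hJ : ∀ θ, m.Dominant θ (J θ)) (θ : Label)
    {k : ℝ} (hk : 0 < k) (h : ∀ᶠ α in 𝓝[>] (0 : ℝ), ∀ π : Policy M,
      ENNReal.ofReal (m.singleCost θ (J θ) (m.budget α θ) + k * m.budget α θ ^ (m.ρ - 1))
        ≤ m.condRisk π α θ) :
    ∃ k : ℝ, 0 < k ∧ ∀ᶠ α in 𝓝[>] (0 : ℝ), ∀ π : Policy M,
      ENNReal.ofReal (m.benchmark α + k * Real.log (1 / α) ^ (m.ρ - 1)) ≤ m.risk π α := by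
  choose S₁ hdom using fun θ => eventually_atTop.1 (hJ θ)
  have hρ : 0 ≤ m.ρ - 1 := by linarith [m.one_le_ρ]
  have hprior := m.prior_pos θ
  refine ⟨m.prior θ * (k * (1 / 2) ^ (m.ρ - 1)), by positivity, ?_⟩
  filter_upwards [h, m.eventually_thresholds (max 1 (max (S₁ Label.A) (S₁ Label.B))) 1 one_pos]
    with α hα ⟨h0, h1, hΛ, _, h4⟩ π
  have hS1 : ∀ θ, 1 ≤ m.budget α θ := fun θ => (le_max_left _ _).trans (h4 θ).1
  have hS2 : ∀ θ, S₁ θ ≤ m.budget α θ := fun θ => le_trans (by cases θ <;> simp) (h4 θ).1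
  have hthr : ∀ θ, 0 < m.thr α θ := fun θ => by linarith [hS1 θ, (h4 θ).2.1]
  have hΛ0 : 0 ≤ Real.log (1 / α) := by linarith [(le_max_left _ _).trans hΛ]
  set gain := k * m.budget α θ ^ (m.ρ - 1) with hgain
  have hgain0 : 0 ≤ gain := mul_nonneg hk.le (Real.rpow_nonneg (by linarith [hS1 θ]) _)
  have hle : k * (1 / 2) ^ (m.ρ - 1) * Real.log (1 / α) ^ (m.ρ - 1) ≤ gain := by
    rw [hgain, mul_assoc, ← Real.mul_rpow (by norm_num) hΛ0]
    have := (h4 θ).2.2.2.1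
    gcongr
    linarith
  have hbench := m.benchmark_le J α fun θ => by linarith [hS1 θ]
  have hrisk := m.le_risk π α
    (fun η => m.singleCost η (J η) (m.budget α η) + if η = θ then gain else 0)
    (fun η => add_nonneg (m.singleCost_nonneg η (J η) (by linarith [hS1 η]))
      (by split_ifs <;> simp [hgain0])) fun η => by
      by_cases hη : η = θ
      · subst hη
        simpa using hα π
      · simpa [hη] using m.singleCost_le_condRisk π h0 h1 η (hthr _) (hthr _) (J η)
          (by linarith [hS1 η]) (hdom η _ (hS2 η))
  refine le_trans (ENNReal.ofReal_le_ofReal ?_) hrisk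
  have hle' := mul_le_mul_of_nonneg_left hle hprior.le
  cases θ <;> simp only [reduceCtorEq, if_true, if_false, add_zero] <;> linarith

end Model
end SeqTest

theorem theorem1 {M : ℕ} (hM : 0 < M) (m : SeqTest.Model M) :
    (∃ jA jB : Fin M,
      (∀ᶠ α in 𝓝[>] (0 : ℝ), m.risk (m.twoLLM jA jB) α ≠ ⊤) ∧
      (fun α : ℝ => (m.risk (m.twoLLM jA jB) α).toReal - m.benchmark α)
        =O[𝓝[>] (0 : ℝ)] (fun α : ℝ => Real.log (1 / α) ^ (m.ρ - 1))) ∧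
    ((1 < m.ρ ∧ 0 < m.gCoef) ∨ (m.ρ = 1 ∧ m.LinearNondegenerate) →
      ∃ k : ℝ, 0 < k ∧ ∀ᶠ α in 𝓝[>] (0 : ℝ), ∀ π : SeqTest.Policy M,
        ENNReal.ofReal (m.benchmark α + k * Real.log (1 / α) ^ (m.ρ - 1)) ≤ m.risk π α) := by
  have : NeZero M := ⟨hM.ne'⟩
  choose J hJ using m.exists_dominant
  refine ⟨⟨J SeqTest.Label.A, J SeqTest.Label.B, m.twoLLM_isBigO J hJ⟩, ?_⟩
  rintro (⟨hρ, hg⟩ | ⟨hρ, θ, j, hj, hk⟩)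
  · choose J' hJ' using m.exists_dominatesAt_atTop
    obtain ⟨k, hk, h⟩ :=
      m.exists_condRisk_ge_of_superlinear SeqTest.Label.A (J' SeqTest.Label.A) hρ hg (hJ' _)
    exact m.exists_risk_ge_of_condRisk_ge J'
      (fun θ => (m.tendsto_slope θ (J' θ) hρ hg).eventually (hJ' θ)) SeqTest.Label.A hk h
  · obtain ⟨k, hk, h⟩ := m.exists_condRisk_ge_of_linear θ j hρ hj hk
    have hdom : m.Dominant θ j := Eventually.of_forall fun S i => by
      have hslope : m.slope θ j S = m.gCoef := by simp [SeqTest.Model.slope, hρ]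
      rw [hslope]
      by_cases hij : i = j
      · rw [hij]
      · exact ((div_lt_div_iff₀ (m.info_pos j θ) (m.info_pos i θ)).1 (hj i hij)).le
    refine m.exists_risk_ge_of_condRisk_ge (fun η => if η = θ then j else J η)
      (fun η => ?_) θ hk ?_
    · by_cases hη : η = θ
      · subst hη
        simpa using hdom
      · simpa [hη] using hJ η
    · simpa [hρ] using h
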